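/- Let $\mathbb K$ be a field and $n\ge 2$. All gradings are $\mathbb Z_2$-gradings, $|x|$ is the degree of a homogeneous element $x$, and identities involving degrees are required for homogeneous elements. An $n$-ary multiplicative Hom-Nambu-Lie superalgebra is a graded vector space $\mathfrak g=\mathfrak g_{\bar 0}\oplus\mathfrak g_{\bar 1}$ with an even linear map $\alpha$ and an $n$-linear bracket such that $|[x_1,\dots,x_n]|=\sum_i|x_i|$, $[\dots,x_i,x_{i+1},\dots]=-(-1)^{|x_i||x_{i+1}|}[\dots,x_{i+1},x_i,\dots]$, $\alpha[x_1,\dots,x_n]=[\alpha(x_1),\dots,\alpha(x_n)]$ and $$[\alpha(x_1),\dots,\alpha(x_{n-1}),[y_1,\dots,y_n]]=\sum_{i=1}^n(-1)^{(|x_1|+\dots+|x_{n-1}|)(|y_1|+\dots+|y_{i-1}|)}[\alpha(y_1),\dots,[x_1,\dots,x_{n-1},y_i],\dots,\alpha(y_n)].$$ Here $\mathfrak g^{\wedge (n-1)}$ is the quotient of $\mathfrak g^{\otimes (n-1)}$ by the same adjacent super-skewsymmetry relations. For $\mathbf x=x_1\wedge\dots\wedge x_{n-1}$ and $\mathbf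 y=y_1\wedge\dots\wedge y_{n-1}$ put $|\mathbf x|=\sum_i|x_i|$, $\alpha(\mathbf x)=\alpha(x_1)\wedge\dots\wedge\alpha(x_{n-1})$, $\mathbf x\cdot z=[x_1,\dots,x_{n-1},z]$ and $$[\mathbf x,\mathbf y]_\alpha=\sum_{i=1}^{n-1}(-1)^{|\mathbf x|(|y_1|+\dots+|y_{i-1}|)}\alpha(y_1)\wedge\dots\wedge\mathbf x\cdot y_i\wedge\dots\wedge\alpha(y_{n-1}).$$ A graded $\mathfrak g$-module $(V,\nu)$ is a graded vector space $V$ with an even $\nu\in\mathrm{End}(V)$ and a linear map $\rho:\mathfrak g^{\wedge (n-1)}\to\mathrm{End}(V)$, $\mathbf x\cdot v:=\rho(\mathbf x)v$, such that $\rho(\mathbf x)V_\beta\subseteq V_{\beta+|\mathbf x|}$, $\nu\circ\rho(\mathbf x)=\rho(\alpha(\mathbf x))\circ\nu$, $\rho(\alpha(\mathbf x))\rho(\mathbf y)=(-1)^{|\mathbf x||\mathbf y|}\rho(\alpha(\mathbf y))\rho(\mathbf x)+\rho([\mathbf x,\mathbf y]_\alpha)\circ\nu$ and $$\rho(\alpha(x_1),\dots,\alpha(x_{n-2}),[y_1,\dots,y_n])\circ\nu=\sum_{i=1}^n(-1)^{n-i+(|x_1|+\dots+|x_{n-2}|)\sum_{j\ne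 i}|y_j|+|y_i|\sum_{j>i}|y_j|}\rho(\alpha(y_1),\dots,\widehat{\alpha(y_i)},\dots,\alpha(y_n))\,\rho(x_1,\dots,x_{n-2},y_i).$$ The bracket is extended super-skewsymmetrically to one argument in $V$ by $[x_1,\dots,x_{n-1},v]=\rho(\mathbf x)v$. For $m\ge0$, $C^m(\mathfrak g,V)$ is the space of $(m+1)$-linear maps $f(\mathbf x_1,\dots,\mathbf x_m,z)\in V$, $\mathbf x_i\in\mathfrak g^{\wedge (n-1)}$, $z\in\mathfrak g$, that are super-skewsymmetric in the $n$ entries of $(\mathbf x_m,z)$ (if $m\ge1$) and satisfy $\nu f(\mathbf x_1,\dots,\mathbf x_m,z)=f(\alpha(\mathbf x_1),\dots,\alpha(\mathbf x_m),\alpha(z))$. It is graded by the degree $|f|$. Let $\delta^m$ be the linear map given for homogeneous $f$ and homogeneous arguments, $\mathbf x_i=\mathbf x_i^1\wedge\dots\wedge\mathbf x_i^{n-1}$, by $$\begin{aligned}(\delta^mf)(\mathbf x_1,\dots,\mathbf x_{m+1},z)=&\sum_{i<j}(-1)^{i+|\mathbf x_i|(|\mathbf x_{i+1}|+\dots+|\mathbf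 x_{j-1}|)}f(\alpha(\mathbf x_1),\dots,\widehat{\alpha(\mathbf x_i)},\dots,[\mathbf x_i,\mathbf x_j]_\alpha,\dots,\alpha(\mathbf x_{m+1}),\alpha(z))\\&+\sum_{i=1}^{m+1}(-1)^{i+|\mathbf x_i|(|\mathbf x_{i+1}|+\dots+|\mathbf x_{m+1}|)}f(\alpha(\mathbf x_1),\dots,\widehat{\alpha(\mathbf x_i)},\dots,\alpha(\mathbf x_{m+1}),\mathbf x_i\cdot z)\\&+\sum_{i=1}^{m+1}(-1)^{i+1+|\mathbf x_i|(|f|+|\mathbf x_1|+\dots+|\mathbf x_{i-1}|)}\alpha^m(\mathbf x_i)\cdot f(\mathbf x_1,\dots,\widehat{\mathbf x_i},\dots,\mathbf x_{m+1},z)\\&+(-1)^m\sum_{i=1}^{n-1}(-1)^{(|f|+|\mathbf x_1|+\dots+|\mathbf x_m|)(|\mathbf x_{m+1}^1|+\dots+|\mathbf x_{m+1}^{i-1}|)}[\alpha^m(\mathbf x_{m+1}^1),\dots,f(\mathbf x_1,\dots,\mathbf x_m,\mathbf x_{m+1}^i),\dots,\alpha^m(\mathbf x_{m+1}^{n-1}),\alpha^m(z)].\end{aligned}$$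 **Theorem.** Let $(\mathfrak g,[\cdot,\dots,\cdot],\alpha)$ be an $n$-ary multiplicative Hom-Nambu-Lie superalgebra and $(V,\nu)$ a graded $\mathfrak g$-module. For every $m\ge0$, $\delta^m$ is a well-defined even linear map $C^m(\mathfrak g,V)\to C^{m+1}(\mathfrak g,V)$, and $\delta^{m+1}\circ\delta^m=0$. Consequently, with $Z^m=\ker\delta^m$, $B^0=0$ and $B^{m}=\delta^{m-1}C^{m-1}(\mathfrak g,V)$ for $m\ge1$, both $Z^m$ and $B^m$ are graded subspaces of $C^m(\mathfrak g,V)$ with $B^m\subseteq Z^m$, and $H^m(\mathfrak g,V)=Z^m/B^m$ is graded by the classes of homogeneous cocycles. If $\mathfrak g$ and $V$ are purely even, $C^m(\mathfrak g,V)$ and $\delta^m$ are the cochains and the coboundary of $n$-ary multiplicative Hom-Nambu-Lie algebras (the definitions above with all degrees $0$); if $\alpha=\mathrm{id}$ and $\nu=\mathrm{id}$, they are those of $n$-Lie superalgebras (the definitions above with $\alpha$ and $\nu$ removed). -/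

import Mathlib

/-! Cohomology of `n`-ary multiplicative Hom-Nambu-Lie superalgebras, with `n = k + 2 ≥ 2`.
A `ℤ₂`-graded vector space is a vector space with a decomposition indexed by `ZMod 2`.
A (pure) fundamental object `x₁ ∧ ⋯ ∧ x_{n-1}` is given by the tuple `Fin (k + 1) → g`; a linear map
out of the super-exterior power is a multilinear map with the super-skewsymmetry relation for each
adjacent transposition. -/

/-- The sign `(-1)^a`, for a parity `a`. -/
def sgn (a : ZMod 2) : ℤˣ := (-1) ^ a

/-- Homogeneous component of degree `a` of a vector. -/
def gradedProj {K W : Type*} [Field K] [AddCommGroup W] [Module K W]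
    (𝒲 : ZMod 2 → Submodule K W) [DirectSum.Decomposition 𝒲] (a : ZMod 2) (w : W) : W :=
  (DirectSum.decompose 𝒲 w a : W)

/-- The tuple `(x₁, …, x_p, z)`. -/
def snocTuple {W : Type*} {p : ℕ} (x : Fin p → W) (z : W) : Fin (p + 1) → W :=
  Fin.snoc (α := fun _ => W) x z

/-- The tuple `x` with the entries at the positions `p` and `p + 1` exchanged. -/
def swapAdj {W : Type*} {r : ℕ} (x : Fin (r + 1) → W) (p : Fin r) : Fin (r + 1) → W :=
  x ∘ Equiv.swap p.castSucc p.succ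

/-- An `n`-ary multiplicative Hom-Nambu-Lie superalgebra structure, `n = k + 2`, on the
`ℤ₂`-graded vector space `g = 𝒢 0 ⊕ 𝒢 1`. -/
structure HomNambuLieSuperalgebra {K g : Type*} [Field K] [AddCommGroup g] [Module K g]
    (𝒢 : ZMod 2 → Submodule K g) (k : ℕ) where
  bracket : MultilinearMap K (fun _ : Fin (k + 2) => g) g
  α : Module.End K g
  α_mem : ∀ (a : ZMod 2) (x : g), x ∈ 𝒢 a → α x ∈ 𝒢 a
  bracket_mem : ∀ (d : Fin (k + 2) → ZMod 2) (x : Fin (k + 2) → g), (∀ i, x i ∈ 𝒢 (d i)) →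
    bracket x ∈ 𝒢 (∑ i, d i)
  bracket_swap : ∀ (d : Fin (k + 2) → ZMod 2) (x : Fin (k + 2) → g), (∀ i, x i ∈ 𝒢 (d i)) →
    ∀ i : Fin (k + 1), bracket x = -(sgn (d i.castSucc * d i.succ) • bracket (swapAdj x i))
  /-- The Hom-Nambu (fundamental) identity. -/
  fundamental : ∀ (a : Fin (k + 1) → ZMod 2) (x : Fin (k + 1) → g)
    (b : Fin (k + 2) → ZMod 2) (y : Fin (k + 2) → g),
    (∀ i, x i ∈ 𝒢 (a i)) → (∀ i, y i ∈ 𝒢 (b i)) →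
    bracket (snocTuple (fun j => α (x j)) (bracket y)) =
      ∑ i, sgn ((∑ j, a j) * ∑ j ∈ Finset.Iio i, b j) •
        bracket (Function.update (fun j => α (y j)) i (bracket (snocTuple x (y i))))
  /-- Multiplicativity. -/
  α_bracket : ∀ x : Fin (k + 2) → g, α (bracket x) = bracket (fun i => α (x i))

namespace HomNambuLieSuperalgebra

section

variable {K g V : Type*} [Field K] [AddCommGroup g] [Module K g] [AddCommGroup V] [Module K V]
  {𝒢 : ZMod 2 → Submodule K g} {k : ℕ}

/-- `x · z = [x₁, …, x_{n-1}, z]`. -/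
def act (L : HomNambuLieSuperalgebra 𝒢 k) (x : Fin (k + 1) → g) (z : g) : g :=
  L.bracket (snocTuple x z)

/-- `α(x) = α(x₁) ∧ ⋯ ∧ α(x_{n-1})`. -/
def alphaT (L : HomNambuLieSuperalgebra 𝒢 k) (x : Fin (k + 1) → g) : Fin (k + 1) → g :=
  fun l => L.α (x l)

/-- The `l`-th wedge `α(y₁) ∧ ⋯ ∧ x · y_l ∧ ⋯ ∧ α(y_{n-1})` in the bracket
`[x, y]_α = ∑ l, (-1)^{|x|(|y₁| + ⋯ + |y_{l-1}|)} (α(y₁) ∧ ⋯ ∧ x · y_l ∧ ⋯ ∧ α(y_{n-1}))`. -/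
def wedgeTerm (L : HomNambuLieSuperalgebra 𝒢 k) (x y : Fin (k + 1) → g) (l : Fin (k + 1)) :
    Fin (k + 1) → g :=
  Function.update (L.alphaT y) l (L.act x (y l))

/-- A graded `g`-module `(V, ν)`. The fields `ν_mem` and `ν_ρ` say that `α + ν` is even and
multiplicative on `g ⊕ V`. -/
structure GradedModule (L : HomNambuLieSuperalgebra 𝒢 k) (𝒱 : ZMod 2 → Submodule K V) where
  ρ : MultilinearMap K (fun _ : Fin (k + 1) => g) (Module.End K V)
  ν : Module.End K V
  ν_mem : ∀ (a : ZMod 2) (v : V), v ∈ 𝒱 a → ν v ∈ 𝒱 a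
  ν_ρ : ∀ (x : Fin (k + 1) → g) (v : V), ν (ρ x v) = ρ (L.alphaT x) (ν v)
  ρ_swap : ∀ (d : Fin (k + 1) → ZMod 2) (x : Fin (k + 1) → g), (∀ i, x i ∈ 𝒢 (d i)) →
    ∀ i : Fin k, ρ x = -(sgn (d i.castSucc * d i.succ) • ρ (swapAdj x i))
  ρ_mem : ∀ (d : Fin (k + 1) → ZMod 2) (x : Fin (k + 1) → g) (b : ZMod 2) (v : V),
    (∀ i, x i ∈ 𝒢 (d i)) → v ∈ 𝒱 b → ρ x v ∈ 𝒱 (b + ∑ i, d i)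
  /-- `ρ(α(x)) ρ(y) = (-1)^{|x||y|} ρ(α(y)) ρ(x) + ρ([x, y]_α) ∘ ν`. -/
  ρ_comp : ∀ (a b : Fin (k + 1) → ZMod 2) (x y : Fin (k + 1) → g),
    (∀ i, x i ∈ 𝒢 (a i)) → (∀ i, y i ∈ 𝒢 (b i)) → ∀ v : V,
    ρ (L.alphaT x) (ρ y v) =
      sgn ((∑ i, a i) * ∑ i, b i) • ρ (L.alphaT y) (ρ x v) +
        ∑ l, sgn ((∑ i, a i) * ∑ j ∈ Finset.Iio l, b j) • ρ (L.wedgeTerm x y l) (ν v)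
  /-- The formula for `ρ(α(x₁), …, α(x_{n-2}), [y₁, …, y_n]) ∘ ν`. -/
  ρ_bracket : ∀ (a : Fin k → ZMod 2) (x : Fin k → g) (b : Fin (k + 2) → ZMod 2)
    (y : Fin (k + 2) → g), (∀ i, x i ∈ 𝒢 (a i)) → (∀ i, y i ∈ 𝒢 (b i)) → ∀ v : V,
    ρ (snocTuple (fun j => L.α (x j)) (L.bracket y)) (ν v) =
      ∑ i : Fin (k + 2),
        sgn (((k + 1 - (i : ℕ) : ℕ) : ZMod 2) + (∑ j, a j) * (∑ j : Fin (k + 1), b (i.succAbove j))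
            + b i * ∑ j ∈ Finset.Ioi i, b j) •
          ρ (fun j => L.α (y (i.succAbove j))) (ρ (snocTuple x (y i)) v)

end

end HomNambuLieSuperalgebra

/-- Functions of `m` fundamental objects and one further element of `g`. -/
abbrev RawCochain (g V : Type*) (k m : ℕ) : Type _ := (Fin m → Fin (k + 1) → g) → g → V

/-- All entries of the arguments `(X₁, …, X_m, z)` are homogeneous, of the degrees `D`, `c`. -/
def HomogArgs {K g : Type*} [Field K] [AddCommGroup g] [Module K g]
    (𝒢 : ZMod 2 → Submodule K g) {k m : ℕ} (D : Fin m → Fin (k + 1) → ZMod 2) (c : ZMod 2)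
    (X : Fin m → Fin (k + 1) → g) (z : g) : Prop :=
  (∀ i l, X i l ∈ 𝒢 (D i l)) ∧ z ∈ 𝒢 c

/-- The arguments with the entries of the `i`-th fundamental object at the positions `p` and
`p + 1` exchanged. -/
def swapIn {g : Type*} {k m : ℕ} (X : Fin m → Fin (k + 1) → g) (i : Fin m) (p : Fin k) :
    Fin m → Fin (k + 1) → g :=
  Function.update X i (swapAdj (X i) p)

/-- The fundamental objects with the last entry of the `i`-th one replaced by `z`. -/
def replaceLast {g : Type*} {k m : ℕ} (X : Fin m → Fin (k + 1) → g) (i : Fin m) (z : g) :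
    Fin m → Fin (k + 1) → g :=
  Function.update X i (Function.update (X i) (Fin.last k) z)

/-- Linearity in each entry of each fundamental object, and in the last variable. -/
def IsMultilinearCochain (K : Type*) {g V : Type*} [Field K] [AddCommGroup g] [Module K g]
    [AddCommGroup V] [Module K V] {k m : ℕ} (f : RawCochain g V k m) : Prop :=
  (∀ X z i l, IsLinearMap K fun y => f (Function.update X i (Function.update (X i) l y)) z) ∧
    ∀ X, IsLinearMap K (f X)

/-- `f` is a map on `(g^{∧(n-1)})^{⊗m} ∧ g`: super-skewsymmetric in the entries of each
fundamental object, and in the entries of the last fundamental object together with `z`. -/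
def IsSuperSkew {K g V : Type*} [Field K] [AddCommGroup g] [Module K g]
    [AddCommGroup V] [Module K V] (𝒢 : ZMod 2 → Submodule K g) {k m : ℕ}
    (f : RawCochain g V k m) : Prop :=
  ∀ (D : Fin m → Fin (k + 1) → ZMod 2) (c : ZMod 2) (X : Fin m → Fin (k + 1) → g) (z : g),
    HomogArgs 𝒢 D c X z →
    (∀ (i : Fin m) (p : Fin k),
      f X z = -(sgn (D i p.castSucc * D i p.succ) • f (swapIn X i p) z)) ∧
    ∀ i : Fin m, (i : ℕ) + 1 = m →
      f X z = -(sgn (D i (Fin.last k) * c) • f (replaceLast X i z) (X i (Fin.last k)))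

section

variable {K g V : Type*} [Field K] [AddCommGroup g] [Module K g] [AddCommGroup V] [Module K V]
  {𝒢 : ZMod 2 → Submodule K g} {𝒱 : ZMod 2 → Submodule K V} {k : ℕ}
  {L : HomNambuLieSuperalgebra 𝒢 k}

/-- The space `C^m(g, V)` of `m`-cochains. -/
def cochains (M : L.GradedModule 𝒱) (m : ℕ) : Submodule K (RawCochain g V k m) where
  carrier := {f | IsMultilinearCochain K f ∧ IsSuperSkew 𝒢 f ∧
    ∀ X z, M.ν (f X z) = f (fun i => L.alphaT (X i)) (L.α z)}
  zero_mem' := by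
    refine ⟨⟨fun X z i l => ⟨fun _ _ => ?_, fun _ _ => ?_⟩, fun X => ⟨fun _ _ => ?_, fun _ _ => ?_⟩⟩,
      fun D c X z _ => ⟨fun i p => ?_, fun i hi => ?_⟩, fun X z => ?_⟩ <;> simp
  add_mem' := by
    rintro f f' ⟨⟨h1, h2⟩, h3, h4⟩ ⟨⟨h1', h2'⟩, h3', h4'⟩
    refine ⟨⟨fun X z i l => ?_, fun X => ?_⟩, fun D c X z h => ⟨fun i p => ?_, fun i hi => ?_⟩,
      fun X z => ?_⟩
    · exact ((h1 X z i l).mk' _ + (h1' X z i l).mk' _).isLinear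
    · exact ((h2 X).mk' _ + (h2' X).mk' _).isLinear
    · simp only [Pi.add_apply, smul_add, neg_add]
      rw [← (h3 D c X z h).1 i p, ← (h3' D c X z h).1 i p]
    · simp only [Pi.add_apply, smul_add, neg_add]
      rw [← (h3 D c X z h).2 i hi, ← (h3' D c X z h).2 i hi]
    · simp only [Pi.add_apply, map_add, h4, h4']
  smul_mem' := by
    rintro r f ⟨⟨h1, h2⟩, h3, h4⟩
    refine ⟨⟨fun X z i l => ?_, fun X => ?_⟩, fun D c X z h => ⟨fun i p => ?_, fun i hi => ?_⟩,
      fun X z => ?_⟩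
    · exact (r • (h1 X z i l).mk' _).isLinear
    · exact (r • (h2 X).mk' _).isLinear
    · simp only [Pi.smul_apply]
      rw [smul_comm, ← smul_neg, ← (h3 D c X z h).1 i p]
    · simp only [Pi.smul_apply]
      rw [smul_comm, ← smul_neg, ← (h3 D c X z h).2 i hi]
    · simp only [Pi.smul_apply, map_smul, h4]

/-- `f` is homogeneous of degree `e`. -/
def IsHomogCochain (𝒢 : ZMod 2 → Submodule K g) (𝒱 : ZMod 2 → Submodule K V) {m : ℕ}
    (e : ZMod 2) (f : RawCochain g V k m) : Prop :=
  ∀ (D : Fin m → Fin (k + 1) → ZMod 2) (c : ZMod 2) (X : Fin m → Fin (k + 1) → g) (z : g),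
    HomogArgs 𝒢 D c X z → f X z ∈ 𝒱 (e + (∑ i, ∑ l, D i l) + c)

/-- The component of degree `e` of `f`: on homogeneous arguments of total degree `d`, take the
component of degree `e + d` of the value of `f`; extend additively. -/
def cochainComponent (𝒢 : ZMod 2 → Submodule K g) [DirectSum.Decomposition 𝒢]
    (𝒱 : ZMod 2 → Submodule K V) [DirectSum.Decomposition 𝒱] {m : ℕ} (e : ZMod 2)
    (f : RawCochain g V k m) : RawCochain g V k m := fun X z =>
  ∑ D : Fin m → Fin (k + 1) → ZMod 2, ∑ c : ZMod 2,
    gradedProj 𝒱 (e + (∑ i, ∑ l, D i l) + c)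
      (f (fun i l => gradedProj 𝒢 (D i l) (X i l)) (gradedProj 𝒢 c z))

/-- The bracket `[y₁, …, v, …, y_n]` on `g ⊕ V` with `v ∈ V` at position `p`, where `|v| = a`
and `|y_j| = b j`: it is determined by super-skewsymmetry and `[x₁, …, x_{n-1}, v] = ρ(x) v`.
The entry `y p` is not used. -/
def mixedBracket (M : L.GradedModule 𝒱) (b : Fin (k + 2) → ZMod 2) (y : Fin (k + 2) → g)
    (p : Fin (k + 2)) (a : ZMod 2) (v : V) : V :=
  sgn (((k + 1 - (p : ℕ) : ℕ) : ZMod 2) + a * ∑ j ∈ Finset.Ioi p, b j) •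
    M.ρ (fun j => y (p.succAbove j)) v

/-- The defining formula of the coboundary `(δ^m f)(X₁, …, X_{m+1}, z)` for `f` homogeneous of
degree `e` and homogeneous arguments of degrees `D`, `c`. Indices start at `0` here, so that
`(-1)^i` becomes `(-1)^(i+1)`. -/
def coboundaryFormula (M : L.GradedModule 𝒱) {m : ℕ} (e : ZMod 2)
    (D : Fin (m + 1) → Fin (k + 1) → ZMod 2) (c : ZMod 2) (f : RawCochain g V k m)
    (X : Fin (m + 1) → Fin (k + 1) → g) (z : g) : V :=
  (∑ i : Fin (m + 1), ∑ j ∈ Finset.Ioi i,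
    sgn (((i : ℕ) + 1 : ZMod 2) + (∑ l, D i l) * ∑ b ∈ Finset.Ioo i j, ∑ l, D b l) •
      ∑ l : Fin (k + 1), sgn ((∑ q, D i q) * ∑ q ∈ Finset.Iio l, D j q) •
        f (fun b => Function.update (fun b' => L.alphaT (X b')) j (L.wedgeTerm (X i) (X j) l)
            (i.succAbove b)) (L.α z)) +
  (∑ i : Fin (m + 1),
    sgn (((i : ℕ) + 1 : ZMod 2) + (∑ l, D i l) * ∑ b ∈ Finset.Ioi i, ∑ l, D b l) •
      f (fun b => L.alphaT (X (i.succAbove b))) (L.act (X i) z)) +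
  (∑ i : Fin (m + 1),
    sgn (((i : ℕ) + 2 : ZMod 2) + (∑ l, D i l) * (e + ∑ b ∈ Finset.Iio i, ∑ l, D b l)) •
      M.ρ (fun l => (L.α ^ m) (X i l)) (f (fun b => X (i.succAbove b)) z)) +
  sgn (m : ZMod 2) • ∑ l : Fin (k + 1),
    sgn ((e + ∑ b : Fin m, ∑ q, D b.castSucc q) * ∑ q ∈ Finset.Iio l, D (Fin.last m) q) •
      mixedBracket M (snocTuple (D (Fin.last m)) c)
        (snocTuple (fun q => (L.α ^ m) (X (Fin.last m) q)) ((L.α ^ m) z)) l.castSucc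
        (e + (∑ b : Fin m, ∑ q, D b.castSucc q) + D (Fin.last m) l)
        (f (fun b => X b.castSucc) (X (Fin.last m) l))

/-- The coboundary operator `δ^m`: the additive extension of `coboundaryFormula` from homogeneous
cochains and homogeneous arguments to all of them. -/
def coboundary [DirectSum.Decomposition 𝒢] [DirectSum.Decomposition 𝒱] (M : L.GradedModule 𝒱)
    (m : ℕ) : RawCochain g V k m →ₗ[K] RawCochain g V k (m + 1) where
  toFun f := fun X z =>
    ∑ e : ZMod 2, ∑ D : Fin (m + 1) → Fin (k + 1) → ZMod 2, ∑ c : ZMod 2,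
      coboundaryFormula M e D c (cochainComponent 𝒢 𝒱 e f)
        (fun i l => gradedProj 𝒢 (D i l) (X i l)) (gradedProj 𝒢 c z)
  map_add' f f' := by
    funext X z
    have h : ∀ e : ZMod 2, cochainComponent 𝒢 𝒱 e (f + f') =
        cochainComponent 𝒢 𝒱 e f + cochainComponent 𝒢 𝒱 e f' := fun e => by
      funext X z
      simp [cochainComponent, gradedProj, DirectSum.decompose_add, Finset.sum_add_distrib]
    simp only [h, Pi.add_apply, ← Finset.sum_add_distrib]
    refine Finset.sum_congr rfl fun e _ => Finset.sum_congr rfl fun D _ =>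
      Finset.sum_congr rfl fun c _ => ?_
    simp only [coboundaryFormula, mixedBracket, Pi.add_apply, map_add, smul_add,
      Finset.sum_add_distrib]
    abel
  map_smul' r f := by
    funext X z
    have h : ∀ e : ZMod 2, cochainComponent 𝒢 𝒱 e (r • f) =
        r • cochainComponent 𝒢 𝒱 e f := fun e => by
      funext X z
      simp only [cochainComponent, gradedProj, DirectSum.decompose_smul, Finset.smul_sum,
        Pi.smul_apply]
      rfl
    simp only [h, Pi.smul_apply, RingHom.id_apply, Finset.smul_sum]
    refine Finset.sum_congr rfl fun e _ => Finset.sum_congr rfl fun D _ =>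
      Finset.sum_congr rfl fun c _ => ?_
    simp only [coboundaryFormula, mixedBracket, Pi.smul_apply, map_smul, smul_add,
      Finset.smul_sum, smul_comm r]

/-- The space `Z^m(g, V)` of `m`-supercocycles. -/
def cocycles [DirectSum.Decomposition 𝒢] [DirectSum.Decomposition 𝒱] (M : L.GradedModule 𝒱)
    (m : ℕ) : Submodule K (RawCochain g V k m) :=
  cochains M m ⊓ LinearMap.ker (coboundary M m)

/-- The space `δ^{m-1} C^{m-1}(g, V)` of `m`-coboundaries (zero for `m = 0`). -/
def coboundaries [DirectSum.Decomposition 𝒢] [DirectSum.Decomposition 𝒱] (M : L.GradedModule 𝒱) :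
    (m : ℕ) → Submodule K (RawCochain g V k m)
  | 0 => ⊥
  | m + 1 => (cochains M m).map (coboundary M m)

/-- `H^m(g, V) = Z^m(g, V) / δ^{m-1} C^{m-1}(g, V)`. -/
abbrev cohomology [DirectSum.Decomposition 𝒢] [DirectSum.Decomposition 𝒱] (M : L.GradedModule 𝒱)
    (m : ℕ) : Type _ :=
  cocycles M m ⧸ (coboundaries M m).submoduleOf (cocycles M m)

/-- The part of degree `e` of `H^m(g, V)`: the span of the classes of the supercocycles of
degree `e` (these classes in fact form a subspace). -/
def cohomologyPart [DirectSum.Decomposition 𝒢] [DirectSum.Decomposition 𝒱] (M : L.GradedModule 𝒱)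
    (m : ℕ) (e : ZMod 2) : Submodule K (cohomology M m) :=
  Submodule.span K {h | ∃ f : cocycles M m, IsHomogCochain 𝒢 𝒱 e f.1 ∧
    h = Submodule.Quotient.mk f}

end

section

variable {K g V : Type*} [Field K] [AddCommGroup g] [Module K g] [AddCommGroup V] [Module K V]
  {k : ℕ}

/-- `m`-cochains of an (ungraded) `n`-ary multiplicative Hom-Nambu-Lie algebra with twist `α` in a
module with twist `ν`. -/
def IsHomNambuLieCochain (α : Module.End K g) (ν : Module.End K V) {m : ℕ}
    (f : RawCochain g V k m) : Prop :=
  IsMultilinearCochain K f ∧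
    (∀ X z (i : Fin m) (p : Fin k), f X z = -f (swapIn X i p) z) ∧
    (∀ X z (i : Fin m), (i : ℕ) + 1 = m →
      f X z = -f (replaceLast X i z) (X i (Fin.last k))) ∧
    ∀ X z, ν (f X z) = f (fun i l => α (X i l)) (α z)

/-- The coboundary of (ungraded) `n`-ary multiplicative Hom-Nambu-Lie algebras. -/
def homNambuLieCoboundary (br : MultilinearMap K (fun _ : Fin (k + 2) => g) g)
    (α : Module.End K g) (ρ : MultilinearMap K (fun _ : Fin (k + 1) => g) (Module.End K V))
    {m : ℕ} (f : RawCochain g V k m) : RawCochain g V k (m + 1) := fun X z =>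
  (∑ i : Fin (m + 1), ∑ j ∈ Finset.Ioi i, (-1 : ℤ) ^ ((i : ℕ) + 1) • ∑ l : Fin (k + 1),
    f (fun b => Function.update (fun b' q => α (X b' q)) j
        (Function.update (fun q => α (X j q)) l (br (snocTuple (X i) (X j l))))
        (i.succAbove b)) (α z)) +
  (∑ i : Fin (m + 1), (-1 : ℤ) ^ ((i : ℕ) + 1) •
    f (fun b q => α (X (i.succAbove b) q)) (br (snocTuple (X i) z))) +
  (∑ i : Fin (m + 1), (-1 : ℤ) ^ (i : ℕ) •
    ρ (fun l => (α ^ m) (X i l)) (f (fun b => X (i.succAbove b)) z)) +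
  (-1 : ℤ) ^ m • ∑ l : Fin (k + 1), (-1 : ℤ) ^ (k + 1 - (l : ℕ)) •
    ρ (fun q => snocTuple (fun q' => (α ^ m) (X (Fin.last m) q')) ((α ^ m) z)
        (l.castSucc.succAbove q))
      (f (fun b => X b.castSucc) (X (Fin.last m) l))

/-- The coboundary of `n`-Lie superalgebras (no twists), for `f` homogeneous of degree `e` and
homogeneous arguments of degrees `D`, `c`. -/
def nLieSuperCoboundaryFormula (br : MultilinearMap K (fun _ : Fin (k + 2) => g) g)
    (ρ : MultilinearMap K (fun _ : Fin (k + 1) => g) (Module.End K V))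
    {m : ℕ} (e : ZMod 2) (D : Fin (m + 1) → Fin (k + 1) → ZMod 2) (c : ZMod 2)
    (f : RawCochain g V k m) (X : Fin (m + 1) → Fin (k + 1) → g) (z : g) : V :=
  (∑ i : Fin (m + 1), ∑ j ∈ Finset.Ioi i,
    sgn (((i : ℕ) + 1 : ZMod 2) + (∑ l, D i l) * ∑ b ∈ Finset.Ioo i j, ∑ l, D b l) •
      ∑ l : Fin (k + 1), sgn ((∑ q, D i q) * ∑ q ∈ Finset.Iio l, D j q) •
        f (fun b => Function.update X j
            (Function.update (X j) l (br (snocTuple (X i) (X j l)))) (i.succAbove b)) z) +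
  (∑ i : Fin (m + 1),
    sgn (((i : ℕ) + 1 : ZMod 2) + (∑ l, D i l) * ∑ b ∈ Finset.Ioi i, ∑ l, D b l) •
      f (fun b => X (i.succAbove b)) (br (snocTuple (X i) z))) +
  (∑ i : Fin (m + 1),
    sgn (((i : ℕ) : ZMod 2) + (∑ l, D i l) * (e + ∑ b ∈ Finset.Iio i, ∑ l, D b l)) •
      ρ (X i) (f (fun b => X (i.succAbove b)) z)) +
  sgn (m : ZMod 2) • ∑ l : Fin (k + 1),
    sgn ((e + ∑ b : Fin m, ∑ q, D b.castSucc q) * (∑ q ∈ Finset.Iio l, D (Fin.last m) q) +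
        ((k + 1 - (l : ℕ) : ℕ) : ZMod 2) +
        (e + (∑ b : Fin m, ∑ q, D b.castSucc q) + D (Fin.last m) l) *
          ((∑ q ∈ Finset.Ioi l, D (Fin.last m) q) + c)) •
      ρ (fun q => snocTuple (X (Fin.last m)) z (l.castSucc.succAbove q))
        (f (fun b => X b.castSucc) (X (Fin.last m) l))

end

/-! The proof is a Cartan calculus. Let ι_X insert a fundamental object X into the first slot of a
cochain, and let L_X be the action of X on cochains. The relation ι_Y L_X = ± L_X ι_Y − ι_[X,Y]
determines L_X by recursion on the number m of slots, and Cartan's formula ι_X δ = L_X − δ ι_X then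
determines δ. Here both relations serve as definitions (`Coch.lie`, `Coch.cobd`); the explicit sum
for δ is recovered afterwards (`Coch.cobd_apply`).

A cochain with at least one slot is determined by its insertions, so identities are proved by
induction on m. The fundamental identity gives a Leibniz rule for [X,Y]_α (`MultiLin.leibniz`). With
the first module axiom `ρ_comp` this gives the commutator of L_X and L_Y (`lie_lie`), and then L_X δ
= δ L_X (`lie_cobd`), whose base case is that ρ acts by derivations of the bracket with one argument
in V (`rho_mixed`, `rho_ins`). Finally ι_X δδ = L_X δ − δ(L_X − δ ι_X) = δδ ι_X, so δδ = 0 reduces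
to m = 0. There L_X F − ι_X δF collects, up to sign, the terms in which F is evaluated at an entry
of X, and its coboundary vanishes by the second module axiom `ρ_bracket` (`ins_insInit`,
`cobd_cobd`).

Two features shape the formalization. First, the condition ν f = f ∘ α is not inherited by ι_X f:
composing ι_X f with ν gives (ι_{α(X)} f) ∘ α. The operators therefore act on pairs (F, G) with ν F
= G ∘ α, where F enters the terms with a ρ and G the terms with a bracket; composing two operators
needs a triple (F, G, H). The exponent s of α is a parameter separate from m, since insertion lowers
m but not s. Second, the signs depend on degrees, so the calculus is done on homogeneous elements
bundled with their degree (`Homog`), for functions linear within each degree (`Lin`, `MultiLinC`).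
The maps `res` and `extend` translate between these functions and multilinear cochains.

Linearity, super-skewsymmetry, degree and compatibility with the twists pass through the same
recursions. Since δ commutes with taking homogeneous components, cocycles, coboundaries and
cohomology are graded. The two special cases follow by comparing explicit formulas. -/

set_option linter.unusedSectionVars false

/-! ### Signs indexed by parities -/

section Sign

theorem sgn_add (a b : ZMod 2) : sgn (a + b) = sgn a * sgn b := uzpow_add _ _ _

@[simp] theorem sgn_zero : sgn 0 = 1 := uzpow_zero _

@[simp] theorem sgn_one : sgn 1 = -1 := uzpow_one _

theorem sgn_natCast (n : ℕ) : sgn (n : ZMod 2) = (-1) ^ n := uzpow_natCast _ _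

theorem neg_eq_sgn_smul {A : Type*} [AddCommGroup A] (v : A) : -v = sgn 1 • v := by
  simp

theorem sgn_smul_congr {A : Type*} [AddCommGroup A] {a b : ZMod 2} (h : a = b) (v : A) :
    sgn a • v = sgn b • v := by rw [h]

theorem sgn_smul_sgn_smul {A : Type*} [AddCommGroup A] (a b : ZMod 2) (v : A) :
    sgn a • sgn b • v = sgn (a + b) • v := by rw [smul_smul, sgn_add]

theorem map_sgn_smul {A B F : Type*} [AddCommGroup A] [AddCommGroup B] [FunLike F A B]
    [AddMonoidHomClass F A B] (φ : F) (a : ZMod 2) (v : A) : φ (sgn a • v) = sgn a • φ v := by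
  rw [Units.smul_def, Units.smul_def, map_zsmul]

theorem Submodule.sgn_smul_mem {K W : Type*} [Field K] [AddCommGroup W] [Module K W]
    (S : Submodule K W) (a : ZMod 2) {w : W} (h : w ∈ S) : sgn a • w ∈ S := by
  rw [Units.smul_def]; exact zsmul_mem h _

end Sign

/-! ### Partial sums over initial and final segments of `Fin r` -/

section FinSums

theorem Finset.sum_Iio_eq {A : Type*} [AddCommMonoid A] {r : ℕ} (l : Fin r) (f : Fin r → A) :
    ∑ q ∈ Finset.Iio l, f q = ∑ q, if q < l then f q else 0 := by
  rw [← Finset.sum_filter]; congr 1; ext; simp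

theorem Finset.sum_Ioi_eq {A : Type*} [AddCommMonoid A] {r : ℕ} (l : Fin r) (f : Fin r → A) :
    ∑ q ∈ Finset.Ioi l, f q = ∑ q, if l < q then f q else 0 := by
  rw [← Finset.sum_filter]; congr 1; ext; simp

theorem Finset.sum_Ioo_eq {A : Type*} [AddCommMonoid A] {r : ℕ} (i l : Fin r) (f : Fin r → A) :
    ∑ q ∈ Finset.Ioo i l, f q = ∑ q, if i < q ∧ q < l then f q else 0 := by
  rw [← Finset.sum_filter]; congr 1; ext; simp

theorem Finset.sum_Iio_succAbove {A : Type*} [AddCommMonoid A] {r : ℕ} (p : Fin (r + 1))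
    (j : Fin r) (f : Fin (r + 1) → A) :
    ∑ q ∈ Finset.Iio (p.succAbove j), f q =
      (if p < p.succAbove j then f p else 0) + ∑ q ∈ Finset.Iio j, f (p.succAbove q) := by
  rw [Finset.sum_Iio_eq, Fin.sum_univ_succAbove _ p, Finset.sum_Iio_eq]
  simp only [Fin.succAbove_lt_succAbove_iff]

theorem Finset.sum_Iio_add_Ioi {A : Type*} [AddCommMonoid A] {r : ℕ} (p : Fin r)
    (f : Fin r → A) :
    ∑ q, f q = ∑ q ∈ Finset.Iio p, f q + f p + ∑ q ∈ Finset.Ioi p, f q := by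
  rw [Finset.sum_Iio_eq, Finset.sum_Ioi_eq]
  have : f p = ∑ q, if q = p then f q else 0 := by simp
  rw [this, ← Finset.sum_add_distrib, ← Finset.sum_add_distrib]
  refine Finset.sum_congr rfl fun q _ => ?_
  rcases lt_trichotomy q p with h | h | h
  · simp [h, h.not_gt, h.ne]
  · simp [h]
  · simp [h, h.not_gt, h.ne']

theorem Finset.sum_Iio_castSucc {A : Type*} [AddCommMonoid A] {r : ℕ} (l : Fin r)
    (f : Fin (r + 1) → A) :
    ∑ q ∈ Finset.Iio l.castSucc, f q = ∑ q ∈ Finset.Iio l, f q.castSucc := by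
  rw [Finset.sum_Iio_eq, Fin.sum_univ_castSucc, Finset.sum_Iio_eq]
  simp [Fin.castSucc_lt_castSucc_iff, (Fin.castSucc_lt_last _).not_gt]

theorem Finset.sum_Ioi_castSucc {A : Type*} [AddCommMonoid A] {r : ℕ} (l : Fin r)
    (f : Fin (r + 1) → A) :
    ∑ q ∈ Finset.Ioi l.castSucc, f q =
      ∑ q ∈ Finset.Ioi l, f q.castSucc + f (Fin.last r) := by
  rw [Finset.sum_Ioi_eq, Fin.sum_univ_castSucc, Finset.sum_Ioi_eq]
  simp [Fin.castSucc_lt_castSucc_iff, Fin.castSucc_lt_last]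

theorem Finset.sum_Iio_last {A : Type*} [AddCommMonoid A] {r : ℕ} (f : Fin (r + 1) → A) :
    ∑ q ∈ Finset.Iio (Fin.last r), f q = ∑ q, f (Fin.castSucc q) := by
  rw [Finset.sum_Iio_eq, Fin.sum_univ_castSucc]
  simp [Fin.castSucc_lt_last]

theorem Finset.sum_Ioi_last {A : Type*} [AddCommMonoid A] {r : ℕ} (f : Fin (r + 1) → A) :
    ∑ q ∈ Finset.Ioi (Fin.last r), f q = 0 := by
  rw [Finset.sum_Ioi_eq]
  exact Finset.sum_eq_zero fun q _ => if_neg (Fin.le_last q).not_gt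

end FinSums

/-! ### Tuples: appending, updating and adjacent transpositions -/

section Tuples

variable {W W' : Type*}

@[simp] theorem snocTuple_castSucc {p : ℕ} (x : Fin p → W) (z : W) (i : Fin p) :
    snocTuple x z i.castSucc = x i := by simp [snocTuple]

@[simp] theorem snocTuple_last {p : ℕ} (x : Fin p → W) (z : W) :
    snocTuple x z (Fin.last p) = z := by simp [snocTuple]

theorem comp_snocTuple {p : ℕ} (φ : W → W') (x : Fin p → W) (z : W) :
    (fun i => φ (snocTuple x z i)) = snocTuple (fun i => φ (x i)) (φ z) := by
  funext i
  refine Fin.lastCases ?_ (fun i => ?_) i <;> simp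

theorem snocTuple_update {p : ℕ} (x : Fin p → W) (z : W) (i : Fin p) (w : W) :
    Function.update (snocTuple x z) i.castSucc w = snocTuple (Function.update x i w) z :=
  (Fin.snoc_update (α := fun _ => W) z x i w).symm

theorem snocTuple_update_last {p : ℕ} (x : Fin p → W) (z w : W) :
    Function.update (snocTuple x z) (Fin.last p) w = snocTuple x w :=
  Fin.update_snoc_last (α := fun _ => W) z x w

theorem snocTuple_init {p : ℕ} (y : Fin (p + 1) → W) :
    snocTuple (fun i => y i.castSucc) (y (Fin.last p)) = y := by
  funext i
  refine Fin.lastCases ?_ (fun i => ?_) i <;> simp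

theorem snocTuple_succAbove_castSucc {p : ℕ} (x : Fin (p + 1) → W) (z : W) (l : Fin (p + 1)) :
    (fun i => snocTuple x z (l.castSucc.succAbove i)) =
      snocTuple (fun i => x (l.succAbove i)) z := by
  funext i
  refine Fin.lastCases ?_ (fun i => ?_) i
  · simp [Fin.succAbove_of_lt_succ]
  · simp [Fin.castSucc_succAbove_castSucc]

theorem comp_update {ι : Type*} [DecidableEq ι] (φ : W → W') (x : ι → W) (i : ι) (w : W) :
    (fun j => φ (Function.update x i w j)) = Function.update (fun j => φ (x j)) i (φ w) := by
  funext j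
  by_cases h : j = i
  · subst h; simp
  · simp [h]

theorem comp_cons {p : ℕ} (φ : W → W') (x : W) (y : Fin p → W) :
    (fun i => φ (Fin.cons (α := fun _ => W) x y i)) =
      Fin.cons (α := fun _ => W') (φ x) (fun i => φ (y i)) := by
  funext i
  refine Fin.cases ?_ (fun i => ?_) i <;> simp

theorem swapAdj_snocTuple_castSucc {r : ℕ} (x : Fin (r + 1) → W) (z : W) (p : Fin r) :
    swapAdj (snocTuple x z) p.castSucc = snocTuple (swapAdj x p) z := by
  funext i
  refine Fin.lastCases ?_ (fun i => ?_) i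
  · simp only [swapAdj, Function.comp, snocTuple_last]
    rw [Equiv.swap_apply_of_ne_of_ne, snocTuple_last]
    · exact (Fin.castSucc_lt_last _).ne'
    · rw [← Fin.castSucc_succ]; exact (Fin.castSucc_lt_last _).ne'
  · simp only [swapAdj, Function.comp, snocTuple_castSucc, ← Fin.castSucc_succ]
    rw [(Fin.castSucc_injective _).swap_apply, snocTuple_castSucc]

theorem swapAdj_snocTuple_last {r : ℕ} (x : Fin (r + 1) → W) (z : W) :
    swapAdj (snocTuple x z) (Fin.last r) =
      snocTuple (Function.update x (Fin.last r) z) (x (Fin.last r)) := by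
  funext i
  simp only [swapAdj, Function.comp, Fin.succ_last]
  refine Fin.lastCases ?_ (fun i => ?_) i
  · simp [Equiv.swap_apply_right]
  · by_cases h : i = Fin.last r
    · subst h; simp
    · rw [Equiv.swap_apply_of_ne_of_ne, snocTuple_castSucc, snocTuple_castSucc,
        Function.update_of_ne h]
      · exact fun h' => h (Fin.castSucc_injective _ h')
      · exact (Fin.castSucc_lt_last _).ne

theorem swapAdj_update {r : ℕ} (x : Fin (r + 1) → W) (p : Fin r) (i : Fin (r + 1)) (w : W) :
    swapAdj (Function.update x i w) p =
      Function.update (swapAdj x p) (Equiv.swap p.castSucc p.succ i) w := by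
  funext j
  simp only [swapAdj, Function.comp, Function.update_apply]
  congr 1
  rw [eq_iff_iff, ← Equiv.apply_eq_iff_eq (Equiv.swap p.castSucc p.succ)]
  simp

theorem sum_swapAdj {A : Type*} [AddCommMonoid A] {r : ℕ} (x : Fin (r + 1) → A) (p : Fin r) :
    ∑ i, swapAdj x p i = ∑ i, x i :=
  Equiv.sum_comp (Equiv.swap p.castSucc p.succ) x

/-- Transposing two adjacent entries changes the sum of the entries before the position `i` only
if exactly one of the two entries lies there. -/
theorem sum_Iio_swapAdj {A : Type*} [AddCommGroup A] {r : ℕ} (x : Fin (r + 1) → A) (p : Fin r)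
    (i : Fin (r + 1)) :
    ∑ q ∈ Finset.Iio (Equiv.swap p.castSucc p.succ i), swapAdj x p q =
      ∑ q ∈ Finset.Iio i, x q +
        (if i = p.castSucc then x p.succ else 0) - (if i = p.succ then x p.castSucc else 0) := by
  rw [Finset.sum_Iio_eq, ← Equiv.sum_comp (Equiv.swap p.castSucc p.succ)]
  have e : ∀ q, swapAdj x p (Equiv.swap p.castSucc p.succ q) = x q := fun q => by simp [swapAdj]
  simp only [e]
  have h1 : (if i = p.castSucc then x p.succ else 0) =
      ∑ q, if q = p.succ then (if i = p.castSucc then x p.succ else 0) else 0 := by simp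
  have h2 : (if i = p.succ then x p.castSucc else 0) =
      ∑ q, if q = p.castSucc then (if i = p.succ then x p.castSucc else 0) else 0 := by simp
  rw [h1, h2, Finset.sum_Iio_eq, ← Finset.sum_add_distrib, ← Finset.sum_sub_distrib]
  refine Finset.sum_congr rfl fun q _ => ?_
  have hv : p.castSucc.val = p.val := rfl
  have hv' : p.succ.val = p.val + 1 := rfl
  -- On underlying natural numbers the transposition is a case distinction, which reduces the
  -- comparison of summands to arithmetic.
  have key : ∀ j : Fin (r + 1), (Equiv.swap p.castSucc p.succ j).val =
      if j.val = p.val then p.val + 1 else if j.val = p.val + 1 then p.val else j.val := by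
    intro j
    rw [Equiv.swap_apply_def]
    simp only [Fin.ext_iff, hv, hv']
    split_ifs <;> simp
  have hx : q.val = p.val → x q = x p.castSucc := fun h => by congr 1; exact Fin.ext h
  have hx' : q.val = p.val + 1 → x q = x p.succ := fun h => by congr 1; exact Fin.ext h
  simp only [Fin.lt_def, Fin.ext_iff, key, hv, hv']
  split_ifs <;> first | omega | simp_all

end Tuples

/-- A homogeneous element together with its degree. -/
@[ext]
structure Homog {K W : Type*} [Field K] [AddCommGroup W] [Module K W]
    (𝒲 : ZMod 2 → Submodule K W) where
  deg : ZMod 2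
  val : W
  mem : val ∈ 𝒲 deg

/-! ### Homogeneous elements, degreewise linearity and brackets of fundamental objects -/

namespace Homog

section

variable {K g A B : Type*} [Field K] [AddCommGroup g] [Module K g] [AddCommGroup A] [Module K A]
  [AddCommGroup B] [Module K B] {𝒢 : ZMod 2 → Submodule K g}

/-- `y'' = r • y + y'`, all three being homogeneous of the same degree. -/
structure Rel (r : K) (y y' y'' : Homog 𝒢) : Prop where
  deg_left : y.deg = y''.deg
  deg_right : y'.deg = y''.deg
  val_eq : y''.val = r • y.val + y'.val

/-- Linearity on each homogeneous component. -/
def Lin (φ : Homog 𝒢 → A) : Prop :=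
  ∀ (r : K) (y y' y'' : Homog 𝒢), Rel r y y' y'' → φ y'' = r • φ y + φ y'

theorem Lin.add {φ ψ : Homog 𝒢 → A} (h : Lin φ) (h' : Lin ψ) : Lin fun y => φ y + ψ y :=
  fun r y y' y'' hr => by
    simp only [h r y y' y'' hr, h' r y y' y'' hr, smul_add]; abel

theorem Lin.neg {φ : Homog 𝒢 → A} (h : Lin φ) : Lin fun y => -φ y :=
  fun r y y' y'' hr => by simp only [h r y y' y'' hr, smul_neg]; abel

theorem Lin.sub {φ ψ : Homog 𝒢 → A} (h : Lin φ) (h' : Lin ψ) : Lin fun y => φ y - ψ y := by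
  simpa only [sub_eq_add_neg] using h.add h'.neg

theorem Lin.map {φ : Homog 𝒢 → A} (h : Lin φ) (T : A →ₗ[K] B) : Lin fun y => T (φ y) :=
  fun r y y' y'' hr => by simp only [h r y y' y'' hr, map_add, map_smul]

theorem Lin.sum {ι : Type*} (s : Finset ι) {φ : ι → Homog 𝒢 → A} (h : ∀ i, Lin (φ i)) :
    Lin fun y => ∑ i ∈ s, φ i y :=
  fun r y y' y'' hr => by
    simp only [h _ r y y' y'' hr, Finset.sum_add_distrib, Finset.smul_sum]

/-- A linear family may be multiplied by signs depending on the degree. -/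
theorem Lin.sgn_smul {φ : Homog 𝒢 → A} (h : Lin φ) (s : ZMod 2 → ZMod 2) :
    Lin fun y => sgn (s y.deg) • φ y :=
  fun r y y' y'' hr => by
    simp only [h r y y' y'' hr, hr.deg_left, hr.deg_right, smul_add, smul_comm r]

theorem Lin.comp {φ : Homog 𝒢 → A} (h : Lin φ) {ψ : Homog 𝒢 → Homog 𝒢}
    (hψ : ∀ (r : K) (y y' y'' : Homog 𝒢), Rel r y y' y'' → Rel r (ψ y) (ψ y') (ψ y'')) :
    Lin fun y => φ (ψ y) :=
  fun r _ _ _ hr => h r _ _ _ (hψ r _ _ _ hr)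

theorem Lin.eq_zero {φ : Homog 𝒢 → A} (h : Lin φ) {y : Homog 𝒢} (hy : y.val = 0) : φ y = 0 := by
  -- For a zero vector, y is related to itself as 1 • y + y, so φ y = φ y + φ y.
  have := h 1 y y y ⟨rfl, rfl, by simp [hy]⟩
  simpa using this

/-- The linear map on the component of degree `a`. -/
def Lin.linearMap {φ : Homog 𝒢 → A} (h : Lin φ) (a : ZMod 2) : 𝒢 a →ₗ[K] A :=
  have key : ∀ (r : K) (y y' : 𝒢 a), φ ⟨a, (r • y + y' : 𝒢 a), (r • y + y').2⟩ =
      r • φ ⟨a, y, y.2⟩ + φ ⟨a, y', y'.2⟩ :=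
    fun r y y' => h r _ _ _ ⟨rfl, rfl, by simp⟩
  { toFun := fun y => φ ⟨a, y, y.2⟩
    map_add' := fun y y' => by simpa using key 1 y y'
    map_smul' := fun r y => by
      have h0 : φ ⟨a, ((0 : 𝒢 a) : g), (0 : 𝒢 a).2⟩ = 0 := h.eq_zero rfl
      have := key r y 0
      simp only [add_zero, h0] at this
      exact this }

/-- Elements of different degrees cannot be added inside `Homog`, so φ itself is not a linear map.
Restricted to a single degree it is one, and this transfers identities between vectors of equal
degree, such as the fundamental identity, to values of φ. -/
theorem Lin.eq_sum {φ : Homog 𝒢 → A} (h : Lin φ) {ι : Type*} (s : Finset ι) (y : Homog 𝒢)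
    (u : ι → ℤˣ) (z : ι → Homog 𝒢) (hd : ∀ i, (z i).deg = y.deg)
    (hv : y.val = ∑ i ∈ s, u i • (z i).val) : φ y = ∑ i ∈ s, u i • φ (z i) := by
  have e : ∀ i, φ (z i) = h.linearMap y.deg ⟨(z i).val, hd i ▸ (z i).mem⟩ := fun i => by
    simp only [Lin.linearMap, LinearMap.coe_mk, AddHom.coe_mk]
    congr 1
    ext <;> simp [hd]
  have e' : φ y = h.linearMap y.deg ⟨y.val, y.mem⟩ := rfl
  rw [e']
  simp only [e, Units.smul_def, ← map_zsmul, ← map_sum]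
  congr 1
  ext
  simp [hv, Units.smul_def]

theorem Lin.eq_sgn_smul {φ : Homog 𝒢 → A} (h : Lin φ) (y z : Homog 𝒢) (a : ZMod 2)
    (hd : z.deg = y.deg) (hv : y.val = sgn a • z.val) : φ y = sgn a • φ z := by
  simpa using h.eq_sum (Finset.univ : Finset Unit) y (fun _ => sgn a) (fun _ => z)
    (fun _ => hd) (by simpa using hv)

/-- Linearity in each entry of a tuple of homogeneous elements. -/
def MultiLin {r : ℕ} (φ : (Fin r → Homog 𝒢) → A) : Prop :=
  ∀ (X : Fin r → Homog 𝒢) (l : Fin r), Lin fun y => φ (Function.update X l y)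

/-- The total degree of a tuple. -/
def tdeg {r : ℕ} (X : Fin r → Homog 𝒢) : ZMod 2 := ∑ i, (X i).deg

/-- Degrees live in `ZMod 2`, so the old degree is removed by adding it a second time. -/
theorem deg_update {r : ℕ} (X : Fin r → Homog 𝒢) (l : Fin r) (y : Homog 𝒢) (q : Fin r) :
    (Function.update X l y q).deg = (X q).deg + if q = l then (X l).deg + y.deg else 0 := by
  by_cases h : q = l
  · subst h; simp; grind
  · simp [h]

theorem tdeg_update {r : ℕ} (X : Fin r → Homog 𝒢) (l : Fin r) (y : Homog 𝒢) :
    tdeg (Function.update X l y) = tdeg X + (X l).deg + y.deg := by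
  simp only [tdeg, deg_update, Finset.sum_add_distrib, Finset.sum_ite_eq', Finset.mem_univ,
    if_true, add_assoc]

theorem tdeg_swapAdj {r : ℕ} (X : Fin (r + 1) → Homog 𝒢) (p : Fin r) :
    tdeg (swapAdj X p) = tdeg X :=
  sum_swapAdj (fun i => (X i).deg) p

theorem tdeg_snocTuple {r : ℕ} (X : Fin r → Homog 𝒢) (z : Homog 𝒢) :
    tdeg (snocTuple X z) = tdeg X + z.deg := by
  simp [tdeg, Fin.sum_univ_castSucc]

variable {k : ℕ} (L : HomNambuLieSuperalgebra 𝒢 k)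

/-- The twist, on homogeneous elements. -/
def twist (x : Homog 𝒢) : Homog 𝒢 := ⟨x.deg, L.α x.val, L.α_mem _ _ x.mem⟩

/-- The twist, on tuples of homogeneous elements. -/
def twistT {r : ℕ} (X : Fin r → Homog 𝒢) : Fin r → Homog 𝒢 := fun i => twist L (X i)

/-- The iterated twist, on homogeneous elements. -/
def twistPow (s : ℕ) (x : Homog 𝒢) : Homog 𝒢 :=
  ⟨x.deg, (L.α ^ s) x.val, by
    induction s with
    | zero => exact x.mem
    | succ s ih => rw [pow_succ']; exact L.α_mem _ _ ih⟩

/-- The iterated twist, on tuples of homogeneous elements. -/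
def twistPowT (s : ℕ) {r : ℕ} (X : Fin r → Homog 𝒢) : Fin r → Homog 𝒢 :=
  fun i => twistPow L s (X i)

/-- The bracket of homogeneous elements. -/
def br (Y : Fin (k + 2) → Homog 𝒢) : Homog 𝒢 :=
  ⟨tdeg Y, L.bracket fun i => (Y i).val, L.bracket_mem _ _ fun i => (Y i).mem⟩

/-- The action `X · z` on homogeneous elements. -/
def act (X : Fin (k + 1) → Homog 𝒢) (z : Homog 𝒢) : Homog 𝒢 := br L (snocTuple X z)

/-- The tuple `(α(Y₁), …, X · Y_l, …, α(Y_r))`. -/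
def wedge {r : ℕ} (X : Fin (k + 1) → Homog 𝒢) (Y : Fin r → Homog 𝒢) (l : Fin r) :
    Fin r → Homog 𝒢 :=
  Function.update (twistT L Y) l (act L X (Y l))

/-- The exponent of the sign of the `l`-th term of `[X, Y]_α`. -/
def passDeg {r : ℕ} (X : Fin (k + 1) → Homog 𝒢) (Y : Fin r → Homog 𝒢) (l : Fin r) : ZMod 2 :=
  tdeg X * ∑ q ∈ Finset.Iio l, (Y q).deg

/-- The value `φ([X, Y]_α)`. -/
def bsum {r : ℕ} (X : Fin (k + 1) → Homog 𝒢) (Y : Fin r → Homog 𝒢)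
    (φ : (Fin r → Homog 𝒢) → A) : A :=
  ∑ l, sgn (passDeg X Y l) • φ (wedge L X Y l)

@[simp] theorem twist_deg (x : Homog 𝒢) : (twist L x).deg = x.deg := rfl
@[simp] theorem twistT_deg {r : ℕ} (X : Fin r → Homog 𝒢) (i : Fin r) :
    (twistT L X i).deg = (X i).deg := rfl
@[simp] theorem twistPowT_deg (s : ℕ) {r : ℕ} (X : Fin r → Homog 𝒢) (i : Fin r) :
    (twistPowT L s X i).deg = (X i).deg := rfl
@[simp] theorem tdeg_twistT {r : ℕ} (X : Fin r → Homog 𝒢) : tdeg (twistT L X) = tdeg X := rfl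
@[simp] theorem tdeg_twistPowT (s : ℕ) {r : ℕ} (X : Fin r → Homog 𝒢) :
    tdeg (twistPowT L s X) = tdeg X := rfl
@[simp] theorem br_deg (Y : Fin (k + 2) → Homog 𝒢) : (br L Y).deg = tdeg Y := rfl
@[simp] theorem act_deg (X : Fin (k + 1) → Homog 𝒢) (z : Homog 𝒢) :
    (act L X z).deg = tdeg X + z.deg := tdeg_snocTuple X z

theorem act_val (X : Fin (k + 1) → Homog 𝒢) (z : Homog 𝒢) :
    (act L X z).val = L.bracket (snocTuple (fun i => (X i).val) z.val) := by
  simp only [act, br, comp_snocTuple (fun y : Homog 𝒢 => y.val)]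

theorem wedge_deg {r : ℕ} (X : Fin (k + 1) → Homog 𝒢) (Y : Fin r → Homog 𝒢) (l q : Fin r) :
    (wedge L X Y l q).deg = (Y q).deg + if q = l then tdeg X else 0 := by
  simp only [wedge, deg_update, twistT_deg, act_deg]
  split_ifs <;> grind

@[simp] theorem tdeg_wedge {r : ℕ} (X : Fin (k + 1) → Homog 𝒢) (Y : Fin r → Homog 𝒢)
    (l : Fin r) : tdeg (wedge L X Y l) = tdeg X + tdeg Y := by
  simp only [tdeg, wedge_deg, Finset.sum_add_distrib, Finset.sum_ite_eq', Finset.mem_univ,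
    if_true, add_comm]

theorem wedge_same {r : ℕ} (X : Fin (k + 1) → Homog 𝒢) (Y : Fin r → Homog 𝒢) (l : Fin r) :
    wedge L X Y l l = act L X (Y l) := by simp [wedge]

theorem wedge_of_ne {r : ℕ} (X : Fin (k + 1) → Homog 𝒢) (Y : Fin r → Homog 𝒢) {l q : Fin r}
    (h : q ≠ l) : wedge L X Y l q = twist L (Y q) := by simp [wedge, h, twistT]

theorem twist_br (Y : Fin (k + 2) → Homog 𝒢) : twist L (br L Y) = br L (twistT L Y) := by
  ext
  · rfl
  · exact L.α_bracket _

theorem twistT_snocTuple {r : ℕ} (X : Fin r → Homog 𝒢) (z : Homog 𝒢) :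
    twistT L (snocTuple X z) = snocTuple (twistT L X) (twist L z) :=
  comp_snocTuple _ _ _

theorem twistPowT_snocTuple (s : ℕ) {r : ℕ} (X : Fin r → Homog 𝒢) (z : Homog 𝒢) :
    twistPowT L s (snocTuple X z) = snocTuple (twistPowT L s X) (twistPow L s z) :=
  comp_snocTuple _ _ _

theorem twist_act (X : Fin (k + 1) → Homog 𝒢) (z : Homog 𝒢) :
    twist L (act L X z) = act L (twistT L X) (twist L z) := by
  rw [act, twist_br, twistT_snocTuple, act]

theorem twistPow_succ (s : ℕ) (x : Homog 𝒢) :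
    twistPow L (s + 1) x = twistPow L s (twist L x) := by
  ext
  · rfl
  · simp [twistPow, twist, pow_succ]

theorem twistPow_succ' (s : ℕ) (x : Homog 𝒢) :
    twistPow L (s + 1) x = twist L (twistPow L s x) := by
  ext
  · rfl
  · simp [twistPow, twist, pow_succ']

theorem twistPowT_succ (s : ℕ) {r : ℕ} (X : Fin r → Homog 𝒢) :
    twistPowT L (s + 1) X = twistPowT L s (twistT L X) :=
  funext fun _ => twistPow_succ L s _

theorem twistPowT_succ' (s : ℕ) {r : ℕ} (X : Fin r → Homog 𝒢) :
    twistPowT L (s + 1) X = twistT L (twistPowT L s X) :=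
  funext fun _ => twistPow_succ' L s _

theorem twistPow_br (s : ℕ) (Y : Fin (k + 2) → Homog 𝒢) :
    twistPow L s (br L Y) = br L (twistPowT L s Y) := by
  induction s generalizing Y with
  | zero => rfl
  | succ s ih => rw [twistPow_succ, twist_br, ih, ← twistPowT_succ]

theorem twistPow_act (s : ℕ) (X : Fin (k + 1) → Homog 𝒢) (z : Homog 𝒢) :
    twistPow L s (act L X z) = act L (twistPowT L s X) (twistPow L s z) := by
  rw [act, twistPow_br, twistPowT_snocTuple, act]

theorem twistT_update {r : ℕ} (X : Fin r → Homog 𝒢) (l : Fin r) (y : Homog 𝒢) :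
    twistT L (Function.update X l y) = Function.update (twistT L X) l (twist L y) :=
  comp_update _ _ _ _

theorem twistPowT_update (s : ℕ) {r : ℕ} (X : Fin r → Homog 𝒢) (l : Fin r) (y : Homog 𝒢) :
    twistPowT L s (Function.update X l y) =
      Function.update (twistPowT L s X) l (twistPow L s y) :=
  comp_update _ _ _ _

theorem twistT_wedge {r : ℕ} (X : Fin (k + 1) → Homog 𝒢) (Y : Fin r → Homog 𝒢) (l : Fin r) :
    twistT L (wedge L X Y l) = wedge L (twistT L X) (twistT L Y) l := by
  rw [wedge, twistT_update, twist_act]; rfl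

theorem twistPowT_wedge (s : ℕ) {r : ℕ} (X : Fin (k + 1) → Homog 𝒢) (Y : Fin r → Homog 𝒢)
    (l : Fin r) :
    twistPowT L s (wedge L X Y l) = wedge L (twistPowT L s X) (twistPowT L s Y) l := by
  rw [wedge, twistPowT_update, twistPow_act, ← twistPowT_succ, twistPowT_succ']; rfl

theorem wedge_snocTuple_castSucc {r : ℕ} (X : Fin (k + 1) → Homog 𝒢) (Y : Fin r → Homog 𝒢)
    (z : Homog 𝒢) (l : Fin r) :
    wedge L X (snocTuple Y z) l.castSucc = snocTuple (wedge L X Y l) (twist L z) := by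
  rw [wedge, twistT_snocTuple, snocTuple_update, snocTuple_castSucc, wedge]

theorem wedge_snocTuple_last {r : ℕ} (X : Fin (k + 1) → Homog 𝒢) (Y : Fin r → Homog 𝒢)
    (z : Homog 𝒢) :
    wedge L X (snocTuple Y z) (Fin.last r) = snocTuple (twistT L Y) (act L X z) := by
  rw [wedge, twistT_snocTuple, snocTuple_update_last, snocTuple_last]

@[simp] theorem passDeg_twistT_left {r : ℕ} (X : Fin (k + 1) → Homog 𝒢) (Y : Fin r → Homog 𝒢)
    (l : Fin r) : passDeg (twistT L X) Y l = passDeg X Y l := rfl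

theorem passDeg_snocTuple_castSucc {r : ℕ} (X : Fin (k + 1) → Homog 𝒢) (Y : Fin r → Homog 𝒢)
    (z : Homog 𝒢) (l : Fin r) : passDeg X (snocTuple Y z) l.castSucc = passDeg X Y l := by
  simp only [passDeg, Finset.sum_Iio_castSucc, snocTuple_castSucc]

theorem passDeg_snocTuple_last {r : ℕ} (X : Fin (k + 1) → Homog 𝒢) (Y : Fin r → Homog 𝒢)
    (z : Homog 𝒢) : passDeg X (snocTuple Y z) (Fin.last r) = tdeg X * tdeg Y := by
  simp only [passDeg, Finset.sum_Iio_last, snocTuple_castSucc, tdeg]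

theorem passDeg_wedge {r : ℕ} (X Y : Fin (k + 1) → Homog 𝒢) (Z : Fin r → Homog 𝒢)
    (l q : Fin r) :
    passDeg X (wedge L Y Z l) q = passDeg X Z q + if l < q then tdeg X * tdeg Y else 0 := by
  simp only [passDeg, wedge_deg, Finset.sum_add_distrib, Finset.sum_ite_eq', Finset.mem_Iio,
    mul_add]
  split_ifs <;> simp

/-- The action on the n-tuple (Y, z) has the same shape as the bracket with Y. This lets the Leibniz
rule and the fundamental identity share one notation, the entry z supplying the last summand. -/
theorem bsum_snocTuple {r : ℕ} (X : Fin (k + 1) → Homog 𝒢) (Y : Fin r → Homog 𝒢)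
    (z : Homog 𝒢) (φ : (Fin (r + 1) → Homog 𝒢) → A) :
    bsum L X (snocTuple Y z) φ = bsum L X Y (fun W => φ (snocTuple W (twist L z))) +
      sgn (tdeg X * tdeg Y) • φ (snocTuple (twistT L Y) (act L X z)) := by
  simp only [bsum, Fin.sum_univ_castSucc, passDeg_snocTuple_castSucc, passDeg_snocTuple_last,
    wedge_snocTuple_castSucc, wedge_snocTuple_last]

theorem bsum_add {r : ℕ} (X : Fin (k + 1) → Homog 𝒢) (Y : Fin r → Homog 𝒢)
    (φ ψ : (Fin r → Homog 𝒢) → A) :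
    bsum L X Y (fun W => φ W + ψ W) = bsum L X Y φ + bsum L X Y ψ := by
  simp only [bsum, smul_add, Finset.sum_add_distrib]

theorem bsum_sub {r : ℕ} (X : Fin (k + 1) → Homog 𝒢) (Y : Fin r → Homog 𝒢)
    (φ ψ : (Fin r → Homog 𝒢) → A) :
    bsum L X Y (fun W => φ W - ψ W) = bsum L X Y φ - bsum L X Y ψ := by
  simp only [bsum, smul_sub, Finset.sum_sub_distrib]

theorem bsum_sgn_smul {r : ℕ} (X : Fin (k + 1) → Homog 𝒢) (Y : Fin r → Homog 𝒢) (a : ZMod 2)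
    (φ : (Fin r → Homog 𝒢) → A) :
    bsum L X Y (fun W => sgn a • φ W) = sgn a • bsum L X Y φ := by
  simp only [bsum, Finset.smul_sum, smul_comm (sgn a)]

theorem map_bsum {A' F : Type*} [AddCommGroup A'] [FunLike F A A'] [AddMonoidHomClass F A A']
    (T : F) {r : ℕ} (X : Fin (k + 1) → Homog 𝒢) (Y : Fin r → Homog 𝒢)
    (φ : (Fin r → Homog 𝒢) → A) :
    T (bsum L X Y φ) = bsum L X Y fun W => T (φ W) := by
  simp only [bsum, map_sum, map_sgn_smul]

theorem bsum_twistT {r : ℕ} (X : Fin (k + 1) → Homog 𝒢) (Y : Fin r → Homog 𝒢)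
    (φ : (Fin r → Homog 𝒢) → A) :
    bsum L (twistT L X) (twistT L Y) φ = bsum L X Y fun W => φ (twistT L W) := by
  simp only [bsum, twistT_wedge]; rfl

theorem bsum_congr {r : ℕ} (X : Fin (k + 1) → Homog 𝒢) (Y : Fin r → Homog 𝒢)
    {φ ψ : (Fin r → Homog 𝒢) → A} (h : ∀ W, tdeg W = tdeg X + tdeg Y → φ W = ψ W) :
    bsum L X Y φ = bsum L X Y ψ :=
  Finset.sum_congr rfl fun l _ => by rw [h _ (tdeg_wedge L X Y l)]

/-! ### Linearity -/

theorem Rel.twist {c : K} {y y' y'' : Homog 𝒢} (h : Rel c y y' y'') :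
    Rel c (twist L y) (Homog.twist L y') (Homog.twist L y'') :=
  ⟨h.1, h.2, by simp [Homog.twist, h.3]⟩

theorem Rel.br_update {c : K} {y y' y'' : Homog 𝒢} (h : Rel c y y' y'')
    (Y : Fin (k + 2) → Homog 𝒢) (l : Fin (k + 2)) :
    Rel c (br L (Function.update Y l y)) (br L (Function.update Y l y'))
      (br L (Function.update Y l y'')) := by
  refine ⟨?_, ?_, ?_⟩
  · simp [tdeg_update, h.1]
  · simp [tdeg_update, h.2]
  · simp only [br, comp_update (fun y : Homog 𝒢 => y.val), h.3]
    simp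

theorem Rel.act_right {c : K} {y y' y'' : Homog 𝒢} (h : Rel c y y' y'')
    (X : Fin (k + 1) → Homog 𝒢) : Rel c (act L X y) (act L X y') (act L X y'') := by
  simpa only [snocTuple_update_last, act] using h.br_update L (snocTuple X y) (Fin.last _)

theorem Rel.act_left {c : K} {y y' y'' : Homog 𝒢} (h : Rel c y y' y'')
    (X : Fin (k + 1) → Homog 𝒢) (l : Fin (k + 1)) (z : Homog 𝒢) :
    Rel c (act L (Function.update X l y) z) (act L (Function.update X l y') z)
      (act L (Function.update X l y'') z) := by
  simpa only [snocTuple_update, act] using h.br_update L (snocTuple X z) l.castSucc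

theorem MultiLin.bsum_right {r : ℕ} {φ : (Fin r → Homog 𝒢) → A} (h : MultiLin φ)
    (X : Fin (k + 1) → Homog 𝒢) : MultiLin fun Y => bsum L X Y φ := by
  intro Y q
  refine Lin.sum _ fun l => ?_
  -- The sign of the l-th term involves the varied entry only when that entry lies before l, and
  -- then only through its degree, so `Lin.sgn_smul` applies.
  have e : ∀ y, passDeg X (Function.update Y q y) l =
      passDeg X Y l + if q < l then tdeg X * ((Y q).deg + y.deg) else 0 := fun y => by
    simp only [passDeg, deg_update, Finset.sum_add_distrib, Finset.sum_ite_eq', Finset.mem_Iio,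
      mul_add]
    split_ifs <;> simp [mul_add]
  simp only [e]
  refine Lin.sgn_smul (φ := fun y => φ (wedge L X (Function.update Y q y) l)) ?_
    fun d => passDeg X Y l + if q < l then tdeg X * ((Y q).deg + d) else 0
  by_cases hq : q = l
  · subst hq
    simp only [wedge, twistT_update, Function.update_idem, Function.update_self]
    exact (h _ _).comp fun r y y' y'' hr => hr.act_right L X
  · simp only [wedge, twistT_update, Function.update_of_ne (Ne.symm hq)]
    simp only [Function.update_comm hq]
    exact (h _ _).comp fun r y y' y'' hr => hr.twist L

theorem MultiLin.bsum_left {r : ℕ} {φ : (Fin r → Homog 𝒢) → A} (h : MultiLin φ)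
    (Y : Fin r → Homog 𝒢) : MultiLin fun X => bsum L X Y φ := by
  intro X q
  refine Lin.sum _ fun l => ?_
  simp only [passDeg, tdeg_update]
  refine Lin.sgn_smul (φ := fun y => φ (wedge L (Function.update X q y) Y l)) ?_
    fun d => (tdeg X + (X q).deg + d) * ∑ q ∈ Finset.Iio l, (Y q).deg
  simp only [wedge]
  exact (h _ _).comp fun r y y' y'' hr => hr.act_left L X q (Y l)

theorem MultiLin.br_comp {φ : Homog 𝒢 → A} (h : Lin φ) : MultiLin fun Y => φ (br L Y) :=
  fun Y l => h.comp fun _ _ _ _ hr => hr.br_update L Y l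

/-! ### The Leibniz rule -/

/-- The fundamental identity. -/
theorem Lin.act_br {φ : Homog 𝒢 → A} (h : Lin φ) (X : Fin (k + 1) → Homog 𝒢)
    (Y : Fin (k + 2) → Homog 𝒢) :
    φ (act L (twistT L X) (br L Y)) = bsum L X Y fun W => φ (br L W) := by
  refine h.eq_sum _ _ _ _ (fun i => ?_) ?_
  · simp
  · rw [act_val]
    refine (L.fundamental _ _ _ _ (fun i => (X i).mem) fun i => (Y i).mem).trans ?_
    refine Finset.sum_congr rfl fun i _ => ?_
    simp only [br, wedge, comp_update (fun y : Homog 𝒢 => y.val), act_val]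
    rfl

/-- This is the fundamental identity with the term of the last entry separated: a commutator formula
for two fundamental objects acting on an element. -/
theorem Lin.act_act {φ : Homog 𝒢 → A} (h : Lin φ) (X Y : Fin (k + 1) → Homog 𝒢)
    (z : Homog 𝒢) :
    φ (act L (twistT L X) (act L Y z)) =
      bsum L X Y (fun W => φ (act L W (twist L z))) +
        sgn (tdeg X * tdeg Y) • φ (act L (twistT L Y) (act L X z)) := by
  rw [act, act, ← act, h.act_br, bsum_snocTuple]; rfl

theorem wedge_wedge_same {r : ℕ} (X Y : Fin (k + 1) → Homog 𝒢) (Z : Fin r → Homog 𝒢)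
    (l : Fin r) : wedge L (twistT L X) (wedge L Y Z l) l =
      Function.update (twistT L (twistT L Z)) l (act L (twistT L X) (act L Y (Z l))) := by
  rw [wedge, wedge_same, wedge, twistT_update, Function.update_idem]

/-- Actions at different positions do not interact: multiplicativity of α turns the twist of an
acted entry into the action of twisted objects, so both sides carry α(X · Z_q) and α(Y · Z_l). -/
theorem wedge_wedge_comm {r : ℕ} (X Y : Fin (k + 1) → Homog 𝒢) (Z : Fin r → Homog 𝒢)
    {l q : Fin r} (h : l ≠ q) : wedge L (twistT L X) (wedge L Y Z l) q =
      wedge L (twistT L Y) (wedge L X Z q) l := by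
  rw [wedge, wedge_of_ne L Y Z h.symm, wedge, twistT_update, twist_act, ← twist_act L X,
    Function.update_comm h, wedge, wedge_of_ne L X Z h, wedge, twistT_update, twist_act L X,
    ← twist_act L Y, twist_act L Y]

/-- When X and Y hit the same entry, the Leibniz rule is the fundamental identity at that entry. -/
theorem MultiLin.leibniz_same {r : ℕ} {φ : (Fin r → Homog 𝒢) → A} (h : MultiLin φ)
    (X Y : Fin (k + 1) → Homog 𝒢) (Z : Fin r → Homog 𝒢) (l : Fin r) :
    sgn (passDeg Y Z l + passDeg X Z l) • φ (wedge L (twistT L X) (wedge L Y Z l) l) =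
      sgn (passDeg Y Z l + passDeg X Z l) • bsum L X Y (fun W => φ (wedge L W (twistT L Z) l)) +
        sgn (tdeg X * tdeg Y) • sgn (passDeg X Z l + passDeg Y Z l) •
          φ (wedge L (twistT L Y) (wedge L X Z l) l) := by
  rw [wedge_wedge_same, wedge_wedge_same, (h (twistT L (twistT L Z)) l).act_act, smul_add,
    add_comm (passDeg X Z l), smul_comm (sgn (tdeg X * tdeg Y))]
  rfl

/-- The Leibniz rule for the brackets of fundamental objects. -/
theorem MultiLin.leibniz {r : ℕ} {φ : (Fin r → Homog 𝒢) → A} (h : MultiLin φ)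
    (X Y : Fin (k + 1) → Homog 𝒢) (Z : Fin r → Homog 𝒢) :
    (bsum L Y Z fun W => bsum L (twistT L X) W φ) =
      bsum L X Y (fun W => bsum L W (twistT L Z) φ) +
        sgn (tdeg X * tdeg Y) • bsum L X Z fun W => bsum L (twistT L Y) W φ := by
  -- Both iterated brackets become double sums over the position l hit by Y and the position q hit
  -- by X.
  have hA : ∀ X Y : Fin (k + 1) → Homog 𝒢, (bsum L Y Z fun W => bsum L (twistT L X) W φ) =
      ∑ l, ∑ q, sgn (passDeg Y Z l + passDeg X (wedge L Y Z l) q) •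
        φ (wedge L (twistT L X) (wedge L Y Z l) q) := by
    intro X Y
    simp only [bsum, Finset.smul_sum, sgn_smul_sgn_smul, passDeg_twistT_left]
  have hB : bsum L X Y (fun W => bsum L W (twistT L Z) φ) =
      ∑ l, sgn (passDeg Y Z l + passDeg X Z l) •
        bsum L X Y fun W => φ (wedge L W (twistT L Z) l) := by
    simp only [bsum, Finset.smul_sum]
    rw [Finset.sum_comm]
    refine Finset.sum_congr rfl fun l _ => Finset.sum_congr rfl fun q _ => ?_
    rw [smul_comm]
    refine sgn_smul_congr ?_ _
    simp only [passDeg, tdeg_wedge, twistT_deg, add_mul]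
    exact add_comm _ _
  rw [hA, hA, hB, Finset.sum_comm (s := Finset.univ) (t := Finset.univ)
    (f := fun l q => sgn (passDeg X Z l + passDeg Y (wedge L X Z l) q) •
        φ (wedge L (twistT L Y) (wedge L X Z l) q)), Finset.smul_sum, ← Finset.sum_add_distrib]
  refine Finset.sum_congr rfl fun l _ => ?_
  -- The diagonal l = q is separated: it produces the term of [X, Y], while the off-diagonal terms
  -- of the two double sums agree.
  rw [← Finset.add_sum_erase _ _ (Finset.mem_univ l), Finset.smul_sum,
    ← Finset.add_sum_erase _ (fun q => sgn (tdeg X * tdeg Y) •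
      sgn (passDeg X Z q + passDeg Y (wedge L X Z q) l) • _) (Finset.mem_univ l), ← add_assoc]
  congr 1
  · have e := h.leibniz_same L X Y Z l
    simp only [passDeg_wedge, lt_irrefl, if_false, add_zero]
    exact e
  · refine Finset.sum_congr rfl fun q hq => ?_
    have hlq : l ≠ q := (Finset.ne_of_mem_erase hq).symm
    rw [wedge_wedge_comm L X Y Z hlq, sgn_smul_sgn_smul]
    -- The object acting second picks up an extra |X||Y| exactly when it passes the entry already
    -- hit. This happens on one side only, according to the order of l and q, and accounts for the
    -- sign between the double sums.
    refine sgn_smul_congr ?_ _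
    rw [passDeg_wedge, passDeg_wedge]
    rcases lt_or_gt_of_ne hlq with h | h
    · rw [if_pos h, if_neg h.not_gt]; ring
    · rw [if_neg h.not_gt, if_pos h]; grind

end
end Homog

/-- Functions of `m` fundamental objects and one element, all entries being homogeneous. -/
abbrev Coch {K g : Type*} [Field K] [AddCommGroup g] [Module K g] (𝒢 : ZMod 2 → Submodule K g)
    (V : Type*) (k m : ℕ) : Type _ := RawCochain (Homog 𝒢) V k m

theorem zmod_two_eq (a : ZMod 2) : a = 0 ∨ a = 1 := by decide +revert

theorem Homog.bsum_apply {K g B C : Type*} {A : B → C → Type*} [Field K] [AddCommGroup g]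
    [Module K g] [∀ b c, AddCommGroup (A b c)] {𝒢 : ZMod 2 → Submodule K g} {k : ℕ}
    [∀ b c, Module K (A b c)] (L : HomNambuLieSuperalgebra 𝒢 k) {r : ℕ}
    (X : Fin (k + 1) → Homog 𝒢)
    (Y : Fin r → Homog 𝒢) (φ : (Fin r → Homog 𝒢) → ∀ b c, A b c) (b : B) (c : C) :
    bsum L X Y φ b c = bsum L X Y fun W => φ W b c := by
  simp only [bsum, Finset.sum_apply, Pi.smul_apply]

/-! ### Insertion and the action of fundamental objects on cochains -/

namespace Coch

open Homog

section

variable {K g V : Type*} [Field K] [AddCommGroup g] [Module K g] [AddCommGroup V] [Module K V]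
  {𝒢 : ZMod 2 → Submodule K g} {𝒱 : ZMod 2 → Submodule K V} {k : ℕ}

/-- Insertion of the first fundamental object. -/
def iota {m : ℕ} (X : Fin (k + 1) → Homog 𝒢) : Coch 𝒢 V k (m + 1) →ₗ[K] Coch 𝒢 V k m where
  toFun F := fun Z z => F (Fin.cons X Z) z
  map_add' _ _ := rfl
  map_smul' _ _ := rfl

theorem iota_apply {m : ℕ} (X : Fin (k + 1) → Homog 𝒢) (F : Coch 𝒢 V k (m + 1))
    (Z : Fin m → Fin (k + 1) → Homog 𝒢) (z : Homog 𝒢) : iota X F Z z = F (Fin.cons X Z) z := rfl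

/-- This is the induction principle of the calculus: an identity of cochains with at least one slot
may be checked after insertion, with one slot fewer. -/
theorem ext_iota {m : ℕ} {F F' : Coch 𝒢 V k (m + 1)} (h : ∀ X, iota X F = iota X F') :
    F = F' := by
  funext Z z
  have := congrFun (congrFun (h (Z 0)) (Fin.tail Z)) z
  simpa only [iota_apply, Fin.cons_self_tail] using this

variable (L : HomNambuLieSuperalgebra 𝒢 k)

/-- Composition with the twist in all arguments. -/
def pre {m : ℕ} : Coch 𝒢 V k m →ₗ[K] Coch 𝒢 V k m where
  toFun F := fun Z z => F (fun i => twistT L (Z i)) (twist L z)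
  map_add' _ _ := rfl
  map_smul' _ _ := rfl

theorem pre_apply {m : ℕ} (F : Coch 𝒢 V k m) (Z : Fin m → Fin (k + 1) → Homog 𝒢)
    (z : Homog 𝒢) : pre L F Z z = F (fun i => twistT L (Z i)) (twist L z) := rfl

theorem iota_pre {m : ℕ} (X : Fin (k + 1) → Homog 𝒢) (F : Coch 𝒢 V k (m + 1)) :
    iota X (pre L F) = pre L (iota (twistT L X) F) := by
  funext Z z
  simp only [iota_apply, pre_apply, comp_cons (twistT L)]

end

section

variable {K g V : Type*} [Field K] [AddCommGroup g] [Module K g] [AddCommGroup V] [Module K V]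
  {𝒢 : ZMod 2 → Submodule K g} {𝒱 : ZMod 2 → Submodule K V} {k : ℕ}
  {L : HomNambuLieSuperalgebra 𝒢 k} (M : L.GradedModule 𝒱)

/-- The representation, on homogeneous fundamental objects. -/
def rho (X : Fin (k + 1) → Homog 𝒢) : Module.End K V := M.ρ fun l => (X l).val

/-- The action of `X` on `m`-cochains of degree `e`, where the bracket terms are formed with `G`
in place of `F`. -/
def lie (s : ℕ) (X : Fin (k + 1) → Homog 𝒢) :
    (m : ℕ) → ZMod 2 → Coch 𝒢 V k m → Coch 𝒢 V k m → Coch 𝒢 V k m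
  | 0, e, F, G => fun Z z =>
      sgn (tdeg X * e) • rho M (twistPowT L s X) (F Z z) - G Z (act L X z)
  | m + 1, e, F, G => fun Z z =>
      (sgn (tdeg X * tdeg (Z 0)) •
          lie s X m (e + tdeg (Z 0)) (iota (Z 0) F) (iota (twistT L (Z 0)) G) -
        bsum L X (Z 0) fun W => pre L (iota W G)) (Fin.tail Z) z

theorem lie_zero_apply (s : ℕ) (X : Fin (k + 1) → Homog 𝒢) (e : ZMod 2) (F G : Coch 𝒢 V k 0)
    (Z : Fin 0 → Fin (k + 1) → Homog 𝒢) (z : Homog 𝒢) :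
    lie M s X 0 e F G Z z =
      sgn (tdeg X * e) • rho M (twistPowT L s X) (F Z z) - G Z (act L X z) := rfl

/-- The Cartan relation between action and insertion; it is definitional because `lie` is the
recursion solving it. -/
theorem iota_lie (s : ℕ) (X Y : Fin (k + 1) → Homog 𝒢) (m : ℕ) (e : ZMod 2)
    (F G : Coch 𝒢 V k (m + 1)) :
    iota Y (lie M s X (m + 1) e F G) =
      sgn (tdeg X * tdeg Y) • lie M s X m (e + tdeg Y) (iota Y F) (iota (twistT L Y) G) -
        bsum L X Y fun W => pre L (iota W G) := rfl

theorem lie_add (s : ℕ) (X : Fin (k + 1) → Homog 𝒢) (m : ℕ) (e : ZMod 2)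
    (F F' G G' : Coch 𝒢 V k m) :
    lie M s X m e (F + F') (G + G') = lie M s X m e F G + lie M s X m e F' G' := by
  induction m generalizing e with
  | zero =>
    funext Z z
    simp only [lie_zero_apply, Pi.add_apply, map_add, smul_add]
    abel
  | succ m ih =>
    refine ext_iota fun Y => ?_
    simp only [iota_lie, map_add, ih, bsum_add, smul_add]
    abel

theorem lie_smul (s : ℕ) (X : Fin (k + 1) → Homog 𝒢) (m : ℕ) (e : ZMod 2) (c : K)
    (F G : Coch 𝒢 V k m) :
    lie M s X m e (c • F) (c • G) = c • lie M s X m e F G := by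
  induction m generalizing e with
  | zero =>
    funext Z z
    simp only [lie_zero_apply, Pi.smul_apply, map_smul, smul_sub, smul_comm c]
  | succ m ih =>
    refine ext_iota fun Y => ?_
    simp only [iota_lie, map_smul, ih, smul_sub, bsum, Finset.smul_sum, smul_comm c]

/-- `lie` as a linear map. -/
def lieHom (s : ℕ) (X : Fin (k + 1) → Homog 𝒢) (m : ℕ) (e : ZMod 2) :
    Coch 𝒢 V k m × Coch 𝒢 V k m →ₗ[K] Coch 𝒢 V k m where
  toFun p := lie M s X m e p.1 p.2
  map_add' p q := lie_add M s X m e p.1 q.1 p.2 q.2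
  map_smul' c p := lie_smul M s X m e c p.1 p.2

theorem lie_sgn_smul (s : ℕ) (X : Fin (k + 1) → Homog 𝒢) (m : ℕ) (e a : ZMod 2)
    (F G : Coch 𝒢 V k m) :
    lie M s X m e (sgn a • F) (sgn a • G) = sgn a • lie M s X m e F G :=
  map_sgn_smul (lieHom M s X m e) a (F, G)

theorem lie_sub (s : ℕ) (X : Fin (k + 1) → Homog 𝒢) (m : ℕ) (e : ZMod 2)
    (F F' G G' : Coch 𝒢 V k m) :
    lie M s X m e (F - F') (G - G') = lie M s X m e F G - lie M s X m e F' G' :=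
  map_sub (lieHom M s X m e) (F, G) (F', G')

theorem lie_bsum (s : ℕ) (X : Fin (k + 1) → Homog 𝒢) (m : ℕ) (e : ZMod 2) {r : ℕ}
    (Y : Fin (k + 1) → Homog 𝒢) (Z : Fin r → Homog 𝒢)
    (φ ψ : (Fin r → Homog 𝒢) → Coch 𝒢 V k m) :
    lie M s X m e (bsum L Y Z φ) (bsum L Y Z ψ) =
      bsum L Y Z fun W => lie M s X m e (φ W) (ψ W) := by
  have h := map_bsum L (lieHom M s X m e) Y Z fun W => (φ W, ψ W)
  have e : bsum L Y Z (fun W => (φ W, ψ W)) = (bsum L Y Z φ, bsum L Y Z ψ) :=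
    Prod.ext (map_bsum L (LinearMap.fst K _ _) Y Z fun W => (φ W, ψ W))
      (map_bsum L (LinearMap.snd K _ _) Y Z fun W => (φ W, ψ W))
  rw [e] at h
  exact h

/-- Twisting all arguments commutes with the action at the cost of one power of α, since α^s(α(X)) =
α^(s+1)(X). -/
theorem pre_lie (s : ℕ) (X : Fin (k + 1) → Homog 𝒢) (m : ℕ) (e : ZMod 2)
    (F G : Coch 𝒢 V k m) :
    pre L (lie M s (twistT L X) m e F G) = lie M (s + 1) X m e (pre L F) (pre L G) := by
  induction m generalizing e with
  | zero =>
    funext Z z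
    simp only [lie_zero_apply, pre_apply, twistPowT_succ, twist_act, tdeg_twistT]
  | succ m ih =>
    refine ext_iota fun Y => ?_
    simp only [iota_lie, iota_pre, map_sub, map_sgn_smul, ih, bsum_twistT, tdeg_twistT, map_bsum]

/-- `ν ∘ F = G ∘ α`. -/
def Compat {m : ℕ} (F G : Coch 𝒢 V k m) : Prop :=
  ∀ Z z, M.ν (F Z z) = pre L G Z z

/-- Inserting X into F forces inserting α(X) into G. Even when F = G initially, the two members
become different, which is why the operators take pairs. -/
theorem compat_iota {m : ℕ} {F G : Coch 𝒢 V k (m + 1)} (h : Compat M F G)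
    (X : Fin (k + 1) → Homog 𝒢) : Compat M (iota X F) (iota (twistT L X) G) := by
  intro Z z
  rw [← iota_pre]
  exact h _ _

/-- Linearity in each entry. -/
def MultiLinC {m : ℕ} (F : Coch 𝒢 V k m) : Prop :=
  (∀ (X : Fin m → Fin (k + 1) → Homog 𝒢) (z : Homog 𝒢) (i : Fin m) (l : Fin (k + 1)),
    Lin fun y => F (Function.update X i (Function.update (X i) l y)) z) ∧ ∀ X, Lin (F X)

theorem multiLinC_succ_iff {m : ℕ} {F : Coch 𝒢 V k (m + 1)} :
    MultiLinC F ↔ MultiLin (fun X => iota X F) ∧ ∀ X, MultiLinC (iota X F) := by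
  constructor
  · rintro ⟨h₁, h₂⟩
    refine ⟨fun X l r y y' y'' hr => ?_, fun X => ⟨fun Z z i l => ?_, fun Z => h₂ _⟩⟩
    · funext Z z
      have := h₁ (Fin.cons X Z) z 0 l r y y' y'' hr
      simp only [Fin.cons_zero, Fin.update_cons_zero] at this
      exact this
    · have := h₁ (Fin.cons X Z) z i.succ l
      simp only [Fin.cons_succ, ← Fin.cons_update] at this
      exact this
  · rintro ⟨h₁, h₂⟩
    refine ⟨fun X z i l => ?_, fun X => ?_⟩
    · rw [← Fin.cons_self_tail X]
      refine Fin.cases ?_ (fun i => ?_) i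
      · intro r y y' y'' hr
        have := congrFun (congrFun (h₁ (X 0) l r y y' y'' hr) (Fin.tail X)) z
        simp only [Fin.cons_zero, Fin.update_cons_zero]
        exact this
      · have := (h₂ (X 0)).1 (Fin.tail X) z i l
        simp only [Fin.cons_succ, ← Fin.cons_update]
        exact this
    · rw [← Fin.cons_self_tail X]
      exact (h₂ (X 0)).2 (Fin.tail X)

theorem rho_comp (X Y : Fin (k + 1) → Homog 𝒢) (v : V) :
    rho M (twistT L X) (rho M Y v) =
      sgn (tdeg X * tdeg Y) • rho M (twistT L Y) (rho M X v) +
        bsum L X Y fun W => rho M W (M.ν v) := by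
  refine (M.ρ_comp _ _ _ _ (fun i => (X i).mem) (fun i => (Y i).mem) v).trans ?_
  congr 1
  refine Finset.sum_congr rfl fun l _ => ?_
  simp only [rho, wedge, comp_update (fun y : Homog 𝒢 => y.val), act_val]
  rfl

theorem nu_rho (X : Fin (k + 1) → Homog 𝒢) (v : V) :
    M.ν (rho M X v) = rho M (twistT L X) (M.ν v) := M.ν_ρ _ _

theorem bsum_twistPowT (s : ℕ) {A : Type*} [AddCommGroup A] [Module K A] {r : ℕ}
    (X : Fin (k + 1) → Homog 𝒢) (Y : Fin r → Homog 𝒢) (φ : (Fin r → Homog 𝒢) → A) :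
    bsum L (twistPowT L s X) (twistPowT L s Y) φ =
      bsum L X Y fun W => φ (twistPowT L s W) := by
  simp only [bsum, twistPowT_wedge]; rfl

/-- Applying the Cartan relation twice leaves four kinds of terms: U untouched, hit by Y only, hit
by X only, or hit by both. In the graded commutator the two middle kinds are exchanged and cancel.
-/
theorem iota_lie_lie (s : ℕ) (X Y U : Fin (k + 1) → Homog 𝒢) (m : ℕ) (e : ZMod 2)
    (F G H : Coch 𝒢 V k (m + 1)) :
    iota U (lie M (s + 1) X (m + 1) (e + tdeg Y) (lie M s Y (m + 1) e F G)
        (lie M s (twistT L Y) (m + 1) e G H)) =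
      sgn (tdeg X * tdeg U + tdeg Y * tdeg U) •
          lie M (s + 1) X m (e + tdeg U + tdeg Y)
            (lie M s Y m (e + tdeg U) (iota U F) (iota (twistT L U) G))
            (lie M s (twistT L Y) m (e + tdeg U) (iota (twistT L U) G)
              (iota (twistT L (twistT L U)) H)) -
        sgn (tdeg X * tdeg U) • (bsum L Y U fun W =>
          lie M (s + 1) X m (e + tdeg U + tdeg Y) (pre L (iota W G))
            (pre L (iota (twistT L W) H))) -
        sgn (tdeg Y * tdeg X + tdeg Y * tdeg U) • (bsum L X U fun W =>
          lie M (s + 1) Y m (e + tdeg U + tdeg X) (pre L (iota W G))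
            (pre L (iota (twistT L W) H))) +
        pre L (pre L (bsum L X U fun W => bsum L (twistT L Y) W fun W' => iota W' H)) := by
  have h : (bsum L X U fun W => pre L (iota W (lie M s (twistT L Y) (m + 1) e G H))) =
      sgn (tdeg Y * tdeg X + tdeg Y * tdeg U) • (bsum L X U fun W =>
          lie M (s + 1) Y m (e + tdeg U + tdeg X) (pre L (iota W G))
            (pre L (iota (twistT L W) H))) -
        pre L (pre L (bsum L X U fun W => bsum L (twistT L Y) W fun W' => iota W' H)) := by
    rw [← bsum_sgn_smul, map_bsum, map_bsum, ← bsum_sub]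
    refine bsum_congr L X U fun W hW => ?_
    rw [iota_lie, map_sub, map_sgn_smul, pre_lie, map_bsum, map_bsum, map_bsum, hW, tdeg_twistT,
      mul_add, add_right_comm e, add_assoc e, add_comm (tdeg X)]
  rw [iota_lie, h, iota_lie, iota_lie, bsum_twistT, lie_sub, lie_bsum, tdeg_twistT, tdeg_twistT,
    lie_sgn_smul, smul_sub, sgn_smul_sgn_smul, add_right_comm e]
  abel

/-- The commutator of the actions of two fundamental objects. -/
theorem lie_lie (s : ℕ) (X Y : Fin (k + 1) → Homog 𝒢) (m : ℕ) (e : ZMod 2)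
    {F G H : Coch 𝒢 V k m} (hFG : Compat M F G) (hH : MultiLinC H) :
    lie M (s + 1) X m (e + tdeg Y) (lie M s Y m e F G) (lie M s (twistT L Y) m e G H) =
      sgn (tdeg X * tdeg Y) •
        (lie M (s + 1) Y m (e + tdeg X) (lie M s X m e F G) (lie M s (twistT L X) m e G H) +
          bsum L X Y fun W => pre L (lie M s W m e G H)) := by
  induction m generalizing e with
  | zero =>
    funext Z z
    -- For m = 0 the commutator splits into two known ones: the fundamental identity on the argument
    -- z, and `ρ_comp` on the value, where compatibility turns ν F into the twist of G.
    have h1 := (hH.2 Z).act_act L X Y z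
    have h2 := rho_comp M (twistPowT L s X) (twistPowT L s Y) (F Z z)
    rw [← twistPowT_succ', ← twistPowT_succ', bsum_twistPowT, hFG, pre_apply] at h2
    have h3 : bsum L X Y (fun W => pre L (lie M s W 0 e G H)) Z z =
        sgn ((tdeg X + tdeg Y) * e) •
            bsum L X Y (fun W => rho M (twistPowT L s W) (pre L G Z z)) -
          bsum L X Y (fun W => H Z (act L W (twist L z))) := by
      rw [bsum_apply, ← bsum_sgn_smul, ← bsum_sub]
      refine bsum_congr L X Y fun W hW => ?_
      rw [pre_apply, lie_zero_apply, hW, pre_apply, Subsingleton.elim (fun i => _) Z]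
    rw [Pi.smul_apply, Pi.smul_apply, Pi.add_apply, Pi.add_apply, h3]
    rw [pre_apply, Subsingleton.elim (fun i => twistT L (Z i)) Z]
    simp only [lie_zero_apply, ← twistPowT_succ, tdeg_twistT, map_sub, map_sgn_smul]
    rw [tdeg_twistPowT, tdeg_twistPowT, Subsingleton.elim (fun i => twistT L (Z i)) Z] at h2
    rw [h1, h2]
    clear h1 h2 h3
    -- The signs now depend only on the parities of X, Y and e, which leaves eight cases.
    generalize tdeg X = x, tdeg Y = y
    rcases zmod_two_eq x with rfl | rfl <;> rcases zmod_two_eq y with rfl | rfl <;>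
      rcases zmod_two_eq e with rfl | rfl <;> simp [CharTwo.add_self_eq_zero] <;> abel
  | succ m ih =>
    refine ext_iota fun U => ?_
    -- The terms in which U is hit twice are compared by the Leibniz rule, and those with U
    -- untouched by the induction hypothesis.
    have h1 := (multiLinC_succ_iff.1 hH).1.leibniz L X Y U
    have h3 := ih (e + tdeg U) (compat_iota M hFG U)
      ((multiLinC_succ_iff.1 hH).2 (twistT L (twistT L U)))
    have h4 : iota U (bsum L X Y fun W => pre L (lie M s W (m + 1) e G H)) =
        sgn (tdeg X * tdeg U + tdeg Y * tdeg U) • (bsum L X Y fun W =>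
            pre L (lie M s W m (e + tdeg U) (iota (twistT L U) G)
              (iota (twistT L (twistT L U)) H))) -
          pre L (pre L (bsum L X Y fun W => bsum L W (twistT L U) fun W' => iota W' H)) := by
      rw [map_bsum, map_bsum, map_bsum, ← bsum_sgn_smul, ← bsum_sub]
      refine bsum_congr L X Y fun W hW => ?_
      rw [iota_pre, iota_lie, map_sub, map_sgn_smul, hW, tdeg_twistT, add_mul, map_bsum, map_bsum]
      simp only [map_bsum]
    rw [iota_lie_lie, map_sgn_smul, map_add, iota_lie_lie, h4, h3, h1]
    simp only [map_add, map_sgn_smul]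
    rw [mul_comm (tdeg Y) (tdeg X)]
    clear h1 h3 h4 ih
    simp only [sgn_add, mul_smul, smul_add, smul_sub]
    -- All remaining coefficients are products of three signs; for each of their eight values the
    -- identity holds in the abelian group of cochains.
    rcases Int.units_eq_one_or (sgn (tdeg X * tdeg Y)) with h | h <;>
      rcases Int.units_eq_one_or (sgn (tdeg X * tdeg U)) with h' | h' <;>
      rcases Int.units_eq_one_or (sgn (tdeg Y * tdeg U)) with h'' | h'' <;>
      rw [h, h', h''] <;> simp only [one_smul, Units.neg_smul, smul_neg, neg_neg] <;> abel

end
end Coch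

/-! ### Brackets with one argument in the module -/

namespace Coch

open Homog

section

variable {K g V : Type*} [Field K] [AddCommGroup g] [Module K g] [AddCommGroup V] [Module K V]
  {𝒢 : ZMod 2 → Submodule K g} {𝒱 : ZMod 2 → Submodule K V} {k : ℕ}
  {L : HomNambuLieSuperalgebra 𝒢 k} (M : L.GradedModule 𝒱)

/-- The mixed bracket, on homogeneous elements. -/
def mixed (Y : Fin (k + 2) → Homog 𝒢) (p : Fin (k + 2)) (a : ZMod 2) (v : V) : V :=
  mixedBracket M (fun j => (Y j).deg) (fun j => (Y j).val) p a v

theorem mixed_eq (Y : Fin (k + 2) → Homog 𝒢) (p : Fin (k + 2)) (a : ZMod 2) (v : V) :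
    mixed M Y p a v =
      sgn (((k + 1 - (p : ℕ) : ℕ) : ZMod 2) + a * ∑ j ∈ Finset.Ioi p, (Y j).deg) •
        rho M (fun j => Y (p.succAbove j)) v := rfl

theorem mixed_add (Y : Fin (k + 2) → Homog 𝒢) (p : Fin (k + 2)) (a : ZMod 2) (v w : V) :
    mixed M Y p a (v + w) = mixed M Y p a v + mixed M Y p a w := by
  simp only [mixed_eq, map_add, smul_add]

theorem mixed_sub (Y : Fin (k + 2) → Homog 𝒢) (p : Fin (k + 2)) (a : ZMod 2) (v w : V) :
    mixed M Y p a (v - w) = mixed M Y p a v - mixed M Y p a w := by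
  simp only [mixed_eq, map_sub, smul_sub]

theorem mixed_smul (Y : Fin (k + 2) → Homog 𝒢) (p : Fin (k + 2)) (a : ZMod 2) (c : K) (v : V) :
    mixed M Y p a (c • v) = c • mixed M Y p a v := by
  simp only [mixed_eq, map_smul, smul_comm c]

theorem mixed_sgn_smul (Y : Fin (k + 2) → Homog 𝒢) (p : Fin (k + 2)) (a b : ZMod 2) (v : V) :
    mixed M Y p a (sgn b • v) = sgn b • mixed M Y p a v := by
  simp only [mixed_eq, map_sgn_smul, smul_comm (sgn b)]

theorem mixed_congr {Y Y' : Fin (k + 2) → Homog 𝒢} {p : Fin (k + 2)}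
    (h : ∀ j, j ≠ p → Y j = Y' j) (a : ZMod 2) (v : V) : mixed M Y p a v = mixed M Y' p a v := by
  simp only [mixed_eq]
  rw [Finset.sum_congr rfl fun j hj => by rw [h j (Finset.mem_Ioi.1 hj).ne']]
  congr 2
  congr 1
  exact funext fun j => h _ (Fin.succAbove_ne p j)

theorem nu_mixed (Y : Fin (k + 2) → Homog 𝒢) (p : Fin (k + 2)) (a : ZMod 2) (v : V) :
    M.ν (mixed M Y p a v) = mixed M (twistT L Y) p a (M.ν v) := by
  rw [mixed_eq, map_sgn_smul, nu_rho]
  rfl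

theorem wedge_succAbove (X : Fin (k + 1) → Homog 𝒢) (Y : Fin (k + 2) → Homog 𝒢)
    (p : Fin (k + 2)) (j : Fin (k + 1)) :
    wedge L X (fun i => Y (p.succAbove i)) j =
      fun i => wedge L X Y (p.succAbove j) (p.succAbove i) := by
  funext i
  by_cases h : i = j
  · subst h; rw [wedge_same, wedge_same]
  · rw [wedge_of_ne _ _ _ h, wedge_of_ne _ _ _ fun h' => h (Fin.succAbove_right_injective h')]

/-- The action of a fundamental object is a derivation of the mixed bracket. -/
theorem rho_mixed (X : Fin (k + 1) → Homog 𝒢) (Y : Fin (k + 2) → Homog 𝒢) (p : Fin (k + 2))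
    (a : ZMod 2) (v : V) :
    rho M (twistT L X) (mixed M Y p a v) =
      sgn (passDeg X Y p) • mixed M (twistT L Y) p (a + tdeg X) (rho M X v) +
        ∑ j, sgn (passDeg X Y (p.succAbove j) +
            if p < p.succAbove j then tdeg X * (a + (Y p).deg) else 0) •
          mixed M (wedge L X Y (p.succAbove j)) p a (M.ν v) := by
  have hs : tdeg (fun j => Y (p.succAbove j)) =
      ∑ q ∈ Finset.Iio p, (Y q).deg + ∑ q ∈ Finset.Ioi p, (Y q).deg := by
    have h1 := Finset.sum_Iio_add_Ioi p fun q => (Y q).deg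
    rw [Fin.sum_univ_succAbove _ p] at h1
    simp only [tdeg]
    grind
  rw [mixed_eq, map_sgn_smul, rho_comp, smul_add]
  congr 1
  · rw [mixed_eq, sgn_smul_sgn_smul, sgn_smul_sgn_smul]
    refine sgn_smul_congr ?_ _
    simp only [hs, passDeg, twistT_deg]
    ring
  · simp only [bsum, Finset.smul_sum]
    refine Finset.sum_congr rfl fun j _ => ?_
    rw [mixed_eq, wedge_succAbove, sgn_smul_sgn_smul, sgn_smul_sgn_smul]
    refine sgn_smul_congr ?_ _
    simp only [passDeg, Finset.sum_Iio_succAbove, wedge_deg, Finset.sum_add_distrib,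
      Finset.sum_ite_eq', Finset.mem_Ioi]
    split_ifs <;> grind

/-- The sum `∑ l, [α^s(Y₁), …, F(Y_l), …, α^s(Y_n)]` with its signs, for `F` of degree `e`. -/
def ins (s : ℕ) (e : ZMod 2) (F : Homog 𝒢 → V) (Y : Fin (k + 2) → Homog 𝒢) : V :=
  ∑ l, sgn (e * ∑ q ∈ Finset.Iio l, (Y q).deg) •
    mixed M (twistPowT L s Y) l (e + (Y l).deg) (F (Y l))

/-- By the derivation rule for mixed brackets, X hits either the value F(Y_l) or another entry. The
latter terms also occur in the bracket sum and cancel; what is left is the action of X on F itself.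
-/
theorem rho_ins (s : ℕ) (e : ZMod 2) {F G : Homog 𝒢 → V} (h : ∀ z, M.ν (F z) = G (twist L z))
    (X : Fin (k + 1) → Homog 𝒢) (Y : Fin (k + 2) → Homog 𝒢) :
    sgn (tdeg X * e) • rho M (twistPowT L (s + 1) X) (ins M s e F Y) - bsum L X Y (ins M s e G) =
      ins M (s + 1) (e + tdeg X)
        (fun z => sgn (tdeg X * e) • rho M (twistPowT L s X) (F z) - G (act L X z)) Y := by
  simp only [ins, bsum, map_sum, Finset.smul_sum]
  rw [Finset.sum_comm (s := Finset.univ) (t := Finset.univ), ← Finset.sum_sub_distrib]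
  refine Finset.sum_congr rfl fun l _ => ?_
  -- In the bracket sum, the summand in which X hits the entry seen by G is separated from the
  -- others.
  rw [Fin.sum_univ_succAbove _ l, map_sgn_smul, twistPowT_succ', rho_mixed, mixed_sub,
    mixed_sgn_smul, h, smul_add, smul_add, Finset.smul_sum, Finset.smul_sum, smul_sub,
    add_sub_add_comm, ← Finset.sum_sub_distrib]
  rw [Finset.sum_eq_zero (s := Finset.univ), add_zero]
  · congr 1
    · rw [← twistPowT_succ', sgn_smul_sgn_smul, sgn_smul_sgn_smul, sgn_smul_sgn_smul,
        tdeg_twistPowT, add_right_comm e]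
      refine sgn_smul_congr ?_ _
      simp only [passDeg, twistPowT_deg, tdeg_twistPowT]
      ring
    · rw [wedge_same, mixed_congr M (Y := twistPowT L s (wedge L X Y l))
        (Y' := twistPowT L (s + 1) Y), sgn_smul_sgn_smul, act_deg, add_assoc e]
      · refine sgn_smul_congr ?_ _
        simp only [passDeg, wedge_deg, Finset.sum_add_distrib, Finset.sum_ite_eq', Finset.mem_Iio,
          lt_irrefl, if_false]
        ring
      · intro j hj
        simp only [twistPowT, wedge_of_ne _ _ _ hj, twistPow_succ]
  -- Here X hits an entry other than the l-th. The two terms coincide because ν F(Y_l) = G(α(Y_l)).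
  · intro j _
    have hj : l ≠ l.succAbove j := (Fin.succAbove_ne l j).symm
    rw [sub_eq_zero, wedge_of_ne _ _ _ hj, ← twistPowT_wedge, sgn_smul_sgn_smul,
      sgn_smul_sgn_smul, sgn_smul_sgn_smul, twist_deg]
    refine sgn_smul_congr ?_ _
    simp only [passDeg, twistPowT_deg, tdeg_twistPowT, wedge_deg, Finset.sum_add_distrib,
      Finset.sum_ite_eq', Finset.mem_Iio]
    rcases lt_or_gt_of_ne hj with h | h
    · simp only [if_pos h, if_neg h.not_gt]; grind
    · simp only [if_pos h, if_neg h.not_gt]; grind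

theorem rho_br {a : Fin k → Homog 𝒢} (Y : Fin (k + 2) → Homog 𝒢) (v : V) :
    rho M (snocTuple (twistT L a) (br L Y)) (M.ν v) =
      ∑ i : Fin (k + 2),
        sgn (((k + 1 - (i : ℕ) : ℕ) : ZMod 2) + tdeg a * tdeg (fun j => Y (i.succAbove j)) +
            (Y i).deg * ∑ j ∈ Finset.Ioi i, (Y j).deg) •
          rho M (twistT L fun j => Y (i.succAbove j)) (rho M (snocTuple a (Y i)) v) := by
  have h := M.ρ_bracket _ _ _ _ (fun i => (a i).mem) (fun i => (Y i).mem) v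
  simp only [rho, comp_snocTuple (fun y : Homog 𝒢 => y.val)]
  exact h

theorem tdeg_eq_add_succAbove {r : ℕ} (X : Fin (r + 1) → Homog 𝒢) (l : Fin (r + 1)) :
    tdeg X = (X l).deg + tdeg fun j => X (l.succAbove j) :=
  Fin.sum_univ_succAbove _ l

theorem mixed_snocTuple_castSucc (X : Fin (k + 1) → Homog 𝒢) (z : Homog 𝒢) (l : Fin (k + 1))
    (a : ZMod 2) (v : V) :
    mixed M (snocTuple X z) l.castSucc a v =
      sgn (((k + 1 - (l : ℕ) : ℕ) : ZMod 2) + a * (∑ j ∈ Finset.Ioi l, (X j).deg + z.deg)) •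
        rho M (snocTuple (fun j => X (l.succAbove j)) z) v := by
  rw [mixed_eq, snocTuple_succAbove_castSucc, Finset.sum_Ioi_castSucc]
  simp only [snocTuple_castSucc, snocTuple_last, Fin.val_castSucc]

theorem mixed_snocTuple_last (X : Fin (k + 1) → Homog 𝒢) (z : Homog 𝒢) (a : ZMod 2) (v : V) :
    mixed M (snocTuple X z) (Fin.last _) a v = rho M X v := by
  rw [mixed_eq, Finset.sum_Ioi_last]
  simp [Fin.succAbove_last]

/-- The fundamental identity with one entry of the acting fundamental object in the module. -/
theorem mixed_br (X : Fin (k + 1) → Homog 𝒢) (l : Fin (k + 1)) (Y : Fin (k + 2) → Homog 𝒢)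
    (a : ZMod 2) (v : V) :
    mixed M (snocTuple (twistT L X) (br L Y)) l.castSucc (a + (X l).deg) (M.ν v) =
      ∑ i, sgn ((a + tdeg X) * ∑ q ∈ Finset.Iio i, (Y q).deg) •
        mixed M (twistT L Y) i (a + tdeg X + (Y i).deg)
          (mixed M (snocTuple X (Y i)) l.castSucc (a + (X l).deg) v) := by
  rw [mixed_snocTuple_castSucc]
  -- Removing the entry at l leaves n − 2 twisted entries followed by the bracket of Y, which is the
  -- left side of `ρ_bracket`.
  change _ • rho M (snocTuple (twistT L fun j => X (l.succAbove j)) (br L Y)) (M.ν v) = _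
  rw [rho_br, Finset.smul_sum]
  refine Finset.sum_congr rfl fun i _ => ?_
  rw [mixed_snocTuple_castSucc, mixed_sgn_smul, mixed_eq, sgn_smul_sgn_smul, sgn_smul_sgn_smul,
    sgn_smul_sgn_smul]
  refine sgn_smul_congr ?_ _
  have h1 := tdeg_eq_add_succAbove X l
  have h2 := tdeg_eq_add_succAbove Y i
  have h3 := Finset.sum_Iio_add_Ioi i fun q => (Y q).deg
  change tdeg Y = _ at h3
  simp only [twistT_deg, br_deg]
  grind

/-- The part of `ins` in which the cochain is not evaluated at the last entry. -/
def insInit (s : ℕ) (e : ZMod 2) (X : Fin (k + 1) → Homog 𝒢) (F : Homog 𝒢 → V) (z : Homog 𝒢) :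
    V :=
  ∑ l, sgn (e * ∑ q ∈ Finset.Iio l, (X q).deg) •
    mixed M (snocTuple (twistPowT L s X) (twistPow L s z)) l.castSucc (e + (X l).deg) (F (X l))

theorem ins_snocTuple (s : ℕ) (e : ZMod 2) (F : Homog 𝒢 → V) (X : Fin (k + 1) → Homog 𝒢)
    (z : Homog 𝒢) :
    ins M s e F (snocTuple X z) =
      insInit M s e X F z + sgn (tdeg X * e) • rho M (twistPowT L s X) (F z) := by
  rw [ins, Fin.sum_univ_castSucc, Finset.sum_Iio_last, twistPowT_snocTuple, mixed_snocTuple_last,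
    mul_comm (tdeg X)]
  simp only [Finset.sum_Iio_castSucc, snocTuple_castSucc, snocTuple_last]
  rfl

/-- After exchanging the two sums, each fixed entry X_l contributes one instance of `mixed_br`. This
is where δδ = 0 uses the second module axiom. -/
theorem ins_insInit (s : ℕ) (e : ZMod 2) {F G : Homog 𝒢 → V}
    (h : ∀ z, M.ν (F z) = G (twist L z)) (X : Fin (k + 1) → Homog 𝒢)
    (Y : Fin (k + 2) → Homog 𝒢) :
    ins M (s + 1) (e + tdeg X) (insInit M s e X F) Y =
      insInit M s e (twistT L X) G (br L Y) := by
  have hm : ∀ (l) (a : ZMod 2) {ι : Type} (t : Finset ι) (f : ι → V),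
      mixed M (twistPowT L (s + 1) Y) l a (∑ i ∈ t, f i) =
        ∑ i ∈ t, mixed M (twistPowT L (s + 1) Y) l a (f i) := fun l a _ t f => by
    simp only [mixed_eq, map_sum, Finset.smul_sum]
  simp only [ins, insInit, hm, Finset.smul_sum]
  rw [Finset.sum_comm]
  refine Finset.sum_congr rfl fun l _ => ?_
  have e1 := mixed_br M (twistPowT L s X) l (twistPowT L s Y) e (F (X l))
  rw [h, ← twistPowT_succ', ← twistPow_br] at e1
  rw [← twistPowT_succ]
  change _ = _ • mixed M _ _ _ (G (twist L (X l)))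
  refine Eq.trans ?_ (congrArg (fun w => sgn _ • w) e1.symm)
  simp only [Finset.smul_sum]
  refine Finset.sum_congr rfl fun i _ => ?_
  rw [mixed_sgn_smul, smul_comm, ← twistPowT_succ']
  rfl

end
end Coch

/-! ### The coboundary through Cartan's formula, and its square -/

namespace Coch

open Homog

section

variable {K g V : Type*} [Field K] [AddCommGroup g] [Module K g] [AddCommGroup V] [Module K V]
  {𝒢 : ZMod 2 → Submodule K g} {𝒱 : ZMod 2 → Submodule K V} {k : ℕ}
  {L : HomNambuLieSuperalgebra 𝒢 k} (M : L.GradedModule 𝒱)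

/-- The coboundary of `m`-cochains of degree `e` with exponent `s` of the twist, where the bracket
terms are formed with `G` in place of `F`. -/
def cobd (s : ℕ) : (m : ℕ) → ZMod 2 → Coch 𝒢 V k m → Coch 𝒢 V k m → Coch 𝒢 V k (m + 1)
  | 0, e, F, G => fun Z z =>
      ins M s e (F (Fin.tail Z)) (snocTuple (Z 0) z) - G (Fin.tail Z) (act L (Z 0) z)
  | m + 1, e, F, G => fun Z z =>
      (lie M s (Z 0) (m + 1) e F G -
        cobd s m (e + tdeg (Z 0)) (iota (Z 0) F) (iota (twistT L (Z 0)) G)) (Fin.tail Z) z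

/-- In lowest degree δF measures the failure of F to be a derivation. It is a function of the
n-tuple (X, z), without a distinguished last entry. -/
theorem iota_cobd_zero (s : ℕ) (e : ZMod 2) (F G : Coch 𝒢 V k 0) (X : Fin (k + 1) → Homog 𝒢)
    (Z : Fin 0 → Fin (k + 1) → Homog 𝒢) (z : Homog 𝒢) :
    iota X (cobd M s 0 e F G) Z z =
      ins M s e (F Z) (snocTuple X z) - G Z (br L (snocTuple X z)) := rfl

/-- Cartan's formula, again definitional: it is the recursion that defines `cobd`. -/
theorem iota_cobd (s m : ℕ) (e : ZMod 2) (F G : Coch 𝒢 V k (m + 1))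
    (X : Fin (k + 1) → Homog 𝒢) :
    iota X (cobd M s (m + 1) e F G) = lie M s X (m + 1) e F G -
      cobd M s m (e + tdeg X) (iota X F) (iota (twistT L X) G) := rfl

theorem ins_add (s : ℕ) (e : ZMod 2) (F F' : Homog 𝒢 → V) (Y : Fin (k + 2) → Homog 𝒢) :
    ins M s e (fun z => F z + F' z) Y = ins M s e F Y + ins M s e F' Y := by
  simp only [ins, mixed_add, smul_add, Finset.sum_add_distrib]

theorem ins_smul (s : ℕ) (e : ZMod 2) (c : K) (F : Homog 𝒢 → V) (Y : Fin (k + 2) → Homog 𝒢) :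
    ins M s e (fun z => c • F z) Y = c • ins M s e F Y := by
  simp only [ins, mixed_smul, Finset.smul_sum, smul_comm c]

theorem cobd_add (s m : ℕ) (e : ZMod 2) (F F' G G' : Coch 𝒢 V k m) :
    cobd M s m e (F + F') (G + G') = cobd M s m e F G + cobd M s m e F' G' := by
  induction m generalizing e with
  | zero =>
    refine ext_iota fun X => ?_
    funext Z z
    have h := ins_add M s e (F Z) (F' Z) (snocTuple X z)
    simp only [map_add, Pi.add_apply, iota_cobd_zero]
    refine (congrArg (· - _) h).trans ?_
    abel
  | succ m ih =>
    refine ext_iota fun Y => ?_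
    simp only [iota_cobd, map_add, ih, lie_add]
    abel

theorem cobd_smul (s m : ℕ) (e : ZMod 2) (c : K) (F G : Coch 𝒢 V k m) :
    cobd M s m e (c • F) (c • G) = c • cobd M s m e F G := by
  induction m generalizing e with
  | zero =>
    refine ext_iota fun X => ?_
    funext Z z
    have h := ins_smul M s e c (F Z) (snocTuple X z)
    simp only [map_smul, Pi.smul_apply, iota_cobd_zero, smul_sub]
    exact congrArg (· - _) h
  | succ m ih =>
    refine ext_iota fun Y => ?_
    simp only [iota_cobd, map_smul, ih, lie_smul, smul_sub]

/-- `cobd` as a linear map. -/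
def cobdHom (s m : ℕ) (e : ZMod 2) :
    Coch 𝒢 V k m × Coch 𝒢 V k m →ₗ[K] Coch 𝒢 V k (m + 1) where
  toFun p := cobd M s m e p.1 p.2
  map_add' p q := cobd_add M s m e p.1 q.1 p.2 q.2
  map_smul' c p := cobd_smul M s m e c p.1 p.2

theorem cobd_sgn_smul (s m : ℕ) (e a : ZMod 2) (F G : Coch 𝒢 V k m) :
    cobd M s m e (sgn a • F) (sgn a • G) = sgn a • cobd M s m e F G :=
  map_sgn_smul (cobdHom M s m e) a (F, G)

theorem cobd_sub (s m : ℕ) (e : ZMod 2) (F F' G G' : Coch 𝒢 V k m) :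
    cobd M s m e (F - F') (G - G') = cobd M s m e F G - cobd M s m e F' G' :=
  map_sub (cobdHom M s m e) (F, G) (F', G')

theorem cobd_bsum (s m : ℕ) (e : ZMod 2) {r : ℕ}
    (Y : Fin (k + 1) → Homog 𝒢) (Z : Fin r → Homog 𝒢)
    (φ ψ : (Fin r → Homog 𝒢) → Coch 𝒢 V k m) :
    cobd M s m e (bsum L Y Z φ) (bsum L Y Z ψ) =
      bsum L Y Z fun W => cobd M s m e (φ W) (ψ W) := by
  have h := map_bsum L (cobdHom M s m e) Y Z fun W => (φ W, ψ W)
  have e : bsum L Y Z (fun W => (φ W, ψ W)) = (bsum L Y Z φ, bsum L Y Z ψ) :=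
    Prod.ext (map_bsum L (LinearMap.fst K _ _) Y Z fun W => (φ W, ψ W))
      (map_bsum L (LinearMap.snd K _ _) Y Z fun W => (φ W, ψ W))
  rw [e] at h
  exact h

theorem ins_twistT (s : ℕ) (e : ZMod 2) (F : Homog 𝒢 → V) (Y : Fin (k + 2) → Homog 𝒢) :
    ins M s e F (twistT L Y) = ins M (s + 1) e (fun z => F (twist L z)) Y := by
  simp only [ins, ← twistPowT_succ]; rfl

theorem pre_cobd (s m : ℕ) (e : ZMod 2) (F G : Coch 𝒢 V k m) :
    pre L (cobd M s m e F G) = cobd M (s + 1) m e (pre L F) (pre L G) := by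
  induction m generalizing e with
  | zero =>
    refine ext_iota fun X => ?_
    funext Z z
    rw [iota_pre, pre_apply, iota_cobd_zero, iota_cobd_zero, ← twistT_snocTuple, ins_twistT,
      ← twist_br]
    rfl
  | succ m ih =>
    refine ext_iota fun Y => ?_
    rw [iota_pre, iota_cobd, iota_cobd, map_sub, pre_lie, ih, iota_pre, iota_pre, tdeg_twistT]

/-- A 1-cochain is a function of one n-tuple, and the action of X hits all n entries uniformly. This
form suits the base case of `lie_cobd` and the proof of super-skewsymmetry. -/
theorem iota_lie_one (s : ℕ) (X Y : Fin (k + 1) → Homog 𝒢) (e : ZMod 2) (F G : Coch 𝒢 V k 1)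
    (Z : Fin 0 → Fin (k + 1) → Homog 𝒢) (z : Homog 𝒢) :
    iota Y (lie M s X 1 e F G) Z z =
      sgn (tdeg X * e) • rho M (twistPowT L s X) (iota Y F Z z) -
        bsum L X (snocTuple Y z) fun W =>
          iota (fun i => W i.castSucc) G Z (W (Fin.last _)) := by
  rw [iota_lie, bsum_snocTuple, Pi.sub_apply, Pi.sub_apply, Pi.smul_apply, Pi.smul_apply,
    lie_zero_apply, smul_sub, sgn_smul_sgn_smul, bsum_apply]
  simp only [snocTuple_castSucc, snocTuple_last, pre_apply]
  rw [show tdeg X * tdeg Y + tdeg X * (e + tdeg Y) = tdeg X * e by grind]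
  simp only [Subsingleton.elim (fun i => twistT L (Z i)) Z]
  abel

/-- The coboundary commutes with the action of fundamental objects. -/
theorem lie_cobd (s : ℕ) (X : Fin (k + 1) → Homog 𝒢) (m : ℕ) (e : ZMod 2)
    {F G H : Coch 𝒢 V k m} (hFG : Compat M F G) (hH : MultiLinC H) :
    lie M (s + 1) X (m + 1) e (cobd M s m e F G) (cobd M s m e G H) =
      cobd M (s + 1) m (e + tdeg X) (lie M s X m e F G) (lie M s (twistT L X) m e G H) := by
  induction m generalizing e with
  | zero =>
    refine ext_iota fun Y => ?_
    funext Z z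
    -- For m = 0 the insertion part of δF is handled by `rho_ins` and the bracket part by the
    -- fundamental identity.
    have h1 := rho_ins M s e (F := F Z) (G := G Z)
      (fun z => (hFG Z z).trans (by rw [pre_apply, Subsingleton.elim (fun i => _) Z]))
      X (snocTuple Y z)
    have h2 := (hH.2 Z).act_br L X (snocTuple Y z)
    rw [iota_lie_one, iota_cobd_zero, iota_cobd_zero]
    simp only [iota_cobd_zero, snocTuple_init]
    rw [bsum_sub, lie_zero_apply, ← twistPowT_succ, h2, map_sub, smul_sub, tdeg_twistT]
    refine Eq.trans ?_ (congrArg (· - _) h1)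
    abel
  | succ m ih =>
    refine ext_iota fun Y => ?_
    -- After ι_Y, the terms containing δ agree by induction and by linearity of δ. The rest is ± L_X
    -- L_Y − L_[X,Y] − L_Y L_X, which vanishes by the commutator formula.
    have h1 := lie_lie M s X Y (m + 1) e hFG hH
    have h2 := ih (e + tdeg Y) (compat_iota M hFG Y)
      ((multiLinC_succ_iff.1 hH).2 (twistT L (twistT L Y)))
    have h3 : (bsum L X Y fun W => pre L (iota W (cobd M s (m + 1) e G H))) =
        (bsum L X Y fun W => pre L (lie M s W (m + 1) e G H)) -
          bsum L X Y fun W => cobd M (s + 1) m (e + tdeg X + tdeg Y) (pre L (iota W G))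
            (pre L (iota (twistT L W) H)) := by
      rw [← bsum_sub]
      refine bsum_congr L X Y fun W hW => ?_
      rw [iota_cobd, map_sub, pre_cobd, hW, add_assoc]
    rw [iota_lie, iota_cobd, iota_cobd, lie_sub, iota_cobd, iota_lie, iota_lie, cobd_sub,
      tdeg_twistT, tdeg_twistT, cobd_sgn_smul, bsum_twistT, cobd_bsum, h3, h1, h2, smul_sub,
      sgn_smul_sgn_smul, ← two_mul, show (2 : ZMod 2) = 0 from rfl, zero_mul, sgn_zero, one_smul,
      add_right_comm e (tdeg Y)]
    abel

/-- Since L_X commutes with δ, Cartan's formula gives ι_X δδ = δδ ι_X, and induction lowers m to 0.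
The triple F, G, H is needed because the outer δ acts on the pair (δF, δG). -/
theorem cobd_cobd (s m : ℕ) (e : ZMod 2)
    {F G H : Coch 𝒢 V k m} (hFG : Compat M F G) (hH : MultiLinC H) :
    cobd M (s + 1) (m + 1) e (cobd M s m e F G) (cobd M s m e G H) = 0 := by
  induction m generalizing e with
  | zero =>
    refine ext_iota fun X => ?_
    rw [iota_cobd, lie_cobd M s X 0 e hFG hH, ← cobd_sub]
    refine ext_iota fun Y => ?_
    funext Z z
    -- For m = 0, L_X F − ι_X δF is minus the part of the insertion sum in which F meets an entry of
    -- X; `ins_insInit` says that its coboundary is zero.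
    have h1 := ins_insInit M s e (F := F Z) (G := G Z)
      (fun z => (hFG Z z).trans (by rw [pre_apply, Subsingleton.elim (fun i => _) Z]))
      X (snocTuple Y z)
    have h2 : ∀ (X : Fin (k + 1) → Homog 𝒢) (F G : Coch 𝒢 V k 0),
        (lie M s X 0 e F G - iota X (cobd M s 0 e F G)) Z =
          fun z => (-1 : K) • insInit M s e X (F Z) z := fun X F G => by
      funext z
      rw [Pi.sub_apply, Pi.sub_apply, iota_cobd_zero, ins_snocTuple, lie_zero_apply, act,
        neg_one_smul]
      abel
    have h3 := congrFun (h2 (twistT L X) G H) (br L (snocTuple Y z))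
    rw [iota_cobd_zero, h2, ins_smul, h3, h1, sub_self]
    rfl
  | succ m ih =>
    refine ext_iota fun X => ?_
    rw [iota_cobd, lie_cobd M s X (m + 1) e hFG hH, iota_cobd, iota_cobd, cobd_sub, tdeg_twistT,
      ih _ (compat_iota M hFG X) ((multiLinC_succ_iff.1 hH).2 _), sub_zero, sub_self, map_zero]

end
end Coch

/-! ### Further rules for degreewise linearity -/

namespace Homog

section

variable {K g A B : Type*} [Field K] [AddCommGroup g] [Module K g] [AddCommGroup A] [Module K A]
  [AddCommGroup B] [Module K B] {𝒢 : ZMod 2 → Submodule K g}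

theorem Lin.map_deg {φ : Homog 𝒢 → A} (h : Lin φ) (T : ZMod 2 → A →ₗ[K] B) :
    Lin fun y => T y.deg (φ y) :=
  fun r y y' y'' hr => by
    simp only [h r y y' y'' hr, hr.deg_left, hr.deg_right, map_add, map_smul]

theorem Lin.prodMk {φ : Homog 𝒢 → A} {ψ : Homog 𝒢 → B} (h : Lin φ) (h' : Lin ψ) :
    Lin fun y => (φ y, ψ y) :=
  fun r y y' y'' hr => by
    simp only [h r y y' y'' hr, h' r y y' y'' hr, Prod.smul_mk, Prod.mk_add_mk]

theorem MultiLin.map {r : ℕ} {φ : (Fin r → Homog 𝒢) → A} (h : MultiLin φ) (T : A →ₗ[K] B) :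
    MultiLin fun X => T (φ X) :=
  fun X l => (h X l).map T

theorem MultiLin.comp_twistT {k r : ℕ} (L : HomNambuLieSuperalgebra 𝒢 k)
    {φ : (Fin r → Homog 𝒢) → A} (h : MultiLin φ) : MultiLin fun X => φ (twistT L X) := by
  intro X l
  simp only [twistT_update]
  exact (h _ l).comp fun r y y' y'' hr => hr.twist L

theorem Rel.twistPow {k : ℕ} (L : HomNambuLieSuperalgebra 𝒢 k) (s : ℕ) {c : K}
    {y y' y'' : Homog 𝒢} (h : Rel c y y' y'') :
    Rel c (twistPow L s y) (Homog.twistPow L s y') (Homog.twistPow L s y'') :=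
  ⟨h.1, h.2, by simp [Homog.twistPow, h.3]⟩

end

end Homog

/-! ### Twists, linearity and degrees are preserved by the action and the coboundary -/

namespace Coch

open Homog

section

variable {K g V : Type*} [Field K] [AddCommGroup g] [Module K g] [AddCommGroup V] [Module K V]
  {𝒢 : ZMod 2 → Submodule K g} {𝒱 : ZMod 2 → Submodule K V} {k : ℕ}
  {L : HomNambuLieSuperalgebra 𝒢 k} (M : L.GradedModule 𝒱)

/-! ### Compatibility with the twists -/

/-- Composition of the values with `ν`. -/
def postNu {m : ℕ} : Coch 𝒢 V k m →ₗ[K] Coch 𝒢 V k m where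
  toFun F := fun Z z => M.ν (F Z z)
  map_add' F F' := by funext Z z; exact map_add M.ν _ _
  map_smul' c F := by funext Z z; exact map_smul M.ν c _

theorem compat_iff {m : ℕ} {F G : Coch 𝒢 V k m} : Compat M F G ↔ postNu M F = pre L G :=
  ⟨fun h => funext fun Z => funext fun z => h Z z, fun h Z z => congrFun (congrFun h Z) z⟩

theorem iota_postNu {m : ℕ} (F : Coch 𝒢 V k (m + 1)) (X : Fin (k + 1) → Homog 𝒢) :
    iota X (postNu M F) = postNu M (iota X F) := rfl

theorem postNu_pre {m : ℕ} (F : Coch 𝒢 V k m) : postNu M (pre L F) = pre L (postNu M F) := rfl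

theorem compat_lie (s : ℕ) (X : Fin (k + 1) → Homog 𝒢) (m : ℕ) (e : ZMod 2)
    {F G H : Coch 𝒢 V k m} (h : Compat M F G) (h' : Compat M G H) :
    Compat M (lie M s X m e F G) (lie M s (twistT L X) m e G H) := by
  induction m generalizing e with
  | zero =>
    intro Z z
    rw [lie_zero_apply, pre_apply, lie_zero_apply, map_sub, map_sgn_smul, nu_rho, h, h',
      ← twistPowT_succ, ← twistPowT_succ', pre_apply, pre_apply, twist_act, tdeg_twistT]
  | succ m ih =>
    refine (compat_iff M).2 (ext_iota fun Y => ?_)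
    have h1 := fun W => (compat_iff M).1 (compat_iota M h' W)
    rw [iota_postNu, iota_pre, iota_lie, iota_lie, map_sub, map_sub, map_sgn_smul, map_sgn_smul,
      (compat_iff M).1 (ih _ (compat_iota M h Y) (compat_iota M h' _)), bsum_twistT, tdeg_twistT,
      tdeg_twistT, map_bsum, map_bsum]
    simp only [postNu_pre, h1]

theorem nu_ins (s : ℕ) (e : ZMod 2) {F G : Homog 𝒢 → V} (h : ∀ z, M.ν (F z) = G (twist L z))
    (Y : Fin (k + 2) → Homog 𝒢) : M.ν (ins M s e F Y) = ins M s e G (twistT L Y) := by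
  simp only [ins, map_sum, map_sgn_smul, nu_mixed, h, ← twistPowT_succ', ← twistPowT_succ]
  rfl

theorem compat_cobd (s m : ℕ) (e : ZMod 2)
    {F G H : Coch 𝒢 V k m} (h : Compat M F G) (h' : Compat M G H) :
    Compat M (cobd M s m e F G) (cobd M s m e G H) := by
  induction m generalizing e with
  | zero =>
    refine (compat_iff M).2 (ext_iota fun X => ?_)
    funext Z z
    rw [iota_pre, pre_apply, iota_postNu, iota_cobd_zero, ← twistT_snocTuple]
    change M.ν (iota X (cobd M s 0 e F G) Z z) = _
    rw [iota_cobd_zero, map_sub, nu_ins M s e (G := G Z)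
      (fun z => (h Z z).trans (by rw [pre_apply, Subsingleton.elim (fun i => _) Z])), h',
      pre_apply, twist_br, Subsingleton.elim (fun i => _) Z]
  | succ m ih =>
    refine (compat_iff M).2 (ext_iota fun X => ?_)
    rw [iota_postNu, iota_pre, iota_cobd, iota_cobd, map_sub, map_sub,
      (compat_iff M).1 (ih _ (compat_iota M h X) (compat_iota M h' _)),
      (compat_iff M).1 (compat_lie M s X (m + 1) e h h'), tdeg_twistT]

/-! ### Linearity -/

theorem MultiLinC.sub {m : ℕ} {F G : Coch 𝒢 V k m} (h : MultiLinC F) (h' : MultiLinC G) :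
    MultiLinC (F - G) :=
  ⟨fun X z i l => (h.1 X z i l).sub (h'.1 X z i l), fun X => (h.2 X).sub (h'.2 X)⟩

theorem MultiLinC.sgn_smul {m : ℕ} {F : Coch 𝒢 V k m} (h : MultiLinC F) (a : ZMod 2) :
    MultiLinC (sgn a • F) :=
  ⟨fun X z i l => (h.1 X z i l).sgn_smul fun _ => a, fun X => (h.2 X).sgn_smul fun _ => a⟩

theorem MultiLinC.bsum {m r : ℕ} (X : Fin (k + 1) → Homog 𝒢) (Y : Fin r → Homog 𝒢)
    {φ : (Fin r → Homog 𝒢) → Coch 𝒢 V k m} (h : ∀ W, MultiLinC (φ W)) :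
    MultiLinC (bsum L X Y φ) := by
  refine ⟨fun Z z i l => ?_, fun Z => ?_⟩
  · simp only [bsum_apply]
    exact Lin.sum _ fun q => ((h _).1 Z z i l).sgn_smul fun _ => _
  · have e : Homog.bsum L X Y φ Z = fun z => Homog.bsum L X Y fun W => φ W Z z :=
      funext fun z => bsum_apply L X Y φ Z z
    rw [e]
    exact Lin.sum _ fun q => ((h _).2 Z).sgn_smul fun _ => _

theorem MultiLinC.pre {m : ℕ} {F : Coch 𝒢 V k m} (h : MultiLinC F) : MultiLinC (pre L F) := by
  refine ⟨fun X z i l => ?_, fun X => (h.2 _).comp fun r y y' y'' hr => hr.twist L⟩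
  simp only [pre_apply, comp_update (twistT L), twistT_update]
  exact (h.1 _ _ i l).comp fun r y y' y'' hr => hr.twist L

theorem lin_of_iota {m : ℕ} {φ : Homog 𝒢 → Coch 𝒢 V k (m + 1)}
    (h : ∀ Y, Lin fun y => iota Y (φ y)) : Lin φ :=
  fun r y y' y'' hr => ext_iota fun Y => by
    rw [map_add, map_smul]
    exact h Y r y y' y'' hr

theorem lin_of_apply {m : ℕ} {φ : Homog 𝒢 → Coch 𝒢 V k m}
    (h : ∀ Z z, Lin fun y => φ y Z z) : Lin φ :=
  fun r y y' y'' hr => by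
    funext Z z
    exact h Z z r y y' y'' hr

theorem multiLinC_zero_iff {F : Coch 𝒢 V k 0} : MultiLinC F ↔ ∀ Z, Lin (F Z) :=
  ⟨fun h => h.2, fun h => ⟨fun _ _ i => i.elim0, h⟩⟩

theorem multiLinC_lie (s : ℕ) (X : Fin (k + 1) → Homog 𝒢) (m : ℕ) (e : ZMod 2)
    {F G : Coch 𝒢 V k m} (h : MultiLinC F) (h' : MultiLinC G) :
    MultiLinC (lie M s X m e F G) := by
  induction m generalizing e with
  | zero =>
    refine multiLinC_zero_iff.2 fun Z => ?_
    exact (((h.2 Z).map _).sgn_smul fun _ => _).sub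
      ((h'.2 Z).comp fun r y y' y'' hr => hr.act_right L X)
  | succ m ih =>
    rw [multiLinC_succ_iff] at h h' ⊢
    refine ⟨?_, fun Y => ?_⟩
    swap
    · rw [iota_lie]
      exact ((ih _ (h.2 Y) (h'.2 (twistT L Y))).sgn_smul _).sub
        (MultiLinC.bsum X Y fun W => (h'.2 W).pre)
    intro Y l
    have hb : Lin fun y => Homog.bsum L X (Function.update Y l y) fun W => Coch.pre L (iota W G) :=
      MultiLin.bsum_right L (φ := fun W => Coch.pre L (iota W G)) (h'.1.map (Coch.pre L)) X Y l
    simp only [iota_lie]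
    refine Lin.sub ?_ hb
    simp only [tdeg_update]
    refine Lin.sgn_smul (φ := fun y => lie M s X m (e + (tdeg Y + (Y l).deg + y.deg))
      (iota (Function.update Y l y) F) (iota (twistT L (Function.update Y l y)) G)) ?_
      fun d => tdeg X * (tdeg Y + (Y l).deg + d)
    -- The pair of insertions varies linearly, while the degree parameter of the action depends on
    -- the varied entry only through its degree d.
    exact ((h.1 Y l).prodMk (h'.1.comp_twistT L Y l)).map_deg fun d =>
      lieHom M s X m (e + (tdeg Y + (Y l).deg + d))

theorem lin_rho_twistPowT (s : ℕ) (X : Fin (k + 1) → Homog 𝒢) (l : Fin (k + 1)) :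
    Lin fun y => rho M (twistPowT L s (Function.update X l y)) := by
  intro r y y' y'' hr
  simp only [rho, twistPowT_update, comp_update (fun y : Homog 𝒢 => y.val), (hr.twistPow L s).3]
  simp

theorem lin_rho_twistPowT_apply (s : ℕ) (X : Fin (k + 1) → Homog 𝒢) (l : Fin (k + 1)) (v : V) :
    Lin fun y => rho M (twistPowT L s (Function.update X l y)) v :=
  (lin_rho_twistPowT M s X l).map (LinearMap.applyₗ v)

theorem multiLin_lie (s m : ℕ) (e : ZMod 2) {F G : Coch 𝒢 V k m} (h' : MultiLinC G) :
    MultiLin fun X => lie M s X m e F G := by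
  intro X l
  induction m generalizing e with
  | zero =>
    refine lin_of_apply fun Z z => ?_
    simp only [lie_zero_apply, tdeg_update]
    refine Lin.sub ?_ ((h'.2 Z).comp fun r y y' y'' hr => hr.act_left L X l z)
    exact Lin.sgn_smul (lin_rho_twistPowT_apply M s X l (F Z z))
      fun d => (tdeg X + (X l).deg + d) * e
  | succ m ih =>
    refine lin_of_iota fun Y => ?_
    rw [multiLinC_succ_iff] at h'
    simp only [iota_lie, tdeg_update]
    refine Lin.sub ?_ ((h'.1.map (pre L)).bsum_left L Y X l)
    exact Lin.sgn_smul (ih _ (h'.2 _)) fun d => (tdeg X + (X l).deg + d) * tdeg Y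

theorem multiLin_ins (s : ℕ) (e : ZMod 2) {F : Homog 𝒢 → V} (h : Lin F) :
    MultiLin (ins M s e F) := by
  intro Y q
  refine Lin.sum _ fun l => ?_
  -- The varied entry is either the one at which F is evaluated, where linearity comes from F, or an
  -- argument of ρ.
  by_cases hq : q = l
  · subst hq
    have e1 : ∀ y, sgn (e * ∑ i ∈ Finset.Iio q, (Function.update Y q y i).deg) •
        mixed M (twistPowT L s (Function.update Y q y)) q (e + (Function.update Y q y q).deg)
          (F (Function.update Y q y q)) =
        sgn (e * ∑ i ∈ Finset.Iio q, (Y i).deg + (((k + 1 - (q : ℕ) : ℕ) : ZMod 2) +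
          (e + y.deg) * ∑ j ∈ Finset.Ioi q, (Y j).deg)) •
          rho M (fun j => twistPow L s (Y (q.succAbove j))) (F y) := fun y => by
      rw [Function.update_self, mixed_congr M (Y' := twistPowT L s Y), mixed_eq,
        sgn_smul_sgn_smul, Finset.sum_congr rfl fun i hi => by
          rw [Function.update_of_ne (Finset.mem_Iio.1 hi).ne]]
      · rfl
      · intro j hj
        simp only [twistPowT, Function.update_of_ne hj]
    simp only [e1]
    exact Lin.sgn_smul (h.map _) fun d => e * ∑ i ∈ Finset.Iio q, (Y i).deg +
      (((k + 1 - (q : ℕ) : ℕ) : ZMod 2) + (e + d) * ∑ j ∈ Finset.Ioi q, (Y j).deg)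
  · obtain ⟨j, rfl⟩ := Fin.exists_succAbove_eq hq
    have e1 : ∀ y, (fun i => twistPowT L s (Function.update Y (l.succAbove j) y)
        (l.succAbove i)) =
        twistPowT L s (Function.update (fun i => Y (l.succAbove i)) j y) := fun y => by
      funext i
      by_cases hi : i = j
      · subst hi; simp [twistPowT]
      · simp [twistPowT, hi]
    simp only [mixed_eq, sgn_smul_sgn_smul, twistPowT_deg, e1,
      Function.update_of_ne (Ne.symm hq), deg_update, Finset.sum_add_distrib,
      Finset.sum_ite_eq', Finset.mem_Iio, Finset.mem_Ioi]
    exact Lin.sgn_smul (lin_rho_twistPowT_apply M s (fun i => Y (l.succAbove i)) j (F (Y l)))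
      fun d => e * (∑ i ∈ Finset.Iio l, (Y i).deg +
        if l.succAbove j < l then (Y (l.succAbove j)).deg + d else 0) +
        (((k + 1 - (l : ℕ) : ℕ) : ZMod 2) + (e + (Y l).deg) *
          (∑ i ∈ Finset.Ioi l, (Y i).deg +
            if l < l.succAbove j then (Y (l.succAbove j)).deg + d else 0))

theorem multiLinC_cobd (s m : ℕ) (e : ZMod 2) {F G : Coch 𝒢 V k m} (h : MultiLinC F)
    (h' : MultiLinC G) : MultiLinC (cobd M s m e F G) := by
  induction m generalizing e with
  | zero =>
    have h0 : ∀ Z, MultiLin fun Y =>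
        ins M s e (F Z) Y - G Z (br L Y) := fun Z Y l =>
      (multiLin_ins M s e (h.2 Z) Y l).sub (MultiLin.br_comp L (h'.2 Z) Y l)
    refine multiLinC_succ_iff.2 ⟨fun X l => lin_of_apply fun Z z => ?_,
      fun X => multiLinC_zero_iff.2 fun Z => ?_⟩
    · have := h0 Z (snocTuple X z) l.castSucc
      simp only [snocTuple_update] at this
      exact this
    · intro r y y' y'' hr
      have := h0 Z (snocTuple X y) (Fin.last _) r y y' y'' hr
      simp only [snocTuple_update_last] at this
      exact this
  | succ m ih =>
    have hs := h
    have hs' := h'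
    rw [multiLinC_succ_iff] at h h' ⊢
    refine ⟨?_, fun Y => ?_⟩
    swap
    · rw [iota_cobd]
      exact (multiLinC_lie M s Y (m + 1) e hs hs').sub (ih _ (h.2 Y) (h'.2 _))
    intro X l
    simp only [iota_cobd, tdeg_update]
    refine Lin.sub (multiLin_lie M s (m + 1) e hs' X l) ?_
    exact ((h.1 X l).prodMk (h'.1.comp_twistT L X l)).map_deg fun d =>
      cobdHom M s m (e + (tdeg X + (X l).deg + d))

/-! ### Degrees -/

/-- `F` is homogeneous of degree `e`. -/
def HomogC (𝒱 : ZMod 2 → Submodule K V) {m : ℕ} (e : ZMod 2) (F : Coch 𝒢 V k m) : Prop :=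
  ∀ Z z, F Z z ∈ 𝒱 (e + (∑ i, tdeg (Z i)) + z.deg)

theorem homogC_succ_iff {m : ℕ} {e : ZMod 2} {F : Coch 𝒢 V k (m + 1)} :
    HomogC 𝒱 e F ↔ ∀ X, HomogC 𝒱 (e + tdeg X) (iota X F) := by
  constructor
  · intro h X Z z
    have := h (Fin.cons X Z) z
    rwa [Fin.sum_univ_succ, Fin.cons_zero, ← add_assoc] at this
  · intro h Z z
    have := h (Z 0) (Fin.tail Z) z
    rw [iota_apply, Fin.cons_self_tail, add_assoc e] at this
    rw [Fin.sum_univ_succ]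
    exact this

theorem HomogC.sub {m : ℕ} {e : ZMod 2} {F G : Coch 𝒢 V k m} (h : HomogC 𝒱 e F)
    (h' : HomogC 𝒱 e G) : HomogC 𝒱 e (F - G) :=
  fun Z z => Submodule.sub_mem _ (h Z z) (h' Z z)

theorem HomogC.sgn_smul {m : ℕ} {e : ZMod 2} {F : Coch 𝒢 V k m} (h : HomogC 𝒱 e F)
    (a : ZMod 2) : HomogC 𝒱 e (sgn a • F) :=
  fun Z z => Submodule.sgn_smul_mem _ _ (h Z z)

theorem HomogC.bsum {m r : ℕ} {e : ZMod 2} (X : Fin (k + 1) → Homog 𝒢) (Y : Fin r → Homog 𝒢)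
    {φ : (Fin r → Homog 𝒢) → Coch 𝒢 V k m}
    (h : ∀ W, tdeg W = tdeg X + tdeg Y → HomogC 𝒱 e (φ W)) : HomogC 𝒱 e (bsum L X Y φ) := by
  intro Z z
  rw [bsum_apply]
  exact Submodule.sum_mem _ fun l _ =>
    Submodule.sgn_smul_mem _ _ (h _ (tdeg_wedge L X Y l) Z z)

theorem rho_mem (X : Fin (k + 1) → Homog 𝒢) {b : ZMod 2} {v : V} (h : v ∈ 𝒱 b) :
    rho M X v ∈ 𝒱 (b + tdeg X) :=
  M.ρ_mem _ _ _ _ (fun i => (X i).mem) h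

theorem homogC_lie (s : ℕ) (X : Fin (k + 1) → Homog 𝒢) (m : ℕ) (e : ZMod 2)
    {F G : Coch 𝒢 V k m} (h : HomogC 𝒱 e F) (h' : HomogC 𝒱 e G) :
    HomogC 𝒱 (e + tdeg X) (lie M s X m e F G) := by
  induction m generalizing e with
  | zero =>
    intro Z z
    rw [lie_zero_apply]
    refine Submodule.sub_mem _ (Submodule.sgn_smul_mem _ _ ?_) ?_
    · have := rho_mem M (twistPowT L s X) (h Z z)
      rwa [tdeg_twistPowT, add_right_comm, add_right_comm e] at this
    · have := h' Z (act L X z)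
      rwa [act_deg, ← add_assoc, add_right_comm e] at this
  | succ m ih =>
    rw [homogC_succ_iff] at h h' ⊢
    intro Y
    rw [iota_lie, add_right_comm]
    refine ((ih _ (h Y) (h' (twistT L Y))).sgn_smul _).sub (HomogC.bsum X Y fun W hW Z z => ?_)
    have := h' W (fun i => twistT L (Z i)) (twist L z)
    rwa [hW, add_comm (tdeg X), ← add_assoc] at this

theorem ins_mem (s : ℕ) (e : ZMod 2) {F : Homog 𝒢 → V} (h : ∀ z, F z ∈ 𝒱 (e + z.deg))
    (Y : Fin (k + 2) → Homog 𝒢) : ins M s e F Y ∈ 𝒱 (e + tdeg Y) := by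
  refine Submodule.sum_mem _ fun l _ => Submodule.sgn_smul_mem _ _ (Submodule.sgn_smul_mem _ _ ?_)
  have := rho_mem M (fun j => twistPowT L s Y (l.succAbove j)) (h (Y l))
  rwa [add_assoc, show (Y l).deg + tdeg (fun j => twistPowT L s Y (l.succAbove j)) = tdeg Y from
    (tdeg_eq_add_succAbove (twistPowT L s Y) l).symm] at this

theorem homogC_cobd (s m : ℕ) (e : ZMod 2) {F G : Coch 𝒢 V k m} (h : HomogC 𝒱 e F)
    (h' : HomogC 𝒱 e G) : HomogC 𝒱 e (cobd M s m e F G) := by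
  induction m generalizing e with
  | zero =>
    refine homogC_succ_iff.2 fun X Z z => ?_
    have e1 : e + tdeg X + (∑ i, tdeg (Z i)) + z.deg = e + tdeg (snocTuple X z) := by
      rw [tdeg_snocTuple, Finset.univ_eq_empty, Finset.sum_empty, add_zero, add_assoc]
    rw [iota_cobd_zero, e1]
    refine Submodule.sub_mem _ (ins_mem M s e (fun z => ?_) _) ?_
    · have := h Z z
      rwa [Finset.univ_eq_empty, Finset.sum_empty, add_zero] at this
    · have := h' Z (br L (snocTuple X z))
      rwa [Finset.univ_eq_empty, Finset.sum_empty, add_zero] at this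
  | succ m ih =>
    have h1 := fun X => homogC_lie M s X (m + 1) e h h'
    rw [homogC_succ_iff] at h h' ⊢
    intro X
    rw [iota_cobd]
    exact (h1 X).sub (ih _ (h X) (h' (twistT L X)))

end
end Coch

/-! ### Super-skewsymmetry of functions of a tuple -/

namespace Homog

section

variable {K g A B : Type*} [Field K] [AddCommGroup g] [Module K g] [AddCommGroup A] [Module K A]
  [AddCommGroup B] [Module K B] {𝒢 : ZMod 2 → Submodule K g}

/-- Super-skewsymmetry of a function of a tuple of homogeneous elements. -/
def Skew {r : ℕ} (φ : (Fin (r + 1) → Homog 𝒢) → A) : Prop :=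
  ∀ (X : Fin (r + 1) → Homog 𝒢) (p : Fin r),
    φ X = -(sgn ((X p.castSucc).deg * (X p.succ).deg) • φ (swapAdj X p))

theorem Skew.sub {r : ℕ} {φ ψ : (Fin (r + 1) → Homog 𝒢) → A} (h : Skew φ) (h' : Skew ψ) :
    Skew fun X => φ X - ψ X := fun X p => by
  simp only [smul_sub, neg_sub']
  rw [← h X p, ← h' X p]

theorem Skew.sgn_smul {r : ℕ} {φ : (Fin (r + 1) → Homog 𝒢) → A} (h : Skew φ)
    (s : ZMod 2 → ZMod 2) : Skew fun X => sgn (s (tdeg X)) • φ X := fun X p => by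
  simp only [tdeg_swapAdj]
  rw [smul_comm, ← smul_neg, ← h X p]

theorem Skew.map {r : ℕ} {φ : (Fin (r + 1) → Homog 𝒢) → A} (h : Skew φ) (T : A →ₗ[K] B) :
    Skew fun X => T (φ X) := fun X p => by
  simp only
  rw [← map_sgn_smul, ← map_neg, ← h X p]

theorem Skew.sum {ι : Type*} (s : Finset ι) {r : ℕ} {φ : ι → (Fin (r + 1) → Homog 𝒢) → A}
    (h : ∀ i, Skew (φ i)) : Skew fun X => ∑ i ∈ s, φ i X := fun X p => by
  simp only [Finset.smul_sum, ← Finset.sum_neg_distrib]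
  exact Finset.sum_congr rfl fun i _ => h i X p

variable {k : ℕ} (L : HomNambuLieSuperalgebra 𝒢 k)

theorem Skew.comp_twistT {r : ℕ} {φ : (Fin (r + 1) → Homog 𝒢) → A} (h : Skew φ) :
    Skew fun X => φ (twistT L X) := fun X p => h (twistT L X) p

/-- The transposition permutes the positions hit by X, matching the summands; only the signs need
comparison. -/
theorem Skew.bsum_right {r : ℕ} {φ : (Fin (r + 1) → Homog 𝒢) → A} (h : Skew φ)
    (X : Fin (k + 1) → Homog 𝒢) : Skew fun Y => bsum L X Y φ := by
  intro Y p
  have e : bsum L X (swapAdj Y p) φ = ∑ l,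
      sgn (passDeg X (swapAdj Y p) (Equiv.swap p.castSucc p.succ l)) •
        φ (swapAdj (wedge L X Y l) p) := by
    rw [bsum, ← Equiv.sum_comp (Equiv.swap p.castSucc p.succ)]
    refine Finset.sum_congr rfl fun l _ => ?_
    rw [wedge, wedge, swapAdj_update]
    congr 3
    simp only [swapAdj, Function.comp, Equiv.swap_apply_self]
  simp only [e, Finset.smul_sum, ← Finset.sum_neg_distrib]
  refine Finset.sum_congr rfl fun l _ => ?_
  have h1 := sum_Iio_swapAdj (fun i => (Y i).deg) p l
  change ∑ q ∈ _, (swapAdj Y p q).deg = _ at h1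
  rw [h (wedge L X Y l) p, smul_neg, sgn_smul_sgn_smul, sgn_smul_sgn_smul]
  congr 1
  refine sgn_smul_congr ?_ _
  simp only [passDeg, h1, wedge_deg]
  have hp : p.castSucc ≠ p.succ := Fin.castSucc_lt_succ.ne
  simp only [eq_comm (a := l)]
  -- If X hits one of the exchanged entries, its degree there grows by |X|, changing the exchange
  -- sign by |X| times the degree of the other. The altered initial sum in the sign of X compensates
  -- for this.
  by_cases h2 : p.castSucc = l
  · have h3 : p.succ ≠ l := fun h => hp (h2.trans h.symm)
    simp only [if_pos h2, if_neg h3]; grind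
  · by_cases h3 : p.succ = l
    · simp only [if_neg h2, if_pos h3]; grind
    · simp only [if_neg h2, if_neg h3]; grind

theorem Lin.br_skew {φ : Homog 𝒢 → A} (h : Lin φ) : Skew fun Y => φ (br L Y) := by
  intro Y p
  have := h.eq_sgn_smul (br L Y) (br L (swapAdj Y p)) (1 + (Y p.castSucc).deg * (Y p.succ).deg)
    (tdeg_swapAdj Y p) ?_
  · simp only
    rw [this, sgn_add, sgn_one, mul_smul, Units.neg_smul, one_smul]
  · rw [sgn_add, sgn_one, mul_smul, Units.neg_smul, one_smul]
    exact L.bracket_swap _ _ (fun i => (Y i).mem) p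

theorem Lin.act_skew {φ : Homog 𝒢 → A} (h : Lin φ) (z : Homog 𝒢) :
    Skew fun X => φ (act L X z) := by
  intro X p
  have := h.br_skew L (snocTuple X z) p.castSucc
  simp only [swapAdj_snocTuple_castSucc, ← Fin.castSucc_succ, snocTuple_castSucc] at this
  exact this

theorem MultiLin.bsum_skew_left {r : ℕ} {φ : (Fin r → Homog 𝒢) → A} (h : MultiLin φ)
    (Y : Fin r → Homog 𝒢) : Skew fun X => bsum L X Y φ := by
  refine Skew.sum _ fun l => ?_
  have := (h (twistT L Y) l).act_skew L (Y l)
  exact this.sgn_smul fun d => d * ∑ q ∈ Finset.Iio l, (Y q).deg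

end

end Homog

/-! ### Super-skewsymmetry of the action and of the coboundary -/

namespace Coch

open Homog

section

variable {K g V : Type*} [Field K] [AddCommGroup g] [Module K g] [AddCommGroup V] [Module K V]
  {𝒢 : ZMod 2 → Submodule K g} {𝒱 : ZMod 2 → Submodule K V} {k : ℕ}
  {L : HomNambuLieSuperalgebra 𝒢 k} (M : L.GradedModule 𝒱)

theorem rho_skew (s : ℕ) : Skew fun X => rho M (twistPowT L s X) := fun X p =>
  M.ρ_swap _ _ (fun i => (twistPowT L s X i).mem) p

/-- Two adjacent positions stay adjacent when a third is deleted, so the skewsymmetry of ρ applies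
to the remaining tuple. -/
theorem exists_succAbove_adjacent (p : Fin (k + 1)) {l : Fin (k + 2)} (h₁ : l ≠ p.castSucc)
    (h₂ : l ≠ p.succ) :
    ∃ q : Fin k, l.succAbove q.castSucc = p.castSucc ∧ l.succAbove q.succ = p.succ := by
  have hl := l.isLt
  have hp := p.isLt
  have h₁' : l.val ≠ p.val := fun h => h₁ (Fin.ext h)
  have h₂' : l.val ≠ p.val + 1 := fun h => h₂ (Fin.ext h)
  by_cases h : l.val < p.val
  · refine ⟨⟨p.val - 1, by omega⟩, ?_, ?_⟩
    · rw [Fin.succAbove_of_le_castSucc _ _ (by simp only [Fin.le_def, Fin.val_castSucc]; omega)]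
      ext; simp; omega
    · rw [Fin.succAbove_of_le_castSucc _ _
        (by simp only [Fin.le_def, Fin.val_castSucc, Fin.val_succ]; omega)]
      ext; simp; omega
  · refine ⟨⟨p.val, by omega⟩, ?_, ?_⟩
    · rw [Fin.succAbove_of_castSucc_lt _ _ (by simp only [Fin.lt_def, Fin.val_castSucc]; omega)]
      ext; simp
    · rw [Fin.succAbove_of_castSucc_lt _ _
        (by simp only [Fin.lt_def, Fin.val_castSucc, Fin.val_succ]; omega)]
      ext; simp

theorem swap_succ_succAbove {r : ℕ} (p : Fin r) (j : Fin r) :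
    Equiv.swap p.castSucc p.succ (p.succ.succAbove j) = p.castSucc.succAbove j := by
  rcases lt_trichotomy j p with h | rfl | h
  · have h' : j.castSucc < p.succ := (Fin.castSucc_lt_castSucc_iff.2 h).trans Fin.castSucc_lt_succ
    rw [Fin.succAbove_of_castSucc_lt _ _ h',
      Fin.succAbove_of_castSucc_lt _ _ (Fin.castSucc_lt_castSucc_iff.2 h),
      Equiv.swap_apply_of_ne_of_ne (Fin.castSucc_lt_castSucc_iff.2 h).ne h'.ne]
  · rw [Fin.succAbove_of_castSucc_lt _ _ Fin.castSucc_lt_succ, Fin.succAbove_of_le_castSucc _ _ le_rfl,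
      Equiv.swap_apply_left]
  · have h' : p.succ ≤ j.castSucc := Fin.succ_le_castSucc_iff.2 h
    rw [Fin.succAbove_of_le_castSucc _ _ h',
      Fin.succAbove_of_le_castSucc p.castSucc _ (Fin.castSucc_le_castSucc_iff.2 h.le),
      Equiv.swap_apply_of_ne_of_ne (Fin.castSucc_lt_succ.trans (Fin.succ_lt_succ_iff.2 h)).ne'
        (Fin.succ_lt_succ_iff.2 h).ne']

/-- Summands are matched by the transposition. If F sees one of the exchanged entries, the module
argument moves by one place and the arguments of ρ are unchanged; otherwise the sign comes from the
skewsymmetry of ρ. -/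
theorem ins_skew (s : ℕ) (e : ZMod 2) (F : Homog 𝒢 → V) : Skew (ins M s e F) := by
  intro Y p
  have h0 : ins M s e F (swapAdj Y p) = ∑ l,
      sgn (e * ∑ q ∈ Finset.Iio (Equiv.swap p.castSucc p.succ l), (swapAdj Y p q).deg) •
        mixed M (twistPowT L s (swapAdj Y p)) (Equiv.swap p.castSucc p.succ l) (e + (Y l).deg)
          (F (Y l)) := by
    rw [ins, ← Equiv.sum_comp (Equiv.swap p.castSucc p.succ)]
    simp only [swapAdj, Function.comp, Equiv.swap_apply_self]
  rw [h0]
  simp only [ins, Finset.smul_sum, ← Finset.sum_neg_distrib]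
  refine Finset.sum_congr rfl fun l _ => ?_
  have h1 := sum_Iio_swapAdj (fun i => (Y i).deg) p l
  change ∑ q ∈ _, (swapAdj Y p q).deg = _ at h1
  have h2 := Finset.sum_Iio_add_Ioi l fun i => (Y i).deg
  have h3 := Finset.sum_Iio_add_Ioi (Equiv.swap p.castSucc p.succ l)
    fun i => (swapAdj Y p i).deg
  rw [show ∑ q, (swapAdj Y p q).deg = ∑ q, (Y q).deg from tdeg_swapAdj Y p, h1] at h3
  rw [show swapAdj Y p (Equiv.swap p.castSucc p.succ l) = Y l by
    simp only [swapAdj, Function.comp, Equiv.swap_apply_self]] at h3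
  have hp : p.castSucc ≠ p.succ := Fin.castSucc_lt_succ.ne
  -- Moving the module argument by one place changes the parity of its distance to the end. The
  -- natural subtraction is not truncated, as p < k + 1.
  have hn : ((k + 1 - (p.castSucc : ℕ) : ℕ) : ZMod 2) =
      ((k + 1 - (p.succ : ℕ) : ℕ) : ZMod 2) + 1 := by
    rw [← Nat.cast_succ]
    congr 1
    have := p.isLt
    simp only [Fin.val_castSucc, Fin.val_succ]
    omega
  rw [h1, mixed_eq, mixed_eq, sgn_smul_sgn_smul, sgn_smul_sgn_smul, sgn_smul_sgn_smul,
    neg_eq_sgn_smul, sgn_smul_sgn_smul]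
  simp only [twistPowT_deg]
  by_cases hl : l = p.castSucc
  · subst hl
    rw [Equiv.swap_apply_left] at h3 ⊢
    rw [show (fun j => twistPowT L s (swapAdj Y p) (p.succ.succAbove j)) =
      fun j => twistPowT L s Y (p.castSucc.succAbove j) from funext fun j =>
        congrArg (twistPowT L s Y) (swap_succ_succAbove p j)]
    refine sgn_smul_congr ?_ _
    simp only [if_true, if_neg hp] at h3 ⊢
    rw [hn]
    grind
  by_cases hl' : l = p.succ
  · subst hl'
    rw [Equiv.swap_apply_right] at h3 ⊢
    rw [show (fun j => twistPowT L s (swapAdj Y p) (p.castSucc.succAbove j)) =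
      fun j => twistPowT L s Y (p.succ.succAbove j) from funext fun j =>
        congrArg (twistPowT L s Y) (by rw [← swap_succ_succAbove p j, Equiv.swap_apply_self])]
    refine sgn_smul_congr ?_ _
    simp only [if_true, if_neg hp.symm] at h3 ⊢
    rw [hn]
    grind
  · rw [Equiv.swap_apply_of_ne_of_ne hl hl'] at h3 ⊢
    obtain ⟨q, hq, hq'⟩ := exists_succAbove_adjacent p hl hl'
    have h4 := rho_skew M s (fun j => Y (l.succAbove j)) q
    simp only [hq, hq'] at h4
    have h5 : (fun j => twistPowT L s (swapAdj Y p) (l.succAbove j)) =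
        twistPowT L s (swapAdj (fun j => Y (l.succAbove j)) q) := by
      funext j
      simp only [twistPowT, swapAdj, Function.comp]
      rw [← hq, ← hq', (Fin.succAbove_right_injective (p := l)).swap_apply]
    rw [h5, show (fun j => twistPowT L s Y (l.succAbove j)) =
      twistPowT L s fun j => Y (l.succAbove j) from rfl, h4, LinearMap.neg_apply, smul_neg,
      neg_eq_sgn_smul, sgn_smul_sgn_smul]
    rw [show ∀ (a : ZMod 2) (T : Module.End K V) (v : V), (sgn a • T) v = sgn a • T v from
      fun a T v => rfl, sgn_smul_sgn_smul]
    refine sgn_smul_congr ?_ _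
    simp only [if_neg hl, if_neg hl'] at h3 ⊢
    grind

/-- Super-skewsymmetry in the entries of each fundamental object, and in the entries of the last
fundamental object together with the last argument. -/
def SkewC {m : ℕ} (F : Coch 𝒢 V k m) : Prop :=
  ∀ (X : Fin m → Fin (k + 1) → Homog 𝒢) (z : Homog 𝒢),
    (∀ (i : Fin m) (p : Fin k),
      F X z = -(sgn ((X i p.castSucc).deg * (X i p.succ).deg) • F (swapIn X i p) z)) ∧
    ∀ i : Fin m, (i : ℕ) + 1 = m →
      F X z = -(sgn ((X i (Fin.last k)).deg * z.deg) •
        F (replaceLast X i z) (X i (Fin.last k)))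

theorem SkewC.sub {m : ℕ} {F G : Coch 𝒢 V k m} (h : SkewC F) (h' : SkewC G) :
    SkewC (F - G) := fun X z =>
  ⟨fun i p => by
    simp only [Pi.sub_apply, smul_sub, neg_sub']
    rw [← (h X z).1 i p, ← (h' X z).1 i p],
  fun i hi => by
    simp only [Pi.sub_apply, smul_sub, neg_sub']
    rw [← (h X z).2 i hi, ← (h' X z).2 i hi]⟩

theorem SkewC.sgn_smul {m : ℕ} {F : Coch 𝒢 V k m} (h : SkewC F) (a : ZMod 2) :
    SkewC (sgn a • F) := fun X z =>
  ⟨fun i p => by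
    simp only [Pi.smul_apply]
    rw [smul_comm, ← smul_neg, ← (h X z).1 i p],
  fun i hi => by
    simp only [Pi.smul_apply]
    rw [smul_comm, ← smul_neg, ← (h X z).2 i hi]⟩

theorem SkewC.sum {ι : Type*} (s : Finset ι) {m : ℕ} {F : ι → Coch 𝒢 V k m}
    (h : ∀ i, SkewC (F i)) : SkewC (∑ i ∈ s, F i) := fun X z =>
  ⟨fun i p => by
    simp only [Finset.sum_apply, Finset.smul_sum, ← Finset.sum_neg_distrib]
    exact Finset.sum_congr rfl fun j _ => (h j X z).1 i p,
  fun i hi => by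
    simp only [Finset.sum_apply, Finset.smul_sum, ← Finset.sum_neg_distrib]
    exact Finset.sum_congr rfl fun j _ => (h j X z).2 i hi⟩

theorem SkewC.pre {m : ℕ} {F : Coch 𝒢 V k m} (h : SkewC F) : SkewC (Coch.pre L F) := fun X z =>
  ⟨fun i p => by
    have := (h (fun j => twistT L (X j)) (twist L z)).1 i p
    rw [pre_apply, this, pre_apply, swapIn, swapIn, comp_update (twistT L)]
    rfl,
  fun i hi => by
    have := (h (fun j => twistT L (X j)) (twist L z)).2 i hi
    rw [pre_apply, this, pre_apply, replaceLast, replaceLast, comp_update (twistT L),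
      twistT_update]
    rfl⟩

theorem SkewC.bsum {m r : ℕ} (X : Fin (k + 1) → Homog 𝒢) (Y : Fin r → Homog 𝒢)
    {φ : (Fin r → Homog 𝒢) → Coch 𝒢 V k m} (h : ∀ W, SkewC (φ W)) :
    SkewC (Homog.bsum L X Y φ) :=
  SkewC.sum _ fun _ => (h _).sgn_smul _

theorem SkewC.skew_iota {m : ℕ} {F : Coch 𝒢 V k (m + 1)} (h : SkewC F) :
    Skew fun X => iota X F := by
  intro X p
  funext Z z
  have := (h (Fin.cons X Z) z).1 0 p
  rw [swapIn, Fin.cons_zero, Fin.update_cons_zero] at this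
  exact this

theorem skewC_zero (F : Coch 𝒢 V k 0) : SkewC F :=
  fun _ _ => ⟨fun i => i.elim0, fun i => i.elim0⟩

/-- With a single fundamental object, that object is also the last one, so the two conditions merge
into skewsymmetry of one n-tuple. -/
theorem skewC_one_iff {F : Coch 𝒢 V k 1} :
    SkewC F ↔ ∀ Z, Skew fun Y : Fin (k + 2) → Homog 𝒢 =>
      iota (fun i => Y i.castSucc) F Z (Y (Fin.last _)) := by
  constructor
  · intro h Z Y p
    rw [← snocTuple_init Y]
    generalize (fun i => Y (Fin.castSucc i)) = X, Y (Fin.last _) = z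
    simp only [snocTuple_castSucc, snocTuple_last]
    refine Fin.lastCases ?_ (fun p => ?_) p
    · have := (h (Fin.cons X Z) z).2 0 rfl
      rw [replaceLast, Fin.cons_zero, Fin.update_cons_zero] at this
      rw [swapAdj_snocTuple_last, Fin.succ_last]
      simp only [snocTuple_castSucc, snocTuple_last]
      exact this
    · have := (h (Fin.cons X Z) z).1 0 p
      rw [swapIn, Fin.cons_zero, Fin.update_cons_zero] at this
      rw [swapAdj_snocTuple_castSucc, ← Fin.castSucc_succ]
      simp only [snocTuple_castSucc, snocTuple_last]
      exact this
  · intro h X z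
    obtain ⟨x, Z, rfl⟩ : ∃ x Z, X = Fin.cons x Z := ⟨X 0, Fin.tail X, (Fin.cons_self_tail X).symm⟩
    constructor
    · intro i p
      obtain rfl : i = 0 := Subsingleton.elim _ _
      have := h Z (snocTuple x z) p.castSucc
      rw [swapAdj_snocTuple_castSucc, ← Fin.castSucc_succ] at this
      simp only [snocTuple_castSucc, snocTuple_last] at this
      rw [swapIn, Fin.cons_zero, Fin.update_cons_zero]
      exact this
    · intro i _
      obtain rfl : i = 0 := Subsingleton.elim _ _
      have := h Z (snocTuple x z) (Fin.last _)
      rw [swapAdj_snocTuple_last, Fin.succ_last] at this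
      simp only [snocTuple_castSucc, snocTuple_last] at this
      rw [replaceLast, Fin.cons_zero, Fin.update_cons_zero]
      exact this

/-- With at least two fundamental objects the first is not the last, so the condition involving z
concerns only the remaining ones. This fails for one slot, hence the shift by two. -/
theorem skewC_succ_succ_iff {m : ℕ} {F : Coch 𝒢 V k (m + 2)} :
    SkewC F ↔ (Skew fun X => iota X F) ∧ ∀ X, SkewC (iota X F) := by
  refine ⟨fun h => ⟨h.skew_iota, fun X Z z => ⟨fun i p => ?_, fun i hi => ?_⟩⟩, fun h X z => ?_⟩
  · have := (h (Fin.cons X Z) z).1 i.succ p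
    rw [swapIn, Fin.cons_succ, ← Fin.cons_update] at this
    exact this
  · have := (h (Fin.cons X Z) z).2 i.succ (by simpa using hi)
    rw [replaceLast, Fin.cons_succ, ← Fin.cons_update] at this
    exact this
  · obtain ⟨x, Z, rfl⟩ : ∃ x Z, X = Fin.cons x Z := ⟨X 0, Fin.tail X, (Fin.cons_self_tail X).symm⟩
    constructor
    · intro i p
      refine Fin.cases ?_ (fun i => ?_) i
      · have := congrFun (congrFun (h.1 x p) Z) z
        rw [swapIn, Fin.cons_zero, Fin.update_cons_zero]
        exact this
      · have := (h.2 x Z z).1 i p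
        rw [swapIn, Fin.cons_succ, ← Fin.cons_update]
        exact this
    · intro i
      refine Fin.cases (fun hi => ?_) (fun i hi => ?_) i
      · simp at hi
      · have := (h.2 x Z z).2 i (by simpa using hi)
        rw [replaceLast, Fin.cons_succ, ← Fin.cons_update]
        exact this

theorem lie_skew (s m : ℕ) (e : ZMod 2) {F G : Coch 𝒢 V k m} (h : MultiLinC G) :
    Skew fun X => lie M s X m e F G := by
  intro X p
  induction m generalizing e with
  | zero =>
    funext Z z
    have h1 := (h.2 Z).act_skew L z X p
    have h2 := congrArg (fun T : Module.End K V => T (F Z z)) (rho_skew M s X p)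
    simp only [Pi.neg_apply, Pi.smul_apply, lie_zero_apply, h1, h2, tdeg_swapAdj,
      LinearMap.neg_apply, smul_sub, smul_neg]
    rw [show ∀ (a : ZMod 2) (T : Module.End K V) (v : V), (sgn a • T) v = sgn a • T v from
      fun a T v => rfl, smul_comm]
    abel
  | succ m ih =>
    refine ext_iota fun Y => ?_
    rw [multiLinC_succ_iff] at h
    have h1 := (h.1.map (Coch.pre L)).bsum_skew_left L Y X p
    have h2 := ih (e + tdeg Y) (F := iota Y F) (h.2 (twistT L Y))
    simp only at h1 h2
    rw [map_neg, map_sgn_smul, iota_lie, iota_lie, h1, h2, tdeg_swapAdj, smul_sub, smul_neg,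
      smul_comm (sgn (tdeg X * tdeg Y))]
    abel

theorem skewC_lie (s : ℕ) (X : Fin (k + 1) → Homog 𝒢) (m : ℕ) (e : ZMod 2)
    {F G : Coch 𝒢 V k m} (h : SkewC F) (h' : SkewC G) :
    SkewC (lie M s X m e F G) := by
  -- The case m = 1 needs its own argument on n-tuples, so the recursion starts at m = 2.
  induction m using Nat.strong_induction_on generalizing e with
  | _ m ih =>
  match m, F, G with
  | 0, _, _ => exact skewC_zero _
  | 1, F, G =>
    rw [skewC_one_iff] at h h' ⊢
    intro Z
    simp only [iota_lie_one, snocTuple_init]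
    exact (((h Z).map (rho M (twistPowT L s X))).sgn_smul fun _ => tdeg X * e).sub
      ((h' Z).bsum_right L X)
  | m + 2, F, G =>
    rw [skewC_succ_succ_iff] at h h' ⊢
    refine ⟨?_, fun Y => ?_⟩
    · simp only [iota_lie]
      refine Skew.sub (fun Y p => ?_) ((h'.1.map (Coch.pre L)).bsum_right L X)
      have h1 := h.1 Y p
      have h2 := h'.1.comp_twistT L Y p
      simp only at h1 h2
      rw [h1, h2]
      simp only [neg_eq_sgn_smul, sgn_smul_sgn_smul, lie_sgn_smul, tdeg_swapAdj]
      refine sgn_smul_congr ?_ _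
      ring
    · rw [iota_lie]
      exact ((ih (m + 1) (by omega) _ (h.2 Y) (h'.2 (twistT L Y))).sgn_smul _).sub
        (SkewC.bsum X Y fun W => (h'.2 W).pre)

theorem skewC_cobd (s m : ℕ) (e : ZMod 2) {F G : Coch 𝒢 V k m} (h : SkewC F) (h' : SkewC G)
    (hG : MultiLinC G) : SkewC (cobd M s m e F G) := by
  induction m generalizing e with
  | zero =>
    refine skewC_one_iff.2 fun Z => ?_
    simp only [iota_cobd_zero, snocTuple_init]
    exact (ins_skew M s e (F Z)).sub ((hG.2 Z).br_skew L)
  | succ m ih =>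
    refine skewC_succ_succ_iff.2 ⟨?_, fun X => ?_⟩
    · simp only [iota_cobd]
      refine Skew.sub (lie_skew M s (m + 1) e hG) fun X p => ?_
      have h1 := h.skew_iota X p
      have h2 := h'.skew_iota.comp_twistT L X p
      simp only at h1 h2
      rw [h1, h2]
      simp only [neg_eq_sgn_smul, sgn_smul_sgn_smul, cobd_sgn_smul, tdeg_swapAdj]
    · rw [iota_cobd]
      refine (skewC_lie M s X (m + 1) e h h').sub (ih _ ?_ ?_ ((multiLinC_succ_iff.1 hG).2 _))
      -- Inserting into a 1-cochain leaves a 0-cochain, which carries no skewsymmetry condition.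
      · cases m with
        | zero => exact skewC_zero _
        | succ m => exact (skewC_succ_succ_iff.1 h).2 X
      · cases m with
        | zero => exact skewC_zero _
        | succ m => exact (skewC_succ_succ_iff.1 h').2 _

end
end Coch

/-! ### Unrolling the recursions into the explicit formulas -/

theorem Finset.sum_Iio_fin_succ {A : Type*} [AddCommMonoid A] {r : ℕ} (l : Fin r)
    (f : Fin (r + 1) → A) :
    ∑ q ∈ Finset.Iio l.succ, f q = f 0 + ∑ q ∈ Finset.Iio l, f q.succ := by
  rw [Finset.sum_Iio_eq, Fin.sum_univ_succ, Finset.sum_Iio_eq]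
  simp [Fin.succ_lt_succ_iff]

theorem Finset.sum_Iio_fin_zero {A : Type*} [AddCommMonoid A] {r : ℕ} (f : Fin (r + 1) → A) :
    ∑ q ∈ Finset.Iio 0, f q = 0 := by
  rw [Finset.sum_Iio_eq]
  exact Finset.sum_eq_zero fun q _ => if_neg (Fin.zero_le q).not_gt

theorem Finset.sum_Ioo_fin_zero_succ {A : Type*} [AddCommMonoid A] {r : ℕ} (l : Fin r)
    (f : Fin (r + 1) → A) :
    ∑ q ∈ Finset.Ioo 0 l.succ, f q = ∑ q ∈ Finset.Iio l, f q.succ := by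
  rw [Finset.sum_Ioo_eq, Fin.sum_univ_succ, Finset.sum_Iio_eq]
  simp [Fin.succ_lt_succ_iff]

theorem Finset.sum_Ioo_fin_succ_succ {A : Type*} [AddCommMonoid A] {r : ℕ} (i l : Fin r)
    (f : Fin (r + 1) → A) :
    ∑ q ∈ Finset.Ioo i.succ l.succ, f q = ∑ q ∈ Finset.Ioo i l, f q.succ := by
  rw [Finset.sum_Ioo_eq, Fin.sum_univ_succ, Finset.sum_Ioo_eq]
  simp [Fin.succ_lt_succ_iff]

theorem cons_succ_succAbove {W : Type*} {m : ℕ} (x : W) (Z : Fin (m + 1) → W) (i : Fin (m + 1)) :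
    (fun b => (Fin.cons (α := fun _ => W) x Z) (i.succ.succAbove b)) =
      Fin.cons (α := fun _ => W) x fun b => Z (i.succAbove b) := by
  funext b
  refine Fin.cases ?_ (fun b => ?_) b
  · simp
  · simp [Fin.succ_succAbove_succ]

namespace Coch

open Homog

section

variable {K g V : Type*} [Field K] [AddCommGroup g] [Module K g] [AddCommGroup V] [Module K V]
  {𝒢 : ZMod 2 → Submodule K g} {𝒱 : ZMod 2 → Submodule K V} {k : ℕ}
  {L : HomNambuLieSuperalgebra 𝒢 k} (M : L.GradedModule 𝒱)

theorem lie_apply (s : ℕ) (X : Fin (k + 1) → Homog 𝒢) (m : ℕ) (e : ZMod 2)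
    (F G : Coch 𝒢 V k m) (Z : Fin m → Fin (k + 1) → Homog 𝒢) (z : Homog 𝒢) :
    lie M s X m e F G Z z =
      sgn (tdeg X * e) • rho M (twistPowT L s X) (F Z z) -
      (∑ j, sgn (tdeg X * ∑ b ∈ Finset.Iio j, tdeg (Z b)) • bsum L X (Z j) fun W =>
        G (Function.update (fun b => twistT L (Z b)) j W) (twist L z)) -
      sgn (tdeg X * ∑ b, tdeg (Z b)) • G (fun b => twistT L (Z b)) (act L X z) := by
  induction m generalizing e with
  | zero => simp [lie_zero_apply, Subsingleton.elim (fun b => twistT L (Z b)) Z]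
  | succ m ih =>
    obtain ⟨Y, Z, rfl⟩ : ∃ x Z', Z = Fin.cons x Z' :=
      ⟨Z 0, Fin.tail Z, (Fin.cons_self_tail Z).symm⟩
    change iota Y (lie M s X (m + 1) e F G) Z z = _
    rw [iota_lie, Pi.sub_apply, Pi.sub_apply, Pi.smul_apply, Pi.smul_apply, ih,
      bsum_apply, Fin.sum_univ_succ, Fin.sum_univ_succ, Finset.sum_Iio_fin_zero]
    simp only [Fin.cons_zero, Fin.cons_succ, Finset.sum_Iio_fin_succ, comp_cons (twistT L),
      Fin.update_cons_zero, ← Fin.cons_update, iota_apply, pre_apply, smul_sub, Finset.smul_sum,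
      sgn_smul_sgn_smul, mul_zero, sgn_zero, one_smul, mul_add]
    rw [show tdeg X * tdeg Y + (tdeg X * e + tdeg X * tdeg Y) = tdeg X * e by grind]
    abel

/-- The defining formula of the coboundary, with exponent `s` of the twist and the bracket terms
formed with `G` in place of `F`. -/
def cobdFormula {m : ℕ} (s : ℕ) (e : ZMod 2) (F G : Coch 𝒢 V k m)
    (X : Fin (m + 1) → Fin (k + 1) → Homog 𝒢) (z : Homog 𝒢) : V :=
  (∑ i : Fin (m + 1), ∑ j ∈ Finset.Ioi i,
    sgn (((i : ℕ) + 1 : ZMod 2) + tdeg (X i) * ∑ b ∈ Finset.Ioo i j, tdeg (X b)) •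
      bsum L (X i) (X j) fun W =>
        G (fun b => Function.update (fun b' => twistT L (X b')) j W (i.succAbove b))
          (twist L z)) +
  (∑ i : Fin (m + 1),
    sgn (((i : ℕ) + 1 : ZMod 2) + tdeg (X i) * ∑ b ∈ Finset.Ioi i, tdeg (X b)) •
      G (fun b => twistT L (X (i.succAbove b))) (act L (X i) z)) +
  (∑ i : Fin (m + 1),
    sgn (((i : ℕ) + 2 : ZMod 2) + tdeg (X i) * (e + ∑ b ∈ Finset.Iio i, tdeg (X b))) •
      rho M (twistPowT L s (X i)) (F (fun b => X (i.succAbove b)) z)) +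
  sgn (m : ZMod 2) • insInit M s (e + ∑ b : Fin m, tdeg (X b.castSucc)) (X (Fin.last m))
    (F fun b => X b.castSucc) z

/-- Cartan's formula sorts the explicit sum by its first argument: the terms with i first form the
action of that argument, and the others form −δ of the insertion. -/
theorem cobd_apply (s m : ℕ) (e : ZMod 2) (F G : Coch 𝒢 V k m)
    (X : Fin (m + 1) → Fin (k + 1) → Homog 𝒢) (z : Homog 𝒢) :
    cobd M s m e F G X z = cobdFormula M s e F G X z := by
  induction m generalizing e with
  | zero =>
    obtain ⟨Y, Z, rfl⟩ : ∃ x Z', X = Fin.cons x Z' :=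
      ⟨X 0, Fin.tail X, (Fin.cons_self_tail X).symm⟩
    change iota Y (cobd M s 0 e F G) Z z = _
    rw [iota_cobd_zero, ins_snocTuple, cobdFormula]
    simp [Subsingleton.elim _ Z, show (2 : ZMod 2) = 0 from rfl, Finset.sum_Iio_fin_zero,
      sgn_add, act]
    abel
  | succ m ih =>
    obtain ⟨Y, Z, rfl⟩ : ∃ x Z', X = Fin.cons x Z' :=
      ⟨X 0, Fin.tail X, (Fin.cons_self_tail X).symm⟩
    change iota Y (cobd M s (m + 1) e F G) Z z = _
    rw [iota_cobd, Pi.sub_apply, Pi.sub_apply, ih, lie_apply, cobdFormula,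
      cobdFormula]
    have h2 : ∀ i : Fin (m + 1), (((i.succ : ℕ)) : ZMod 2) = (i : ℕ) + 1 := fun i => by simp
    simp only [Fin.sum_univ_succ (n := m + 1), Fin.sum_Ioi_zero, Fin.sum_Ioi_succ,
      Finset.sum_Ioo_fin_zero_succ, Finset.sum_Ioo_fin_succ_succ, Finset.sum_Iio_fin_zero,
      Finset.sum_Iio_fin_succ, Fin.cons_zero, Fin.cons_succ, Fin.succAbove_zero,
      comp_cons (twistT L), ← Fin.cons_update, cons_succ_succAbove, h2]
    have h3 : ∀ i : Fin (m + 1), (fun b => twistT L ((Fin.cons Y Z :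
        Fin (m + 2) → Fin (k + 1) → Homog 𝒢) (i.succ.succAbove b))) =
        Fin.cons (twistT L Y) fun b => twistT L (Z (i.succAbove b)) := fun i => by
      rw [← comp_cons (twistT L), ← cons_succ_succAbove]
    have h4 : (fun b : Fin (m + 1) => (Fin.cons Y Z :
        Fin (m + 2) → Fin (k + 1) → Homog 𝒢) b.castSucc) =
        Fin.cons Y fun b : Fin m => Z b.castSucc := by
      funext b
      refine Fin.cases ?_ (fun b => ?_) b
      · simp
      · simp
    have h5 : (Fin.cons Y Z : Fin (m + 2) → Fin (k + 1) → Homog 𝒢) (Fin.last (m + 1)) =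
        Z (Fin.last m) := by rw [← Fin.succ_last, Fin.cons_succ]
    have h6 : ∑ b : Fin (m + 1), tdeg ((Fin.cons Y Z :
        Fin (m + 2) → Fin (k + 1) → Homog 𝒢) b.castSucc) =
        tdeg Y + ∑ b : Fin m, tdeg (Z b.castSucc) := by
      have := congrArg (fun W => ∑ b, tdeg (W b)) h4
      simp only [Fin.sum_univ_succ (n := m), Fin.cons_zero, Fin.cons_succ] at this ⊢
      exact this
    -- Prepending an argument raises every later index by one; the resulting sign is the minus in −δ
    -- ι_Y.
    have h7 : ∀ a b : ZMod 2, sgn (a + 1 + 1 + b) = -sgn (a + 1 + b) := fun a b => by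
      rw [add_assoc (a + 1), add_comm 1, ← add_assoc, sgn_add _ 1, sgn_one, mul_neg_one]
    have h8 : ∀ a b : ZMod 2, sgn (a + 1 + 2 + b) = -sgn (a + 2 + b) := fun a b => by
      rw [show a + 1 + 2 + b = a + 2 + b + 1 by ring, sgn_add _ 1, sgn_one, mul_neg_one]
    have h9 : iota Y F (fun b : Fin m => Z b.castSucc) =
        F (Fin.cons Y fun b : Fin m => Z b.castSucc) := rfl
    rw [h6, h5, h4, h9]
    simp only [h3, h7, h8, Units.neg_smul, Finset.sum_neg_distrib, Nat.cast_succ,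
      sgn_add (m : ZMod 2), mul_neg_one, sgn_one]
    simp only [iota_apply, Fin.val_zero, Nat.cast_zero, zero_add, add_zero, ← add_assoc,
      sgn_add 1, sgn_one, neg_one_mul, Units.neg_smul, Finset.sum_neg_distrib,
      show (2 : ZMod 2) = 0 from rfl]
    abel

end
end Coch

/-! ### Passing between homogeneous and arbitrary arguments -/

namespace Coch

open Homog

section

variable {K g V : Type*} [Field K] [AddCommGroup g] [Module K g] [AddCommGroup V] [Module K V]
  {𝒢 : ZMod 2 → Submodule K g} {𝒱 : ZMod 2 → Submodule K V} {k : ℕ}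

/-- Restriction of a cochain to homogeneous arguments. -/
def res (𝒢 : ZMod 2 → Submodule K g) {m : ℕ} (f : RawCochain g V k m) : Coch 𝒢 V k m :=
  fun X z => f (fun i l => (X i l).val) z.val

theorem res_apply {m : ℕ} (f : RawCochain g V k m) (X : Fin m → Fin (k + 1) → Homog 𝒢)
    (z : Homog 𝒢) : res 𝒢 f X z = f (fun i l => (X i l).val) z.val := rfl

theorem comp_update_update {W W' : Type*} (φ : W → W') {m : ℕ} (X : Fin m → Fin (k + 1) → W)
    (i : Fin m) (l : Fin (k + 1)) (y : W) :
    (fun j q => φ (Function.update X i (Function.update (X i) l y) j q)) =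
      Function.update (fun j q => φ (X j q)) i
        (Function.update (fun q => φ (X i q)) l (φ y)) := by
  rw [← comp_update φ]
  exact comp_update (fun (Y : Fin (k + 1) → W) q => φ (Y q)) X i _

/-- Homogeneous arguments are bundled arguments. -/
theorem forall_homogArgs {m : ℕ}
    {P : (Fin m → Fin (k + 1) → ZMod 2) → ZMod 2 → (Fin m → Fin (k + 1) → g) → g → Prop} :
    (∀ D c X z, HomogArgs 𝒢 D c X z → P D c X z) ↔
      ∀ (X : Fin m → Fin (k + 1) → Homog 𝒢) (z : Homog 𝒢),
        P (fun i l => (X i l).deg) z.deg (fun i l => (X i l).val) z.val :=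
  ⟨fun h X z => h _ _ _ _ ⟨fun i l => (X i l).mem, z.mem⟩,
    fun h D c X z hX => h (fun i l => ⟨D i l, X i l, hX.1 i l⟩) ⟨c, z, hX.2⟩⟩

theorem isSuperSkew_iff {m : ℕ} {f : RawCochain g V k m} :
    IsSuperSkew 𝒢 f ↔ SkewC (res 𝒢 f) := by
  rw [IsSuperSkew, forall_homogArgs]
  refine forall_congr' fun X => forall_congr' fun z => and_congr
    (forall_congr' fun i => forall_congr' fun p => ?_)
    (forall_congr' fun i => imp_congr_right fun hi => ?_)
  · simp only [res_apply, swapIn]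
    rw [comp_update (fun (Y : Fin (k + 1) → Homog 𝒢) q => (Y q).val)]
    rfl
  · simp only [res_apply, replaceLast]
    rw [comp_update_update (fun y : Homog 𝒢 => y.val)]

theorem isHomogCochain_iff {m : ℕ} {e : ZMod 2} {f : RawCochain g V k m} :
    IsHomogCochain 𝒢 𝒱 e f ↔ HomogC 𝒱 e (res 𝒢 f) := by
  rw [IsHomogCochain, forall_homogArgs]
  rfl

theorem multiLinC_res {m : ℕ} {f : RawCochain g V k m} (h : IsMultilinearCochain K f) :
    MultiLinC (res 𝒢 f) := by
  refine ⟨fun X z i l r y y' y'' hr => ?_, fun X r y y' y'' hr => ?_⟩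
  · simp only [res_apply, comp_update_update (fun y : Homog 𝒢 => y.val), hr.val_eq]
    have := h.1 (fun i l => (X i l).val) z.val i l
    exact (this.map_add _ _).trans (congrArg (· + _) (this.map_smul _ _))
  · simp only [res_apply, hr.val_eq]
    exact ((h.2 _).map_add _ _).trans (congrArg (· + _) ((h.2 _).map_smul _ _))

section

variable [DirectSum.Decomposition 𝒢] [DirectSum.Decomposition 𝒱]

theorem gradedProj_mem (a : ZMod 2) (x : V) : gradedProj 𝒱 a x ∈ 𝒱 a := Subtype.property _

theorem gradedProj_add (a : ZMod 2) (x y : V) :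
    gradedProj 𝒱 a (x + y) = gradedProj 𝒱 a x + gradedProj 𝒱 a y := by
  simp [gradedProj, DirectSum.decompose_add]

theorem gradedProj_smul (a : ZMod 2) (c : K) (x : V) :
    gradedProj 𝒱 a (c • x) = c • gradedProj 𝒱 a x := by
  simp only [gradedProj, DirectSum.decompose_smul]
  rfl

theorem gradedProj_of_mem {a : ZMod 2} {x : V} (h : x ∈ 𝒱 a) : gradedProj 𝒱 a x = x :=
  DirectSum.decompose_of_mem_same 𝒱 h

theorem gradedProj_of_mem_ne {a b : ZMod 2} {x : V} (h : x ∈ 𝒱 b) (hab : b ≠ a) :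
    gradedProj 𝒱 a x = 0 :=
  DirectSum.decompose_of_mem_ne 𝒱 h hab

theorem sum_gradedProj (x : V) : ∑ a, gradedProj 𝒱 a x = x := by
  classical
  have := DirectSum.sum_support_decompose 𝒱 x
  rw [← Finset.sum_subset (Finset.subset_univ (DirectSum.decompose 𝒱 x).support)]
  · exact this
  · intro a _ ha
    simpa [gradedProj] using ha

/-- `gradedProj` as a linear map. -/
def gradedProjHom (𝒱 : ZMod 2 → Submodule K V) [DirectSum.Decomposition 𝒱] (a : ZMod 2) :
    V →ₗ[K] V where
  toFun := gradedProj 𝒱 a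
  map_add' := gradedProj_add a
  map_smul' := gradedProj_smul a

/-- The component of degree `a`, as a homogeneous element. -/
def projH (𝒢 : ZMod 2 → Submodule K g) [DirectSum.Decomposition 𝒢] (a : ZMod 2) (x : g) :
    Homog 𝒢 :=
  ⟨a, gradedProj 𝒢 a x, gradedProj_mem a x⟩

theorem rel_projH (a : ZMod 2) (c : K) (x y : g) :
    Rel c (projH 𝒢 a x) (projH 𝒢 a y) (projH 𝒢 a (c • x + y)) :=
  ⟨rfl, rfl, by simp only [projH, gradedProj_add, gradedProj_smul]⟩

theorem projH_val_deg (x : Homog 𝒢) : projH 𝒢 x.deg x.val = x :=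
  Homog.ext rfl (gradedProj_of_mem x.mem)

theorem projH_val_of_ne (x : Homog 𝒢) {a : ZMod 2} (h : a ≠ x.deg) :
    (projH 𝒢 a x.val).val = 0 := gradedProj_of_mem_ne x.mem h.symm

/-- The additive extension of a function of homogeneous arguments. -/
def extend {m : ℕ} (F : Coch 𝒢 V k m) : RawCochain g V k m := fun X z =>
  ∑ D : Fin m → Fin (k + 1) → ZMod 2, ∑ c : ZMod 2,
    F (fun i l => projH 𝒢 (D i l) (X i l)) (projH 𝒢 c z)

theorem isLinearMap_of_smul_add {W W' : Type*} [AddCommGroup W] [Module K W] [AddCommGroup W']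
    [Module K W'] {φ : W → W'} (h : ∀ (c : K) x y, φ (c • x + y) = c • φ x + φ y) :
    IsLinearMap K φ := by
  have h0 : φ 0 = 0 := by simpa using h 1 0 0
  exact ⟨fun x y => by simpa using h 1 x y, fun c x => by simpa [h0] using h c x 0⟩

theorem isMultilinearCochain_extend {m : ℕ} {F : Coch 𝒢 V k m} (h : MultiLinC F) :
    IsMultilinearCochain K (extend F) := by
  refine ⟨fun X z i l => isLinearMap_of_smul_add fun r x y => ?_,
    fun X => isLinearMap_of_smul_add fun r x y => ?_⟩
  · have e : ∀ (D : Fin m → Fin (k + 1) → ZMod 2) (x : g),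
        (fun j q => projH 𝒢 (D j q)
          (Function.update X i (Function.update (X i) l x) j q)) =
        Function.update (fun j q => projH 𝒢 (D j q) (X j q)) i
          (Function.update (fun q => projH 𝒢 (D i q) (X i q)) l (projH 𝒢 (D i l) x)) := by
      intro D x
      funext j q
      by_cases hj : j = i
      · subst hj
        by_cases hq : q = l
        · subst hq; simp
        · simp [hq]
      · simp [hj]
    simp only [extend, e, Finset.smul_sum, ← Finset.sum_add_distrib]
    exact Finset.sum_congr rfl fun D _ => Finset.sum_congr rfl fun c _ =>
      h.1 (fun j q => projH 𝒢 (D j q) (X j q)) _ i l r _ _ _ (rel_projH _ r x y)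
  · simp only [extend, Finset.smul_sum, ← Finset.sum_add_distrib]
    exact Finset.sum_congr rfl fun D _ => Finset.sum_congr rfl fun c _ =>
      h.2 _ r _ _ _ (rel_projH _ r x y)

/-- On homogeneous arguments a single summand survives: in every other one some projected entry is
zero, and F vanishes there by linearity. -/
theorem res_extend {m : ℕ} {F : Coch 𝒢 V k m} (h : MultiLinC F) : res 𝒢 (extend F) = F := by
  funext X z
  rw [res_apply, extend, Finset.sum_eq_single fun i l => (X i l).deg, Finset.sum_eq_single z.deg]
  · simp only [projH_val_deg]
  · intro c _ hc
    exact (h.2 _).eq_zero (projH_val_of_ne z hc)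
  · simp
  · intro D _ hD
    obtain ⟨i, hi⟩ := Function.ne_iff.1 hD
    obtain ⟨l, hl⟩ := Function.ne_iff.1 hi
    refine Finset.sum_eq_zero fun c _ => ?_
    have := (h.1 (fun i l => projH 𝒢 (D i l) (X i l).val) (projH 𝒢 c z.val) i l).eq_zero
      (projH_val_of_ne (X i l) hl)
    simpa only [Function.update_eq_self] using this
  · simp

/-- A multilinear cochain with the last argument fixed, as a multilinear map. -/
def uncurryCochain {m : ℕ} {f : RawCochain g V k m} (h : IsMultilinearCochain K f) (z : g) :
    MultilinearMap K (fun _ : Fin m × Fin (k + 1) => g) V :=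
  have key : ∀ (v : Fin m × Fin (k + 1) → g) (p : Fin m × Fin (k + 1)) (y : g),
      (fun i l => Function.update v p y (i, l)) =
        Function.update (fun i l => v (i, l)) p.1
          (Function.update (fun l => v (p.1, l)) p.2 y) := by
    rintro v ⟨i, l⟩ y
    funext j q
    by_cases hj : j = i
    · subst hj
      by_cases hq : q = l
      · subst hq; simp
      · simp [hq]
    · simp [hj]
  MultilinearMap.mk' (fun v => f (fun i l => v (i, l)) z)
    (fun v p x y => by
      simp only [key]; exact (h.1 (fun i l => v (i, l)) z p.1 p.2).map_add x y)
    (fun v p c x => by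
      simp only [key]; exact (h.1 (fun i l => v (i, l)) z p.1 p.2).map_smul c x)

theorem extend_res {m : ℕ} {f : RawCochain g V k m} (h : IsMultilinearCochain K f) :
    extend (res 𝒢 f) = f := by
  funext X z
  have h1 : ∀ D : Fin m → Fin (k + 1) → ZMod 2,
      ∑ c, res 𝒢 f (fun i l => projH 𝒢 (D i l) (X i l)) (projH 𝒢 c z) =
        f (fun i l => gradedProj 𝒢 (D i l) (X i l)) z := fun D => by
    conv_rhs => rw [← sum_gradedProj (𝒱 := 𝒢) z]
    exact (map_sum ((h.2 fun i l => gradedProj 𝒢 (D i l) (X i l)).mk' _) _ _).symm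
  have h2 := (uncurryCochain h z).map_sum fun (p : Fin m × Fin (k + 1)) (a : ZMod 2) =>
    gradedProj 𝒢 a (X p.1 p.2)
  simp only [sum_gradedProj] at h2
  simp only [extend, h1]
  -- `MultilinearMap.map_sum` indexes the expansion by degree functions on pairs (i, l); currying
  -- turns these into the families D.
  rw [← Equiv.sum_comp (Equiv.curry (Fin m) (Fin (k + 1)) (ZMod 2))]
  exact h2.symm

theorem ext_res {m : ℕ} {f f' : RawCochain g V k m} (h : IsMultilinearCochain K f)
    (h' : IsMultilinearCochain K f') (hr : res 𝒢 f = res 𝒢 f') : f = f' := by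
  rw [← extend_res (𝒢 := 𝒢) h, hr, extend_res h']

variable {L : HomNambuLieSuperalgebra 𝒢 k} (M : L.GradedModule 𝒱)

/-- Both ν ∘ f and f ∘ α are multilinear, so their equality may be tested on homogeneous arguments.
-/
theorem mem_cochains_iff {m : ℕ} {f : RawCochain g V k m} :
    f ∈ cochains M m ↔
      IsMultilinearCochain K f ∧ SkewC (res 𝒢 f) ∧ Compat M (res 𝒢 f) (res 𝒢 f) := by
  rw [← isSuperSkew_iff]
  refine and_congr_right fun h => and_congr_right fun _ => ⟨fun h' X z => h' _ _, fun h' X z => ?_⟩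
  have h1 : IsMultilinearCochain K fun X z => M.ν (f X z) :=
    ⟨fun X z i l => (M.ν ∘ₗ (h.1 X z i l).mk' _).isLinear,
      fun X => (M.ν ∘ₗ (h.2 X).mk' _).isLinear⟩
  have h2 : IsMultilinearCochain K fun X z => f (fun i => L.alphaT (X i)) (L.α z) := by
    refine ⟨fun X z i l => ?_, fun X => ((h.2 _).mk' _ ∘ₗ L.α).isLinear⟩
    have e : ∀ y, (fun j => L.alphaT (Function.update X i (Function.update (X i) l y) j)) =
        Function.update (fun j => L.alphaT (X j)) i
          (Function.update (L.alphaT (X i)) l (L.α y)) :=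
      fun y => comp_update_update L.α X i l y
    simp only [e]
    exact ((h.1 _ (L.α z) i l).mk' _ ∘ₗ L.α).isLinear
  exact congrFun (congrFun (ext_res (𝒢 := 𝒢) h1 h2
    (funext fun X => funext fun z => h' X z)) X) z

theorem extend_mem_cochains {m : ℕ} {F : Coch 𝒢 V k m} (h : MultiLinC F) (h' : SkewC F)
    (h'' : Compat M F F) : extend F ∈ cochains M m := by
  rw [mem_cochains_iff, res_extend h]
  exact ⟨isMultilinearCochain_extend h, h', h''⟩

/-- The coboundary δ^m is the case s = m and G = F of the two-cochain operator. -/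
theorem coboundaryFormula_eq {m : ℕ} (e : ZMod 2) (f : RawCochain g V k m)
    (X : Fin (m + 1) → Fin (k + 1) → Homog 𝒢) (z : Homog 𝒢) :
    coboundaryFormula M e (fun i l => (X i l).deg) z.deg f (fun i l => (X i l).val) z.val =
      cobd M m m e (res 𝒢 f) (res 𝒢 f) X z := by
  rw [cobd_apply, coboundaryFormula, cobdFormula]
  congr 1
  · congr 2
    · refine Finset.sum_congr rfl fun i _ => Finset.sum_congr rfl fun j _ =>
        congrArg _ (Finset.sum_congr rfl fun l _ => congrArg _ ?_)
      simp only [res_apply]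
      congr 1
      funext b
      have e1 := comp_update (fun (Y : Fin (k + 1) → Homog 𝒢) q => (Y q).val)
        (fun b' => twistT L (X b')) j (wedge L (X i) (X j) l)
      refine Eq.trans ?_ (congrFun e1 (i.succAbove b)).symm
      congr 2
      rw [wedge, comp_update (fun y : Homog 𝒢 => y.val), act_val]
      rfl
    · refine Finset.sum_congr rfl fun i _ => congrArg _ ?_
      rw [res_apply, act_val]
      rfl
  · refine congrArg _ (Finset.sum_congr rfl fun l _ => congrArg _ ?_)
    rw [mixed, comp_snocTuple (fun y : Homog 𝒢 => y.val), comp_snocTuple (fun y : Homog 𝒢 => y.deg)]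
    rfl

end

end

end Coch

namespace Homog

variable {K g : Type*} [Field K] [AddCommGroup g] [Module K g] {𝒢 : ZMod 2 → Submodule K g}

theorem sum_tdeg_update {m r : ℕ} (X : Fin m → Fin r → Homog 𝒢) (i : Fin m)
    (Y : Fin r → Homog 𝒢) :
    ∑ j, tdeg (Function.update X i Y j) = (∑ j, tdeg (X j)) + tdeg (X i) + tdeg Y := by
  have h1 := Finset.sum_update_of_mem (Finset.mem_univ i) (fun j => tdeg (X j)) (tdeg Y)
  have h2 := Finset.add_sum_erase Finset.univ (fun j => tdeg (X j)) (Finset.mem_univ i)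
  rw [Finset.sdiff_singleton_eq_erase] at h1
  rw [← comp_update tdeg X i Y] at h1
  rw [h1, ← h2]
  grind

end Homog

/-! ### Homogeneous components and the grading of cohomology -/

namespace Coch

open Homog

section

variable {K g V : Type*} [Field K] [AddCommGroup g] [Module K g] [AddCommGroup V] [Module K V]
  {𝒢 : ZMod 2 → Submodule K g} {𝒱 : ZMod 2 → Submodule K V} {k : ℕ}
  [DirectSum.Decomposition 𝒱]

/-- The component of degree `e` of a function of homogeneous arguments. -/
def compC (𝒱 : ZMod 2 → Submodule K V) [DirectSum.Decomposition 𝒱] {m : ℕ} (e : ZMod 2) :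
    Coch 𝒢 V k m →ₗ[K] Coch 𝒢 V k m where
  toFun F X z := gradedProj 𝒱 (e + (∑ i, tdeg (X i)) + z.deg) (F X z)
  map_add' F G := by
    funext X z
    exact gradedProj_add _ _ _
  map_smul' c F := by
    funext X z
    exact gradedProj_smul _ _ _

theorem compC_apply {m : ℕ} (e : ZMod 2) (F : Coch 𝒢 V k m) (X : Fin m → Fin (k + 1) → Homog 𝒢)
    (z : Homog 𝒢) :
    compC 𝒱 e F X z = gradedProjHom 𝒱 (e + (∑ i, tdeg (X i)) + z.deg) (F X z) := rfl

theorem homogC_compC {m : ℕ} (e : ZMod 2) (F : Coch 𝒢 V k m) : HomogC 𝒱 e (compC 𝒱 e F) :=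
  fun _ _ => gradedProj_mem _ _

theorem compC_of_homogC {m : ℕ} {e : ZMod 2} {F : Coch 𝒢 V k m} (h : HomogC 𝒱 e F) :
    compC 𝒱 e F = F := by
  funext X z
  exact gradedProj_of_mem (h X z)

theorem compC_of_homogC_ne {m : ℕ} {e e' : ZMod 2} {F : Coch 𝒢 V k m} (h : HomogC 𝒱 e' F)
    (hne : e ≠ e') : compC 𝒱 e F = 0 := by
  funext X z
  refine gradedProj_of_mem_ne (h X z) fun h' => hne ?_
  rw [add_assoc, add_assoc] at h'
  exact (add_right_cancel h').symm

theorem sum_compC {m : ℕ} (F : Coch 𝒢 V k m) : ∑ e, compC 𝒱 e F = F := by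
  funext X z
  simp only [Finset.sum_apply, compC_apply, add_assoc]
  -- Translation by the total degree of the arguments permutes `ZMod 2`, so all components of the
  -- value are summed once.
  exact (Equiv.sum_comp (Equiv.addRight ((∑ i, tdeg (X i)) + z.deg))
    fun a => gradedProj 𝒱 a (F X z)).trans (sum_gradedProj _)

theorem MultiLinC.compC {m : ℕ} {F : Coch 𝒢 V k m} (h : MultiLinC F) (e : ZMod 2) :
    MultiLinC (compC 𝒱 e F) := by
  refine ⟨fun X z i l => ?_, fun X => ?_⟩
  · have := (h.1 X z i l).map_deg fun d => gradedProjHom 𝒱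
      (e + ((∑ j, tdeg (X j)) + tdeg (X i) + (tdeg (X i) + (X i l).deg + d)) + z.deg)
    simpa only [compC_apply, sum_tdeg_update, tdeg_update] using this
  · exact (h.2 X).map_deg fun d => gradedProjHom 𝒱 (e + (∑ j, tdeg (X j)) + d)

theorem SkewC.compC {m : ℕ} {F : Coch 𝒢 V k m} (h : SkewC F) (e : ZMod 2) :
    SkewC (compC 𝒱 e F) := by
  refine fun X z => ⟨fun i p => ?_, fun i hi => ?_⟩
  · simp only [compC_apply, swapIn, sum_tdeg_update, tdeg_swapAdj]
    rw [(h X z).1 i p, map_neg, map_sgn_smul, swapIn]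
    congr 5
    grind
  · simp only [compC_apply, replaceLast, sum_tdeg_update, tdeg_update]
    rw [(h X z).2 i hi, map_neg, map_sgn_smul, replaceLast]
    congr 4
    grind

theorem MultiLinC.sum {ι : Type*} (s : Finset ι) {m : ℕ} {F : ι → Coch 𝒢 V k m}
    (h : ∀ i, MultiLinC (F i)) : MultiLinC (∑ i ∈ s, F i) := by
  refine ⟨fun X z i l => ?_, fun X => ?_⟩
  · simpa only [Finset.sum_apply] using Lin.sum s fun j => (h j).1 X z i l
  · intro r y y' y'' hr
    simp only [Finset.sum_apply]
    exact Lin.sum s (fun j => (h j).2 X) r y y' y'' hr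

variable [DirectSum.Decomposition 𝒢] {L : HomNambuLieSuperalgebra 𝒢 k} (M : L.GradedModule 𝒱)

/-- Since ν is even, applying it to each component of v keeps the degree. -/
theorem gradedProj_nu (a : ZMod 2) (v : V) : gradedProj 𝒱 a (M.ν v) = M.ν (gradedProj 𝒱 a v) := by
  conv_lhs => rw [← sum_gradedProj (𝒱 := 𝒱) v, map_sum]
  refine (map_sum (gradedProjHom 𝒱 a) _ _).trans ?_
  rw [Finset.sum_eq_single a]
  · exact gradedProj_of_mem (M.ν_mem _ _ (gradedProj_mem a v))
  · intro b _ hb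
    exact gradedProj_of_mem_ne (M.ν_mem _ _ (gradedProj_mem b v)) hb
  · simp

theorem Compat.compC {m : ℕ} {F G : Coch 𝒢 V k m} (h : Compat M F G) (e : ZMod 2) :
    Compat M (compC 𝒱 e F) (compC 𝒱 e G) := fun X z => by
  refine (gradedProj_nu M _ _).symm.trans ?_
  rw [h X z]
  rfl

theorem Compat.sum {ι : Type*} (s : Finset ι) {m : ℕ} {F G : ι → Coch 𝒢 V k m}
    (h : ∀ i, Compat M (F i) (G i)) : Compat M (∑ i ∈ s, F i) (∑ i ∈ s, G i) := by
  rw [compat_iff, map_sum, map_sum]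
  exact Finset.sum_congr rfl fun i _ => (compat_iff M).1 (h i)

theorem extend_sum {ι : Type*} (s : Finset ι) {m : ℕ} (F : ι → Coch 𝒢 V k m) :
    extend (∑ i ∈ s, F i) = ∑ i ∈ s, extend (F i) := by
  funext X z
  simp only [extend, Finset.sum_apply]
  rw [Finset.sum_comm]
  simp only [Finset.sum_comm (s := s)]
  rw [Finset.sum_comm]

theorem extend_zero {m : ℕ} : extend (0 : Coch 𝒢 V k m) = 0 := by
  funext X z
  simp [extend]

theorem cochainComponent_eq {m : ℕ} (e : ZMod 2) (f : RawCochain g V k m) :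
    cochainComponent 𝒢 𝒱 e f = extend (compC 𝒱 e (res 𝒢 f)) := rfl

/-- `cochainComponent` as a linear map. -/
def cochainComponentHom (𝒢 : ZMod 2 → Submodule K g) [DirectSum.Decomposition 𝒢]
    (𝒱 : ZMod 2 → Submodule K V) [DirectSum.Decomposition 𝒱] {m : ℕ} (e : ZMod 2) :
    RawCochain g V k m →ₗ[K] RawCochain g V k m where
  toFun := cochainComponent 𝒢 𝒱 e
  map_add' f f' := by
    funext X z
    simp only [cochainComponent, Pi.add_apply, gradedProj_add, Finset.sum_add_distrib]
  map_smul' r f := by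
    funext X z
    simp only [cochainComponent, Pi.smul_apply, gradedProj_smul, Finset.smul_sum, RingHom.id_apply]

/-- The coboundary on functions of homogeneous arguments. -/
def coboundaryC {m : ℕ} (F : Coch 𝒢 V k m) : Coch 𝒢 V k (m + 1) :=
  ∑ e, cobd M m m e (compC 𝒱 e F) (compC 𝒱 e F)

theorem coboundary_eq {m : ℕ} {f : RawCochain g V k m} (hf : f ∈ cochains M m) :
    coboundary M m f = extend (coboundaryC M (res 𝒢 f)) := by
  have h := multiLinC_res (𝒢 := 𝒢) hf.1
  rw [coboundaryC, extend_sum]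
  funext X z
  simp only [Finset.sum_apply, extend]
  change ∑ e, ∑ D : Fin (m + 1) → Fin (k + 1) → ZMod 2, ∑ c,
    coboundaryFormula M e D c (cochainComponent 𝒢 𝒱 e f)
      (fun i l => gradedProj 𝒢 (D i l) (X i l)) (gradedProj 𝒢 c z) = _
  refine Finset.sum_congr rfl fun e _ => Finset.sum_congr rfl fun D _ =>
    Finset.sum_congr rfl fun c _ => ?_
  refine (coboundaryFormula_eq M e _ (fun i l => projH 𝒢 (D i l) (X i l)) (projH 𝒢 c z)).trans ?_
  rw [cochainComponent_eq, res_extend (h.compC e)]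

theorem coboundaryC_of_homogC {m : ℕ} {e : ZMod 2} {F : Coch 𝒢 V k m} (h : HomogC 𝒱 e F) :
    coboundaryC M F = cobd M m m e F F := by
  rw [coboundaryC, Finset.sum_eq_single e, compC_of_homogC h]
  · intro b _ hb
    rw [compC_of_homogC_ne h hb]
    exact map_zero (cobdHom M m m b)
  · simp

theorem multiLinC_coboundaryC {m : ℕ} {F : Coch 𝒢 V k m} (h : MultiLinC F) :
    MultiLinC (coboundaryC M F) :=
  MultiLinC.sum _ fun e => multiLinC_cobd M m m e (h.compC e) (h.compC e)

/-- Each summand of δF is homogeneous of the degree of the component it comes from, so projection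
selects one summand. -/
theorem compC_coboundaryC {m : ℕ} (e : ZMod 2) (F : Coch 𝒢 V k m) :
    compC 𝒱 e (coboundaryC M F) = cobd M m m e (compC 𝒱 e F) (compC 𝒱 e F) := by
  rw [coboundaryC, map_sum, Finset.sum_eq_single e]
  · exact compC_of_homogC (homogC_cobd M m m e (homogC_compC e F) (homogC_compC e F))
  · intro b _ hb
    exact compC_of_homogC_ne (homogC_cobd M m m b (homogC_compC b F) (homogC_compC b F)) hb.symm
  · simp

theorem coboundary_mem {m : ℕ} {f : RawCochain g V k m} (hf : f ∈ cochains M m) :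
    coboundary M m f ∈ cochains M (m + 1) := by
  rw [coboundary_eq M hf]
  have h := multiLinC_res (𝒢 := 𝒢) hf.1
  obtain ⟨-, h2, h3⟩ := (mem_cochains_iff M).1 hf
  exact extend_mem_cochains M (multiLinC_coboundaryC M h)
    (SkewC.sum _ fun e => skewC_cobd M m m e (h2.compC e) (h2.compC e) (h.compC e))
    (Compat.sum M _ fun e => compat_cobd M m m e (Compat.compC M h3 e) (Compat.compC M h3 e))

theorem res_coboundary {m : ℕ} {f : RawCochain g V k m} (hf : f ∈ cochains M m) :
    res 𝒢 (coboundary M m f) = coboundaryC M (res 𝒢 f) := by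
  rw [coboundary_eq M hf, res_extend (multiLinC_coboundaryC M (multiLinC_res hf.1))]

theorem coboundary_apply_of_isHomogCochain {m : ℕ} {e : ZMod 2} {f : RawCochain g V k m}
    (hf : f ∈ cochains M m) (he : IsHomogCochain 𝒢 𝒱 e f)
    {D : Fin (m + 1) → Fin (k + 1) → ZMod 2} {c : ZMod 2} {X : Fin (m + 1) → Fin (k + 1) → g}
    {z : g} (hX : HomogArgs 𝒢 D c X z) :
    coboundary M m f X z = coboundaryFormula M e D c f X z := by
  revert D c X z hX
  rw [forall_homogArgs]
  intro X z
  rw [coboundaryFormula_eq, ← coboundaryC_of_homogC M (isHomogCochain_iff.1 he),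
    ← res_coboundary M hf, res_apply]

theorem isHomogCochain_coboundary {m : ℕ} {e : ZMod 2} {f : RawCochain g V k m}
    (hf : f ∈ cochains M m) (he : IsHomogCochain 𝒢 𝒱 e f) :
    IsHomogCochain 𝒢 𝒱 e (coboundary M m f) := by
  rw [isHomogCochain_iff] at he ⊢
  rw [res_coboundary M hf, coboundaryC_of_homogC M he]
  exact homogC_cobd M m m e he he

theorem coboundary_coboundary {m : ℕ} {f : RawCochain g V k m} (hf : f ∈ cochains M m) :
    coboundary M (m + 1) (coboundary M m f) = 0 := by
  have h := multiLinC_res (𝒢 := 𝒢) hf.1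
  obtain ⟨-, -, h3⟩ := (mem_cochains_iff M).1 hf
  rw [coboundary_eq M (coboundary_mem M hf), res_coboundary M hf, coboundaryC]
  simp only [compC_coboundaryC]
  rw [Finset.sum_eq_zero, extend_zero]
  -- The exponents m and m + 1 of the two coboundaries are those of `cobd_cobd` with s = m, and F =
  -- G = H is the component of degree e.
  exact fun e _ => cobd_cobd M m m e (Compat.compC M h3 e) (h.compC e)

theorem cochainComponent_mem {m : ℕ} {f : RawCochain g V k m} (hf : f ∈ cochains M m)
    (e : ZMod 2) : cochainComponent 𝒢 𝒱 e f ∈ cochains M m := by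
  obtain ⟨-, h2, h3⟩ := (mem_cochains_iff M).1 hf
  exact extend_mem_cochains M ((multiLinC_res hf.1).compC e) (h2.compC e) (Compat.compC M h3 e)

theorem sum_cochainComponent {m : ℕ} {f : RawCochain g V k m} (hf : IsMultilinearCochain K f) :
    ∑ e, cochainComponent 𝒢 𝒱 e f = f := by
  simp only [cochainComponent_eq]
  rw [← extend_sum, sum_compC, extend_res hf]

theorem res_cochainComponent {m : ℕ} {f : RawCochain g V k m} (hf : IsMultilinearCochain K f)
    (e : ZMod 2) : res 𝒢 (cochainComponent 𝒢 𝒱 e f) = compC 𝒱 e (res 𝒢 f) :=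
  res_extend ((multiLinC_res hf).compC e)

theorem isHomogCochain_cochainComponent {m : ℕ} {f : RawCochain g V k m}
    (hf : IsMultilinearCochain K f) (e : ZMod 2) :
    IsHomogCochain 𝒢 𝒱 e (cochainComponent 𝒢 𝒱 e f) := by
  rw [isHomogCochain_iff, res_cochainComponent hf]
  exact homogC_compC e _

theorem cochainComponent_of_isHomogCochain {m : ℕ} {e : ZMod 2} {f : RawCochain g V k m}
    (hf : IsMultilinearCochain K f) (he : IsHomogCochain 𝒢 𝒱 e f) :
    cochainComponent 𝒢 𝒱 e f = f := by
  rw [cochainComponent_eq, compC_of_homogC (isHomogCochain_iff.1 he), extend_res hf]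

theorem cochainComponent_of_isHomogCochain_ne {m : ℕ} {e e' : ZMod 2} {f : RawCochain g V k m}
    (he : IsHomogCochain 𝒢 𝒱 e' f) (hne : e ≠ e') : cochainComponent 𝒢 𝒱 e f = 0 := by
  rw [cochainComponent_eq, compC_of_homogC_ne (isHomogCochain_iff.1 he) hne, extend_zero]

theorem coboundary_cochainComponent {m : ℕ} {f : RawCochain g V k m} (hf : f ∈ cochains M m)
    (e : ZMod 2) :
    coboundary M m (cochainComponent 𝒢 𝒱 e f) = cochainComponent 𝒢 𝒱 e (coboundary M m f) := by
  rw [coboundary_eq M (cochainComponent_mem M hf e), cochainComponent_eq e (coboundary M m f),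
    res_coboundary M hf, res_cochainComponent hf.1,
    coboundaryC_of_homogC M (homogC_compC e _), compC_coboundaryC]

theorem coboundaries_le (m : ℕ) : coboundaries M m ≤ cocycles M m := by
  cases m with
  | zero => exact bot_le
  | succ m =>
    rintro _ ⟨f, hf, rfl⟩
    exact ⟨coboundary_mem M hf, coboundary_coboundary M hf⟩

theorem cochainComponent_mem_cocycles {m : ℕ} {f : RawCochain g V k m} (hf : f ∈ cocycles M m)
    (e : ZMod 2) : cochainComponent 𝒢 𝒱 e f ∈ cocycles M m := by
  refine ⟨cochainComponent_mem M hf.1 e, ?_⟩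
  rw [SetLike.mem_coe, LinearMap.mem_ker, coboundary_cochainComponent M hf.1,
    LinearMap.mem_ker.1 hf.2]
  exact map_zero (cochainComponentHom 𝒢 𝒱 e)

theorem cochainComponent_mem_coboundaries {m : ℕ} {f : RawCochain g V k m}
    (hf : f ∈ coboundaries M m) (e : ZMod 2) :
    cochainComponent 𝒢 𝒱 e f ∈ coboundaries M m := by
  cases m with
  | zero =>
    rw [(Submodule.mem_bot K).1 hf]
    exact (Submodule.mem_bot K).2 (map_zero (cochainComponentHom 𝒢 𝒱 e))
  | succ m =>
    obtain ⟨f, hf, rfl⟩ := hf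
    exact ⟨_, cochainComponent_mem M hf e, coboundary_cochainComponent M hf e⟩

/-- Independence holds because π i is the identity on N i and kills every other summand; spanning
holds because the projections sum to the identity. -/
theorem isInternal_of_projections {ι R W : Type*} [DecidableEq ι] [Fintype ι] [Ring R]
    [AddCommGroup W] [Module R W] (N : ι → Submodule R W) (π : ι → W →ₗ[R] W)
    (hmem : ∀ i x, π i x ∈ N i) (hsum : ∀ x, ∑ i, π i x = x)
    (hsame : ∀ i, ∀ x ∈ N i, π i x = x) (hne : ∀ i j, i ≠ j → ∀ x ∈ N j, π i x = 0) :
    DirectSum.IsInternal N := by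
  refine DirectSum.isInternal_submodule_of_iSupIndep_of_iSup_eq_top ?_ ?_
  · intro i
    rw [Submodule.disjoint_def]
    intro x hx hx'
    rw [← hsame i x hx]
    have h : ⨆ j, ⨆ (_ : j ≠ i), N j ≤ LinearMap.ker (π i) :=
      iSup₂_le fun j hj y hy => hne i j hj.symm y hy
    exact h hx'
  · rw [eq_top_iff]
    intro x _
    rw [← hsum x]
    exact Submodule.sum_mem _ fun i _ => Submodule.mem_iSup_of_mem i (hmem i x)

/-- The component of degree `e` of a cocycle. -/
def cocycleComponent (m : ℕ) (e : ZMod 2) : cocycles M m →ₗ[K] cocycles M m :=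
  (cochainComponentHom 𝒢 𝒱 e).restrict fun _ hf => cochainComponent_mem_cocycles M hf e

/-- The component of degree `e` of a cohomology class. -/
def cohomologyComponent (m : ℕ) (e : ZMod 2) : cohomology M m →ₗ[K] cohomology M m :=
  Submodule.mapQ _ _ (cocycleComponent M m e) fun _ hf =>
    cochainComponent_mem_coboundaries M hf e

theorem cohomologyComponent_mk (m : ℕ) (e : ZMod 2) (f : cocycles M m) :
    cohomologyComponent M m e (Submodule.Quotient.mk f) =
      Submodule.Quotient.mk (cocycleComponent M m e f) := rfl

theorem isInternal_cohomologyPart (m : ℕ) : DirectSum.IsInternal (cohomologyPart M m) := by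
  refine isInternal_of_projections _ (cohomologyComponent M m) (fun e x => ?_) (fun x => ?_)
    (fun e x hx => ?_) fun e e' hne x hx => ?_
  · obtain ⟨f, rfl⟩ := Submodule.Quotient.mk_surjective _ x
    exact Submodule.subset_span
      ⟨cocycleComponent M m e f, isHomogCochain_cochainComponent f.2.1.1 e, rfl⟩
  · obtain ⟨f, rfl⟩ := Submodule.Quotient.mk_surjective _ x
    simp only [cohomologyComponent_mk]
    refine (map_sum (Submodule.mkQ _) _ _).symm.trans (congrArg _ (Subtype.ext ?_))
    rw [Submodule.coe_sum]
    exact sum_cochainComponent f.2.1.1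
  · have h : cohomologyPart M m e ≤ LinearMap.eqLocus (cohomologyComponent M m e) LinearMap.id := by
      refine Submodule.span_le.2 ?_
      rintro _ ⟨f, hf, rfl⟩
      exact congrArg Submodule.Quotient.mk
        (Subtype.ext (cochainComponent_of_isHomogCochain f.2.1.1 hf))
    exact h hx
  · have h : cohomologyPart M m e' ≤ LinearMap.ker (cohomologyComponent M m e) := by
      refine Submodule.span_le.2 ?_
      rintro _ ⟨f, hf, rfl⟩
      have h0 : cocycleComponent M m e f = 0 :=
        Subtype.ext (cochainComponent_of_isHomogCochain_ne hf hne)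
      rw [SetLike.mem_coe, LinearMap.mem_ker, cohomologyComponent_mk, h0]
      rfl
    exact h hx

end

end Coch

theorem sgn_smul_eq_neg_one_pow_smul {A : Type*} [AddCommGroup A] {a : ZMod 2} {n : ℕ}
    (h : a = n) (v : A) : sgn a • v = (-1 : ℤ) ^ n • v := by
  rw [h, sgn_natCast, Units.smul_def]
  simp

/-! ### The untwisted and the purely even cases -/

namespace Coch

open Homog

section

variable {K g V : Type*} [Field K] [AddCommGroup g] [Module K g] [AddCommGroup V] [Module K V]
  {𝒢 : ZMod 2 → Submodule K g} {𝒱 : ZMod 2 → Submodule K V} {k : ℕ}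
  {L : HomNambuLieSuperalgebra 𝒢 k} (M : L.GradedModule 𝒱)

/-! ### The untwisted case -/

theorem alphaT_of_untwisted (hα : L.α = LinearMap.id) (x : Fin (k + 1) → g) : L.alphaT x = x := by
  funext l
  rw [HomNambuLieSuperalgebra.alphaT, hα, LinearMap.id_apply]

theorem mem_cochains_iff_of_untwisted (hα : L.α = LinearMap.id) (hν : M.ν = LinearMap.id) {m : ℕ}
    {f : RawCochain g V k m} :
    f ∈ cochains M m ↔ IsMultilinearCochain K f ∧ IsSuperSkew 𝒢 f := by
  refine ⟨fun h => ⟨h.1, h.2.1⟩, fun h => ⟨h.1, h.2, fun X z => ?_⟩⟩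
  simp only [alphaT_of_untwisted hα, hα, hν, LinearMap.id_apply]

theorem coboundaryFormula_of_untwisted (hα : L.α = LinearMap.id) {m : ℕ} (e : ZMod 2)
    (D : Fin (m + 1) → Fin (k + 1) → ZMod 2) (c : ZMod 2) (f : RawCochain g V k m)
    (X : Fin (m + 1) → Fin (k + 1) → g) (z : g) :
    coboundaryFormula M e D c f X z = nLieSuperCoboundaryFormula L.bracket M.ρ e D c f X z := by
  have hp : ∀ x : g, (L.α ^ m) x = x := fun x => by
    rw [hα, ← Module.End.one_eq_id, one_pow, Module.End.one_apply]
  rw [coboundaryFormula, nLieSuperCoboundaryFormula]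
  simp only [hp, alphaT_of_untwisted hα, HomNambuLieSuperalgebra.wedgeTerm,
    HomNambuLieSuperalgebra.act]
  simp only [hα, LinearMap.id_apply]
  refine congrArg₂ (· + ·) (congrArg₂ (· + ·) rfl ?_) ?_
  -- The exponents i + 2 and i agree modulo 2.
  · refine Finset.sum_congr rfl fun i _ => sgn_smul_congr ?_ _
    grind
  · refine congrArg _ (Finset.sum_congr rfl fun l _ => ?_)
    rw [mixedBracket, sgn_smul_sgn_smul, Finset.sum_Ioi_castSucc, snocTuple_last]
    simp only [snocTuple_castSucc]
    refine sgn_smul_congr ?_ _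
    simp only [Fin.val_castSucc]
    ring

/-! ### The purely even case -/

theorem IsMultilinearCochain.eq_zero {m : ℕ} {f : RawCochain g V k m}
    (h : IsMultilinearCochain K f) {X : Fin m → Fin (k + 1) → g} (z : g) {i : Fin m}
    {l : Fin (k + 1)} (hX : X i l = 0) : f X z = 0 := by
  have := (h.1 X z i l).map_zero
  rwa [← hX, Function.update_eq_self, Function.update_eq_self] at this

/-- An entry declared odd is zero, so the signed relation then holds because the cochain vanishes;
for even entries the sign is trivial. -/
theorem isSuperSkew_iff_of_even (h0 : ∀ x, x ∈ 𝒢 0) (h1 : 𝒢 1 = ⊥) {m : ℕ}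
    {f : RawCochain g V k m} (hf : IsMultilinearCochain K f) :
    IsSuperSkew 𝒢 f ↔ (∀ X z (i : Fin m) (p : Fin k), f X z = -f (swapIn X i p) z) ∧
      ∀ X z (i : Fin m), (i : ℕ) + 1 = m →
        f X z = -f (replaceLast X i z) (X i (Fin.last k)) := by
  have zero_of_one : ∀ {x : g} {a : ZMod 2}, x ∈ 𝒢 a → a ≠ 0 → x = 0 := fun {x a} hx ha => by
    rcases zmod_two_eq a with rfl | rfl
    · exact absurd rfl ha
    · rwa [h1, Submodule.mem_bot] at hx
  constructor
  · intro h
    have hA : ∀ X z, HomogArgs 𝒢 (fun (_ : Fin m) (_ : Fin (k + 1)) => 0) 0 X z :=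
      fun X z => ⟨fun _ _ => h0 _, h0 _⟩
    refine ⟨fun X z i p => ?_, fun X z i hi => ?_⟩
    · simpa using (h _ _ X z (hA X z)).1 i p
    · simpa using (h _ _ X z (hA X z)).2 i hi
  · rintro ⟨h2, h3⟩ D c X z ⟨hX, hz⟩
    refine ⟨fun i p => ?_, fun i hi => ?_⟩
    · rw [h2 X z i p]
      by_cases hD : D i p.castSucc = 0
      · rw [hD, zero_mul, sgn_zero, one_smul]
      · have e : f (swapIn X i p) z = 0 := by
          -- The exchange moves the zero entry from position p to position p + 1.
          refine IsMultilinearCochain.eq_zero hf z (i := i) (l := p.succ) ?_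
          simpa [swapIn, swapAdj] using zero_of_one (hX i p.castSucc) hD
        rw [e, smul_zero]
    · rw [h3 X z i hi]
      by_cases hD : D i (Fin.last k) = 0
      · rw [hD, zero_mul, sgn_zero, one_smul]
      · rw [zero_of_one (hX i (Fin.last k)) hD, (hf.2 _).map_zero, smul_zero]

theorem mem_cochains_iff_of_even (h0 : ∀ x, x ∈ 𝒢 0) (h1 : 𝒢 1 = ⊥) {m : ℕ}
    {f : RawCochain g V k m} : f ∈ cochains M m ↔ IsHomNambuLieCochain L.α M.ν f := by
  constructor
  · rintro ⟨h2, h3, h4⟩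
    obtain ⟨h5, h6⟩ := (isSuperSkew_iff_of_even h0 h1 h2).1 h3
    exact ⟨h2, h5, h6, h4⟩
  · rintro ⟨h2, h3, h4, h5⟩
    exact ⟨h2, (isSuperSkew_iff_of_even h0 h1 h2).2 ⟨h3, h4⟩, h5⟩

/-- If some declared degree is odd, the corresponding argument is zero and so is the value, which
lies in every component. -/
theorem isHomogCochain_of_even (h0 : ∀ v, v ∈ 𝒱 0) (h1 : 𝒢 1 = ⊥) {m : ℕ}
    {f : RawCochain g V k m} (hf : IsMultilinearCochain K f) : IsHomogCochain 𝒢 𝒱 0 f := by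
  rintro D c X z ⟨hX, hz⟩
  by_cases hD : ∀ i l, D i l = 0
  · rcases zmod_two_eq c with rfl | rfl
    · simpa [hD] using h0 _
    · rw [h1, Submodule.mem_bot] at hz
      rw [hz, (hf.2 X).map_zero]
      exact Submodule.zero_mem _
  · push Not at hD
    obtain ⟨i, l, hD⟩ := hD
    have hx := hX i l
    rw [(zmod_two_eq _).resolve_left hD, h1, Submodule.mem_bot] at hx
    rw [IsMultilinearCochain.eq_zero hf z hx]
    exact Submodule.zero_mem _

theorem coboundaryFormula_of_even {m : ℕ} (f : RawCochain g V k m)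
    (X : Fin (m + 1) → Fin (k + 1) → g) (z : g) :
    coboundaryFormula M 0 (fun _ _ => 0) 0 f X z =
      homNambuLieCoboundary L.bracket L.α M.ρ f X z := by
  rw [coboundaryFormula, homNambuLieCoboundary]
  simp only [Finset.sum_const_zero, zero_mul, add_zero, sgn_zero, one_smul]
  congr 1
  · congr 1
    · congr 1
      · exact Finset.sum_congr rfl fun i _ => Finset.sum_congr rfl fun j _ =>
          sgn_smul_eq_neg_one_pow_smul (by push_cast; rfl) _
      · exact Finset.sum_congr rfl fun i _ => sgn_smul_eq_neg_one_pow_smul (by push_cast; rfl) _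
    · exact Finset.sum_congr rfl fun i _ => sgn_smul_eq_neg_one_pow_smul (by grind) _
  · rw [sgn_smul_eq_neg_one_pow_smul rfl]
    refine congrArg _ (Finset.sum_congr rfl fun l _ => ?_)
    rw [mixedBracket]
    exact sgn_smul_eq_neg_one_pow_smul (by simp) _

theorem mem_zero_of_even [DirectSum.Decomposition 𝒱] (h1 : 𝒱 1 = ⊥) (v : V) : v ∈ 𝒱 0 := by
  rw [← sum_gradedProj (𝒱 := 𝒱) v]
  refine Submodule.sum_mem _ fun a _ => ?_
  have h := gradedProj_mem (𝒱 := 𝒱) a v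
  rcases zmod_two_eq a with rfl | rfl
  · exact h
  · rw [h1, Submodule.mem_bot] at h
    rw [h]
    exact Submodule.zero_mem _

theorem coboundary_of_even [DirectSum.Decomposition 𝒢] [DirectSum.Decomposition 𝒱]
    (h1 : 𝒢 1 = ⊥) (h1' : 𝒱 1 = ⊥) {m : ℕ} {f : RawCochain g V k m} (hf : f ∈ cochains M m) :
    coboundary M m f = homNambuLieCoboundary L.bracket L.α M.ρ f := by
  funext X z
  rw [← coboundaryFormula_of_even]
  exact coboundary_apply_of_isHomogCochain M hf
    (isHomogCochain_of_even (mem_zero_of_even h1') h1 hf.1)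
    ⟨fun _ _ => mem_zero_of_even h1 _, mem_zero_of_even h1 _⟩

end

end Coch

/-! ### The theorem -/

theorem mainTheorem1 {K g V : Type*} [Field K] [AddCommGroup g] [Module K g]
    [AddCommGroup V] [Module K V]
    (𝒢 : ZMod 2 → Submodule K g) [DirectSum.Decomposition 𝒢]
    (𝒱 : ZMod 2 → Submodule K V) [DirectSum.Decomposition 𝒱]
    (k : ℕ) (L : HomNambuLieSuperalgebra 𝒢 k) (M : L.GradedModule 𝒱) :
    -- `δ^m` is given by its defining formula on homogeneous cochains and arguments
    (∀ (m : ℕ) (e : ZMod 2), ∀ f ∈ cochains M m, IsHomogCochain 𝒢 𝒱 e f →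
      ∀ (D : Fin (m + 1) → Fin (k + 1) → ZMod 2) (c : ZMod 2)
        (X : Fin (m + 1) → Fin (k + 1) → g) (z : g), HomogArgs 𝒢 D c X z →
        coboundary M m f X z = coboundaryFormula M e D c f X z) ∧
    -- `δ^m` is an even map from `C^m` to `C^{m+1}`
    (∀ (m : ℕ), ∀ f ∈ cochains M m, coboundary M m f ∈ cochains M (m + 1) ∧
      ∀ e : ZMod 2, IsHomogCochain 𝒢 𝒱 e f → IsHomogCochain 𝒢 𝒱 e (coboundary M m f)) ∧
    -- `δ^{m+1} ∘ δ^m = 0`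
    (∀ (m : ℕ), ∀ f ∈ cochains M m, coboundary M (m + 1) (coboundary M m f) = 0) ∧
    -- the graded cohomology: coboundaries are cocycles, all spaces are graded, and so is `H^m`
    (∀ (m : ℕ), coboundaries M m ≤ cocycles M m ∧
      (∀ f ∈ cochains M m, (f = ∑ e : ZMod 2, cochainComponent 𝒢 𝒱 e f) ∧
        ∀ e : ZMod 2, IsHomogCochain 𝒢 𝒱 e (cochainComponent 𝒢 𝒱 e f) ∧
          cochainComponent 𝒢 𝒱 e f ∈ cochains M m) ∧
      (∀ f ∈ cocycles M m, ∀ e : ZMod 2, cochainComponent 𝒢 𝒱 e f ∈ cocycles M m) ∧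
      (∀ f ∈ coboundaries M m, ∀ e : ZMod 2,
        cochainComponent 𝒢 𝒱 e f ∈ coboundaries M m) ∧
      DirectSum.IsInternal (cohomologyPart M m)) ∧
    -- in the purely even case this is the complex of Hom-Nambu-Lie algebras
    (𝒢 1 = ⊥ → 𝒱 1 = ⊥ → ∀ (m : ℕ) (f : RawCochain g V k m),
      (f ∈ cochains M m ↔ IsHomNambuLieCochain L.α M.ν f) ∧
      (f ∈ cochains M m → coboundary M m f = homNambuLieCoboundary L.bracket L.α M.ρ f)) ∧
    -- in the untwisted case this is the complex of `n`-Lie superalgebras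
    (L.α = LinearMap.id → M.ν = LinearMap.id → ∀ (m : ℕ) (f : RawCochain g V k m),
      (f ∈ cochains M m ↔ IsMultilinearCochain K f ∧ IsSuperSkew 𝒢 f) ∧
      (f ∈ cochains M m → ∀ e : ZMod 2, IsHomogCochain 𝒢 𝒱 e f →
        ∀ (D : Fin (m + 1) → Fin (k + 1) → ZMod 2) (c : ZMod 2)
          (X : Fin (m + 1) → Fin (k + 1) → g) (z : g), HomogArgs 𝒢 D c X z →
          coboundary M m f X z =
            nLieSuperCoboundaryFormula L.bracket M.ρ e D c f X z)) := by
  refine ⟨fun m e f hf he D c X z hX => Coch.coboundary_apply_of_isHomogCochain M hf he hX,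
    fun m f hf => ⟨Coch.coboundary_mem M hf, fun e he => Coch.isHomogCochain_coboundary M hf he⟩,
    fun m f hf => Coch.coboundary_coboundary M hf,
    fun m => ⟨Coch.coboundaries_le M m, fun f hf => ⟨(Coch.sum_cochainComponent hf.1).symm,
        fun e => ⟨Coch.isHomogCochain_cochainComponent hf.1 e, Coch.cochainComponent_mem M hf e⟩⟩,
      fun f hf e => Coch.cochainComponent_mem_cocycles M hf e,
      fun f hf e => Coch.cochainComponent_mem_coboundaries M hf e,
      Coch.isInternal_cohomologyPart M m⟩,
    fun hg hV m f => ⟨Coch.mem_cochains_iff_of_even M (Coch.mem_zero_of_even hg) hg,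
      fun hf => Coch.coboundary_of_even M hg hV hf⟩,
    fun hα hν m f => ⟨Coch.mem_cochains_iff_of_untwisted M hα hν, fun hf e he D c X z hX => ?_⟩⟩
  rw [← Coch.coboundaryFormula_of_untwisted M hα]
  exact Coch.coboundary_apply_of_isHomogCochain M hf he hX
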